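/- Let $S$ be a smooth boundaryless surface with a smooth Riemannian metric and its distance $d$, let $\Lambda\subset S$ be compact, let $U,V\subset S$ be open neighborhoods of $\Lambda$, and let $\mathcal D$ be a set of $C^2$-diffeomorphisms $f$ from $U$ onto open subsets $f(U)\subset V$ which is $C^2$-bounded: read in charts, the derivatives of order $\le 2$ of the maps $f\in\mathcal D$ are bounded on compact subsets of $U$ uniformly in $f$. Let $\sigma,\tilde\sigma,\rho,\tilde\rho\in(0,1)$ satisfy $$\frac{\tilde\sigma\tilde\rho}{\sigma\rho}>\sigma .$$ Let $\mathcal A$ be the set of pairs $(f,x)$ with $f\in\mathcal D$ and $x\in\bigcap_{n\ge0}f^{-n}(\Lambda)$ for which there is a one-dimensional subspace $E\subset T_xS$ such that, for all $n\ge 0$, $$\tilde\sigma^{\,n}\le\|Df^n(x)|_E\|\le\sigma^n\quad\text{and}\quad \tilde\rho^{\,n}\le\frac{\|Df^n(x)|_E\|^2}{|\det Df^n(x)|}\le\rho^n .$$ Then every $(f,x)\in\mathcal A$ has a one-dimensional (local) stable manifold $W(f,x)$, and $W(f,x)$ varies continuously in the $C^1$-topology with $(f,x)\in\mathcal A$,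 where $\mathcal D$ carries the $C^1$-topology (uniform convergence of $f$ and $Df$ on compact subsets of $U$). Here, a one-dimensional stable manifold of $x$ is the image $W$ of a $C^1$-embedding $\varphi:[-1,1]\to S$ with $\varphi(0)=x$ and $\varphi'(0)\in E$ (for any $E$ as above), such that: * $f^n(W)\subset U$ for all $n\ge0$, and $W$ is exponentially contracted: there are $C>0$ and $\theta\in(0,1)$ with $d(f^n(y),f^n(z))\le C\theta^n d(y,z)$ for all $y,z\in W$ and $n\ge0$; * $W$ is locally the set of points asymptotic to $x$ at the exponential rate of $E$: for every $\tau>1$ there is $C$ such that $d(f^n(x),f^n(y))\le C\tau^n\|Df^n(x)|_E\|$ for all $y\in W$ and $n\ge 0$; and there are $\kappa>0$, $\tau>1$ such that $W$ contains every point $y$ whose forward orbit stays in $U$ and satisfies $d(f^n(x),f^n(y))\le\kappa\,\tau^n\|Df^n(x)|_E\|$ for all $n\ge0$. Continuity in the $C^1$-topology means that every point of $\mathcal A$ has a neighborhood in $\mathcal A$ on which one can choose $C^1$-embeddings $\varphi_{f,x}:[-1,1]\to S$ with $\varphi_{f,x}(0)=x$ and image $W(f,x)$, such that $(f,x,t)\mapsto(\varphi_{f,x}(t),\varphi_{f,x}'(t))\in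 TS$ is continuous. -/

import Mathlib

open Set Filter Topology Manifold Bundle
open scoped ContDiff

noncomputable section

namespace SurfaceStable

section Basic

variable {S : Type*} [TopologicalSpace S] [ChartedSpace (EuclideanSpace ℝ (Fin 2)) S]
  [IsManifold (𝓡 2) ∞ S]

/-- A `C^2`-diffeomorphism defined on the open set `U`, onto an open subset of `V`. Only the values
on `U` are meaningful. -/
structure DiffeoInto (U V : Set S) extends PartialDiffeomorph (𝓡 2) (𝓡 2) S S 2 where
  source_eq : source = U
  target_subset : target ⊆ V

variable {U V : Set S}

instance : CoeFun (DiffeoInto U V) fun _ => S → S := ⟨fun f => f.toFun⟩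

/-- The `C^1`-topology: the compact-open topology of the tangent maps `Tf : TU → TS`, that is,
uniform convergence of `f` and `Df` on compact subsets of `U`. -/
instance : TopologicalSpace (DiffeoInto U V) :=
  TopologicalSpace.generateFrom
    {A | ∃ (K O : Set (TangentBundle (𝓡 2) S)), IsCompact K ∧ (∀ v ∈ K, v.proj ∈ U) ∧ IsOpen O ∧
      A = {f : DiffeoInto U V | MapsTo (tangentMap (𝓡 2) (𝓡 2) f) K O}}

/-- A set of maps is `C^2`-bounded on `U` if, read in charts, the derivatives of order `≤ 2` of its
members are bounded on compact sets, by constants that do not depend on the map. -/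
def IsC2Bounded (D : Set (DiffeoInto U V)) : Prop :=
  ∀ (p q : S) (K L : Set S), IsCompact K → K ⊆ U → K ⊆ (extChartAt (𝓡 2) p).source →
    IsCompact L → L ⊆ (extChartAt (𝓡 2) q).source →
    ∃ C : ℝ, ∀ f ∈ D, ∀ y ∈ K, f y ∈ L → ∀ k : ℕ, k ≤ 2 →
      ‖iteratedFDeriv ℝ k (extChartAt (𝓡 2) q ∘ f ∘ (extChartAt (𝓡 2) p).symm)
        (extChartAt (𝓡 2) p y)‖ ≤ C

/-- The velocity vector `(φ t, φ' t)` in the tangent bundle of a curve `φ : [-1, 1] → S`. -/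
def velocity (φ : ℝ → S) (t : ℝ) : TangentBundle (𝓡 2) S :=
  tangentMapWithin 𝓘(ℝ, ℝ) (𝓡 2) φ (Icc (-1) 1) ⟨t, (1 : ℝ)⟩

/-- `φ` is a `C^1`-embedding of the compact interval `[-1, 1]`, that is, an injective
`C^1`-immersion. -/
structure IsC1Arc (φ : ℝ → S) : Prop where
  contMDiffOn : ContMDiffOn 𝓘(ℝ, ℝ) (𝓡 2) 1 φ (Icc (-1) 1)
  injOn : InjOn φ (Icc (-1) 1)
  immersion : ∀ t ∈ Icc (-1 : ℝ) 1, (velocity φ t).2 ≠ 0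

/-- The sets `W a x`, for `(a, x) ∈ A`, are `C^1`-arcs through `x` which vary continuously with
`(a, x)` in the `C^1`-topology: locally in `A` they have parametrizations, starting from `x` at
time `0`, that depend continuously on `(a, x)` for the `C^1`-topology on maps `[-1, 1] → S`
(by compactness of `[-1, 1]`, this is the joint continuity of position and velocity).
Parametrizations are only taken locally because the arcs may not be globally orientable. -/
def VariesC1Continuously {P : Type*} [TopologicalSpace P] (A : Set (P × S))
    (W : P → S → Set S) : Prop :=
  ∀ a ∈ A, ∃ N ∈ 𝓝 a, ∃ φ : P × S → ℝ → S,
    (∀ b ∈ N ∩ A, IsC1Arc (φ b) ∧ φ b 0 = b.2 ∧ φ b '' Icc (-1) 1 = W b.1 b.2) ∧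
    ContinuousOn (fun q : (P × S) × ℝ => velocity (φ q.1) q.2) ((N ∩ A) ×ˢ Icc (-1) 1)

end Basic

section Riemannian

variable {S : Type*} [EMetricSpace S] [ChartedSpace (EuclideanSpace ℝ (Fin 2)) S]
  [IsManifold (𝓡 2) ∞ S] [RiemannianBundle (fun x : S => TangentSpace (𝓡 2) x)]

/-- The norm `‖Df^n(x)|_E‖`. -/
def normAlong (f : S → S) (n : ℕ) (x : S) (E : Submodule ℝ (TangentSpace (𝓡 2) x)) : ℝ :=
  ‖(mfderiv (𝓡 2) (𝓡 2) f^[n] x).comp E.subtypeL‖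

instance (x : S) : FiniteDimensional ℝ (TangentSpace (𝓡 2) x) :=
  inferInstanceAs (FiniteDimensional ℝ (EuclideanSpace ℝ (Fin 2)))

/-- The Jacobian `|det Df^n(x)|`, computed in orthonormal bases of `T_x S` and `T_{f^n(x)} S`. -/
def absDet (f : S → S) (n : ℕ) (x : S) : ℝ :=
  (mfderiv (𝓡 2) (𝓡 2) f^[n] x).toLinearMap.normDet

/-- `E` is a direction at `x` along which `Df^n` has two-sided exponential bounds on the contraction
and on the pinching, for all `n ≥ 0`. -/
structure IsPinchedDirection (f : S → S) (σ σ' ρ ρ' : ℝ) (x : S)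
    (E : Submodule ℝ (TangentSpace (𝓡 2) x)) : Prop where
  finrank_eq : Module.finrank ℝ E = 1
  contraction : ∀ n : ℕ, σ' ^ n ≤ normAlong f n x E ∧ normAlong f n x E ≤ σ ^ n
  pinching : ∀ n : ℕ, ρ' ^ n ≤ normAlong f n x E ^ 2 / absDet f n x ∧
    normAlong f n x E ^ 2 / absDet f n x ≤ ρ ^ n

/-- `W` is a one-dimensional (local) stable manifold of `x`, associated with the direction `E`, for
a map `f` with domain `U`. -/
structure IsStableManifold (f : S → S) (U : Set S) (x : S)
    (E : Submodule ℝ (TangentSpace (𝓡 2) x)) (W : Set S) : Prop where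
  /-- `W` is a `C^1`-arc containing `x` in its interior and tangent to `E` at `x`. -/
  exists_arc : ∃ φ : ℝ → S, IsC1Arc φ ∧ φ '' Icc (-1) 1 = W ∧ ∃ v ∈ E, velocity φ 0 = ⟨x, v⟩
  /-- The forward iterates of `W` are defined. -/
  iterate_mem : ∀ n : ℕ, ∀ y ∈ W, f^[n] y ∈ U
  /-- The forward iterates contract `W` exponentially. -/
  contracts : ∃ C θ : ℝ, 0 < θ ∧ θ < 1 ∧ ∀ n : ℕ, ∀ y ∈ W, ∀ z ∈ W,
    edist (f^[n] y) (f^[n] z) ≤ ENNReal.ofReal (C * θ ^ n) * edist y z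
  /-- The orbits of the points of `W` approach the orbit of `x` at the exponential rate of `E`. -/
  rate : ∀ τ : ℝ, 1 < τ → ∃ C : ℝ, ∀ n : ℕ, ∀ y ∈ W,
    edist (f^[n] x) (f^[n] y) ≤ ENNReal.ofReal (C * τ ^ n * normAlong f n x E)
  /-- `W` contains all the points whose orbit stays close to that of `x`, at that rate. -/
  maximal : ∃ κ τ : ℝ, 0 < κ ∧ 1 < τ ∧ ∀ y : S,
    (∀ n : ℕ, f^[n] y ∈ U ∧
      edist (f^[n] x) (f^[n] y) ≤ ENNReal.ofReal (κ * τ ^ n * normAlong f n x E)) → y ∈ W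

/-- The pairs `(f, x)` with `f ∈ D` and `x ∈ ⋂ n, f⁻ⁿ(Λ)` having a pinched direction. -/
def pinchedPoints {U V : Set S} (D : Set (DiffeoInto U V)) (Λ : Set S) (σ σ' ρ ρ' : ℝ) :
    Set (DiffeoInto U V × S) :=
  {a | a.1 ∈ D ∧ (∀ n : ℕ, a.1^[n] a.2 ∈ Λ) ∧ ∃ E, IsPinchedDirection a.1 σ σ' ρ ρ' a.2 E}

end Riemannian

end SurfaceStable

end

/-! The proof runs the Lyapunov–Perron method along each orbit and then gets all regularity from
uniqueness and compactness.

Let `v n` be the images, read in charts, of a unit vector e spanning E. Write displacements as z₁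
v_n + z₂ rot v_n. The derivative fixes z₁ up to a shear and fixes q = z₂ / m_n, where m_n = d_n /
‖v_n‖² is the ratio of transverse to longitudinal expansion. Pinching makes |m_n| grow at least like
ρ⁻ⁿ, so for an orbit with slowly growing coordinates q tends to 0. Then q is minus the tail sum of
the nonlinear terms, and only z₁ at time 0 remains free. Relative to v_n the nonlinear terms carry a
factor σⁿ, and comparing m at different times loses (ρ/ρ')ⁿ. Since σ' ≤ σ whenever a pinched
direction exists, the hypothesis gives σρ/ρ' < 1, which leaves room for weights τⁿ with τ > 1.
Existence comes from a contraction (`exists_bounded_orbit`), while uniqueness and Lipschitz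
dependence come from a weighted supremum estimate (`norm_le_of_slow_growth`). For nonlinear orbits
these become `exists_asymptotic_orbit`, `norm_sub_le` and `norm_tangent_le`.

On the surface, the chart used at a point is taken from a finite family and does not vary
continuously with the point. The free parameter is therefore a chart-independent one, the height ⟨DΦ
e, Φ y - Φ x⟩ for a globally defined smooth Φ immersive on Λ. The stable manifold is the set of
points shadowing x at the rate of E with small height, parametrized by its height.

Any limit of shadowing points is a shadowing point, and any limit of difference quotients is a
vector decaying at the rate of e. Each is determined by its height, respectively by its derivative
of height, so limits along ultrafilters have only one possible value. This yields differentiability,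
the C¹ property and continuity in (f, x) (`exists_hasDerivWithinAt`, `GoodVector.tendsto_velocity`).
The direction itself is continuous up to sign, because two independent pinched vectors would violate
the decay of a Gram determinant (`IsPinchedVector.limit_eq_inner_smul`). The sign is fixed locally.
The size of the manifold depends on f only through the least expansion of Df over Λ, which is
continuous in the C¹-topology. -/

namespace SurfaceStable

/-! ### Perturbed shears and the Lyapunov–Perron operator -/

/-- Decay of the transverse coordinate and boundedness of the longitudinal coordinate along a
perturbation of a sequence of shears, when the transverse coordinate tends to zero. -/
theorem shear_bounds {p q α β γ M : ℕ → ℝ} {B X θ : ℝ} (hθ0 : 0 ≤ θ) (hθ1 : θ < 1)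
    (hB : 0 ≤ B) (hX : 0 ≤ X) (hM : ∀ n, 0 < M n)
    (hp : ∀ n, p (n + 1) = p n + γ n * q n + α n) (hq : ∀ n, q (n + 1) = q n + β n)
    (hγ : ∀ n, |γ n| ≤ B * M n) (hα : ∀ n, |α n| ≤ X * θ ^ n)
    (hβ : ∀ n, ∀ j ≤ n, M j * |β n| ≤ X * θ ^ n) (hlim : Tendsto q atTop (𝓝 0)) :
    (∀ n, M n * |q n| ≤ X * (1 - θ)⁻¹ * θ ^ n) ∧
      ∀ n, |p n - p 0| ≤ X * (B * (1 - θ)⁻¹ + 1) * (1 - θ)⁻¹ := by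
  have hc : 0 < 1 - θ := by linarith
  have hgeom : ∀ m, ∑ k ∈ Finset.range m, θ ^ k ≤ (1 - θ)⁻¹ := fun m => by
    rw [← tsum_geometric_of_lt_one hθ0 hθ1]
    exact (summable_geometric_of_lt_one hθ0 hθ1).sum_le_tsum _ fun _ _ => by positivity
  have h1 : ∀ n, M n * |q n| ≤ X * (1 - θ)⁻¹ * θ ^ n := by
    intro n
    -- Telescoping from time n up to time m + n. The limit m → ∞ then removes the boundary term,
    -- which is where `hlim` replaces any information on q at time 0.
    have key : ∀ m, M n * |q n| ≤
        M n * |q (m + n)| + X * θ ^ n * ∑ k ∈ Finset.range m, θ ^ k := by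
      intro m
      induction m with
      | zero => simp
      | succ m ih =>
        have e1 : q (m + n) = q (m + 1 + n) - β (m + n) := by
          rw [show m + 1 + n = m + n + 1 by ring, hq]; ring
        have e2 : |q (m + n)| ≤ |q (m + 1 + n)| + |β (m + n)| := by rw [e1]; exact abs_sub _ _
        have e3 := hβ (m + n) n (by omega)
        have e4 := mul_le_mul_of_nonneg_left e2 (hM n).le
        rw [Finset.sum_range_succ, mul_add]
        have e5 : X * θ ^ (m + n) = X * θ ^ n * θ ^ m := by rw [pow_add]; ring
        nlinarith
    have hl : Tendsto (fun m => M n * |q (m + n)| + X * θ ^ n * (1 - θ)⁻¹) atTop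
        (𝓝 (M n * |0| + X * θ ^ n * (1 - θ)⁻¹)) :=
      (((hlim.comp (tendsto_add_atTop_nat n)).abs).const_mul _).add_const _
    have := ge_of_tendsto' hl fun m => (key m).trans
      (by gcongr; exact hgeom m)
    simp only [abs_zero, mul_zero, zero_add] at this
    linarith
  refine ⟨h1, fun n => ?_⟩
  have key : |p n - p 0| ≤ X * (B * (1 - θ)⁻¹ + 1) * ∑ k ∈ Finset.range n, θ ^ k := by
    induction n with
    | zero => simp
    | succ n ih =>
      rw [Finset.sum_range_succ, mul_add]
      have e1 : p (n + 1) - p 0 = (p n - p 0) + (γ n * q n + α n) := by rw [hp]; ring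
      have e2 : |γ n * q n + α n| ≤ X * (B * (1 - θ)⁻¹ + 1) * θ ^ n := by
        refine (abs_add_le _ _).trans ?_
        have : |γ n * q n| ≤ B * (X * (1 - θ)⁻¹ * θ ^ n) := by
          rw [abs_mul]
          calc |γ n| * |q n| ≤ B * M n * |q n| := by gcongr; exact hγ n
            _ = B * (M n * |q n|) := by ring
            _ ≤ _ := mul_le_mul_of_nonneg_left (h1 n) hB
        have := hα n
        nlinarith
      rw [e1]
      exact (abs_add_le _ _).trans (add_le_add ih e2)
  refine key.trans ?_
  have : 0 ≤ B * (1 - θ)⁻¹ + 1 := by positivity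
  gcongr
  exact hgeom n

/-- The smallness threshold for perturbations of shears. -/
noncomputable def shearConst (B θ : ℝ) : ℝ := (1 + B * (1 - θ)⁻¹) * (1 + (1 - θ)⁻¹)

theorem one_le_shearConst {B θ : ℝ} (hθ1 : θ < 1) (hB : 0 ≤ B) : 1 ≤ shearConst B θ := by
  have hc : 0 < (1 - θ)⁻¹ := inv_pos.2 (by linarith)
  unfold shearConst
  have : 0 ≤ B * (1 - θ)⁻¹ := by positivity
  nlinarith [mul_nonneg this hc.le]

/-- The Lyapunov–Perron fixed point: existence of bounded orbits of small perturbations of a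
sequence of shears. -/
theorem exists_bounded_orbit {α β : ℕ → ℝ × ℝ → ℝ} {γ m : ℕ → ℝ} {χ : ℝ × ℝ → ℝ}
    {B η θ b s : ℝ} (hθ0 : 0 ≤ θ) (hθ1 : θ < 1) (hB : 0 ≤ B) (hη : 0 ≤ η)
    (hηL : η * shearConst B θ ≤ 1 / 2) (hm : ∀ n, m n ≠ 0) (hγ : ∀ n, |γ n| ≤ B * |m n|)
    (hα0 : ∀ n, α n 0 = 0) (hβ0 : ∀ n, β n 0 = 0) (hχ0 : χ 0 = 0)
    (hα : ∀ n z z', ‖z‖ ≤ b → ‖z'‖ ≤ b → |α n z - α n z'| ≤ η * θ ^ n * ‖z - z'‖)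
    (hβ : ∀ n, ∀ j ≤ n, ∀ z z', ‖z‖ ≤ b → ‖z'‖ ≤ b →
      |m j| * |β n z - β n z'| ≤ η * θ ^ n * ‖z - z'‖)
    (hχ : ∀ z z', ‖z‖ ≤ b → ‖z'‖ ≤ b → |χ z - χ z'| ≤ η * ‖z - z'‖ + B * |z.2 - z'.2|)
    (hs : 2 * |s| ≤ b) :
    ∃ z : ℕ → ℝ × ℝ, (∀ n, ‖z n‖ ≤ 2 * |s|) ∧ (z 0).1 + χ (z 0) = s ∧
      (∀ n, (z (n + 1)).1 = (z n).1 + γ n * ((z n).2 / m n) + α n (z n)) ∧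
      ∀ n, (z (n + 1)).2 / m (n + 1) = (z n).2 / m n + β n (z n) := by
  set c := (1 - θ)⁻¹ with hcdef
  have hc : 0 < c := inv_pos.2 (by linarith)
  have hL : shearConst B θ = (1 + B * c) * (1 + c) := rfl
  have hBc : 0 ≤ B * c := by positivity
  have hηc : η * c ≤ 1 / 2 := by
    refine le_trans ?_ hηL
    rw [hL]; gcongr; nlinarith
  set b' := 2 * |s|
  have hb' : 0 ≤ b' := by positivity
  have hM : ∀ n, 0 < |m n| := fun n => abs_pos.2 (hm n)
  -- the operator
  let q : (ℕ → ℝ × ℝ) → ℕ → ℝ := fun z n => -∑' k, β (k + n) (z (k + n))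
  -- The initial value is chosen so that a fixed point satisfies the condition at time 0. The second
  -- argument of χ is the updated transverse coordinate, not `(z 0).2`: χ depends on it with the
  -- possibly large constant B, and only the updated coordinate already carries the small factor η
  -- c.
  let p : (ℕ → ℝ × ℝ) → ℕ → ℝ := fun z n => s - χ ((z 0).1, m 0 * q z 0) +
    ∑ k ∈ Finset.range n, (γ k * q z k + α k (z k))
  have hball : ∀ z : ℕ → ℝ × ℝ, (∀ n, ‖z n‖ ≤ b') → ∀ n, ‖z n‖ ≤ b :=
    fun z hz n => (hz n).trans hs
  have h0b : ‖(0 : ℝ × ℝ)‖ ≤ b := by simpa using hb'.trans hs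
  have hsum : ∀ z : ℕ → ℝ × ℝ, (∀ n, ‖z n‖ ≤ b') → Summable fun k => β k (z k) := by
    intro z hz
    refine Summable.of_norm_bounded
      (g := fun k => (|m 0|⁻¹ * η * b') * θ ^ k) ((summable_geometric_of_lt_one hθ0 hθ1).mul_left _)
      fun k => ?_
    have := hβ k 0 (Nat.zero_le _) (z k) 0 (hball z hz k) h0b
    rw [hβ0, sub_zero, sub_zero] at this
    have h2 : |m 0| * |β k (z k)| ≤ η * θ ^ k * b' := this.trans (by gcongr; exact hz k)
    rw [Real.norm_eq_abs, mul_assoc, mul_assoc, inv_mul_eq_div, le_div_iff₀ (hM 0)]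
    linarith
  have hq : ∀ z : ℕ → ℝ × ℝ, (∀ n, ‖z n‖ ≤ b') → ∀ n, q z (n + 1) = q z n + β n (z n) := by
    intro z hz n
    have := ((summable_nat_add_iff n).2 (hsum z hz)).tsum_eq_zero_add
    simp only [q]
    rw [this]
    simp only [zero_add, neg_add_rev]
    have e : ∀ k, k + (n + 1) = k + 1 + n := fun k => by ring
    simp only [e]; ring
  have hqlim : ∀ z : ℕ → ℝ × ℝ, Tendsto (q z) atTop (𝓝 0) := by
    intro z
    have := (tendsto_sum_nat_add fun k => β k (z k)).neg
    simpa using this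
  have hdiff : ∀ z z' : ℕ → ℝ × ℝ, (∀ n, ‖z n‖ ≤ b') → (∀ n, ‖z' n‖ ≤ b') → ∀ d,
      (∀ n, ‖z n - z' n‖ ≤ d) → ∀ n,
      ‖((p z n, m n * q z n) : ℝ × ℝ) - (p z' n, m n * q z' n)‖ ≤ d / 2 ∧
        |m n * q z n - m n * q z' n| ≤ d / 2 := by
    intro z z' hz hz' d hd
    have hd0 : 0 ≤ d := (norm_nonneg _).trans (hd 0)
    obtain ⟨h1, h2⟩ := shear_bounds (p := fun n => p z n - p z' n) (q := fun n => q z n - q z' n)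
      (α := fun n => α n (z n) - α n (z' n)) (β := fun n => β n (z n) - β n (z' n))
      (γ := γ) (M := fun n => |m n|) (B := B) (X := η * d) hθ0 hθ1 hB (by positivity) hM
      (fun n => by simp only [p]; rw [Finset.sum_range_succ, Finset.sum_range_succ]; ring)
      (fun n => by simp only [hq z hz, hq z' hz']; ring) hγ
      (fun n => (hα n _ _ (hball z hz n) (hball z' hz' n)).trans (by
        have := hd n
        calc η * θ ^ n * ‖z n - z' n‖ ≤ η * θ ^ n * d := by gcongr
          _ = _ := by ring))
      (fun n j hj => (hβ n j hj _ _ (hball z hz n) (hball z' hz' n)).trans (by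
        have := hd n
        calc η * θ ^ n * ‖z n - z' n‖ ≤ η * θ ^ n * d := by gcongr
          _ = _ := by ring))
      (by simpa using (hqlim z).sub (hqlim z'))
    have hr : ∀ n, |m n * q z n - m n * q z' n| ≤ η * c * d := by
      intro n
      rw [← mul_sub, abs_mul]
      refine (h1 n).trans ?_
      have : θ ^ n ≤ 1 := pow_le_one₀ hθ0 hθ1.le
      calc η * d * c * θ ^ n ≤ η * d * c * 1 := by gcongr
        _ = _ := by ring
    have hr' : ∀ n, |m n * q z n - m n * q z' n| ≤ d / 2 := fun n => (hr n).trans (by nlinarith)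
    -- Needed to evaluate χ inside the ball where its Lipschitz bound holds.
    have hr0 : ∀ z : ℕ → ℝ × ℝ, (∀ n, ‖z n‖ ≤ b') → |m 0 * q z 0| ≤ b' := by
      intro z hz
      obtain ⟨h1, -⟩ := shear_bounds (p := fun n => ∑ k ∈ Finset.range n, γ k * q z k)
        (q := q z) (α := 0) (β := fun n => β n (z n)) (γ := γ) (M := fun n => |m n|) (B := B)
        (X := η * b') hθ0 hθ1 hB (by positivity) hM
        (fun n => by rw [Finset.sum_range_succ]; simp) (hq z hz) hγ
        (fun n => by simp only [Pi.zero_apply, abs_zero]; positivity)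
        (fun n j hj => by
          have := hβ n j hj (z n) 0 (hball z hz n) h0b
          rw [hβ0, sub_zero, sub_zero] at this
          refine this.trans ?_
          have := hz n
          calc η * θ ^ n * ‖z n‖ ≤ η * θ ^ n * b' := by gcongr
            _ = _ := by ring) (hqlim z)
      have := h1 0
      rw [abs_mul]
      simp only [pow_zero, mul_one] at this
      refine this.trans ?_
      calc η * b' * c = η * c * b' := by ring
        _ ≤ 1 / 2 * b' := by gcongr
        _ ≤ b' := by linarith
    intro n
    refine ⟨?_, hr' n⟩
    rw [Prod.mk_sub_mk, Prod.norm_mk, Real.norm_eq_abs, Real.norm_eq_abs]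
    refine max_le ?_ (hr' n)
    have h3 := h2 n
    have hp0 : |p z 0 - p z' 0| ≤ η * d + B * (η * c * d) := by
      simp only [p, Finset.range_zero, Finset.sum_empty, add_zero]
      have e : s - χ ((z 0).1, m 0 * q z 0) - (s - χ ((z' 0).1, m 0 * q z' 0)) =
        -(χ ((z 0).1, m 0 * q z 0) - χ ((z' 0).1, m 0 * q z' 0)) := by ring
      rw [e, abs_neg]
      have hin : ∀ z : ℕ → ℝ × ℝ, (∀ n, ‖z n‖ ≤ b') → ‖((z 0).1, m 0 * q z 0)‖ ≤ b := by
        intro z hz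
        rw [Prod.norm_mk]
        exact (max_le ((norm_fst_le _).trans (hz 0)) (hr0 z hz)).trans hs
      refine (hχ _ _ (hin z hz) (hin z' hz')).trans ?_
      refine add_le_add ?_ (mul_le_mul_of_nonneg_left (hr 0) hB)
      refine mul_le_mul_of_nonneg_left ?_ hη
      rw [Prod.mk_sub_mk, Prod.norm_mk]
      refine max_le (le_trans ?_ (hd 0)) ((hr' 0).trans (by linarith))
      exact norm_fst_le (z 0 - z' 0)
    have h4 : |p z n - p z' n| ≤ η * d + B * (η * c * d) + η * d * (B * c + 1) * c := by
      have : p z n - p z' n = (p z 0 - p z' 0) + (p z n - p z' n - (p z 0 - p z' 0)) := by ring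
      rw [this]
      exact (abs_add_le _ _).trans (add_le_add hp0 h3)
    refine h4.trans ?_
    -- The three contributions (χ in its first variable, χ in its second, the sum along the orbit)
    -- add up to `shearConst`, whose product with η is at most 1/2.
    have : η * d + B * (η * c * d) + η * d * (B * c + 1) * c = η * shearConst B θ * d := by
      rw [hL]; ring
    rw [this]
    nlinarith
  have hzero : ∀ n, ((p 0 n, m n * q 0 n) : ℝ × ℝ) = (s, 0) := by
    have hq0 : ∀ n, q 0 n = 0 := fun n => by simp [q, hβ0]
    intro n
    simp [p, hq0, hα0, show χ (0, 0) = 0 from hχ0]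
  -- The operator sends 0 to the constant sequence (s, 0), so the factor 1/2 makes the ball of
  -- radius 2|s| invariant.
  have hmaps : ∀ z : ℕ → ℝ × ℝ, (∀ n, ‖z n‖ ≤ b') → ∀ n, ‖((p z n, m n * q z n) : ℝ × ℝ)‖ ≤ b' := by
    intro z hz n
    have := (hdiff z 0 hz (by simpa using hb') b' (by simpa using hz) n).1
    rw [hzero] at this
    have h2 : ‖((s, 0) : ℝ × ℝ)‖ = |s| := by simp [Prod.norm_mk]
    calc _ ≤ ‖((p z n, m n * q z n) : ℝ × ℝ) - (s, 0)‖ + ‖((s, 0) : ℝ × ℝ)‖ := by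
          conv_lhs => rw [← sub_add_cancel ((p z n, m n * q z n) : ℝ × ℝ) (s, 0)]
          exact norm_add_le _ _
      _ ≤ b' / 2 + |s| := by rw [h2]; gcongr
      _ = b' := by simp only [b']; ring
  -- the complete space on which the operator contracts
  let Y : Set (BoundedContinuousFunction ℕ (ℝ × ℝ)) := {z | ∀ n, ‖z n‖ ≤ b'}
  have hYc : IsClosed Y := by
    simp only [Y, ofPred_forall]
    exact isClosed_iInter fun n => isClosed_le
      ((continuous_eval_const n).norm) continuous_const
  let T : Y → Y := fun z => ⟨BoundedContinuousFunction.ofNormedAddCommGroupDiscrete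
    (fun n => (p z.1 n, m n * q z.1 n)) b' (hmaps z.1 z.2), hmaps z.1 z.2⟩
  have hT : ContractingWith (1 / 2) T := by
    refine ⟨by
      rw [← NNReal.coe_lt_coe]; norm_num, LipschitzWith.of_dist_le_mul fun z z' => ?_⟩
    rw [Subtype.dist_eq, BoundedContinuousFunction.dist_le (by positivity)]
    intro n
    rw [dist_eq_norm]
    refine ((hdiff z.1 z'.1 z.2 z'.2 (dist z z') (fun k => ?_) n).1).trans ?_
    · rw [← dist_eq_norm]
      exact BoundedContinuousFunction.dist_coe_le_dist k
    · push_cast; linarith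
  have : CompleteSpace Y := hYc.completeSpace_coe
  have : Nonempty Y := ⟨⟨0, fun n => by simpa using hb'⟩⟩
  obtain ⟨z, hz⟩ : ∃ z, T z = z := ⟨_, hT.fixedPoint_isFixedPt⟩
  have hzn : ∀ n, z.1 n = (p z.1 n, m n * q z.1 n) := fun n => by
    conv_lhs => rw [← hz]
    rfl
  have hzq : ∀ n, (z.1 n).2 / m n = q z.1 n := fun n => by
    rw [hzn n]
    exact mul_div_cancel_left₀ _ (hm n)
  refine ⟨z.1, z.2, ?_, fun n => ?_, fun n => ?_⟩
  · have h1 : (z.1 0).1 = s - χ ((z.1 0).1, m 0 * q z.1 0) := by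
      conv_lhs => rw [hzn 0]
      simp [p]
    have h2 : m 0 * q z.1 0 = (z.1 0).2 := by rw [hzn 0]
    rw [h2] at h1
    have h3 : (z.1 0).1 = s - χ (z.1 0) := h1
    linarith
  · rw [hzq]
    have h1 : ∀ n, (z.1 n).1 = p z.1 n := fun n => congrArg Prod.fst (hzn n)
    rw [h1, h1]
    simp only [p]
    rw [Finset.sum_range_succ]
    ring
  · rw [hzq, hzq]
    exact hq z.1 z.2 n

/-- An orbit of a small perturbation of a sequence of shears that grows slowly is bounded by its
initial longitudinal coordinate. -/
theorem norm_le_of_slow_growth {z : ℕ → ℝ × ℝ} {α β γ m : ℕ → ℝ} {B η θ τ s X₀ : ℝ}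
    (hθ0 : 0 ≤ θ) (hθ1 : θ < 1) (hB : 0 ≤ B) (hη : 0 ≤ η) (hηL : η * shearConst B θ ≤ 1 / 2)
    (hτ : 1 ≤ τ) (hm : ∀ n, m n ≠ 0) (hγ : ∀ n, |γ n| ≤ B * |m n|)
    (hmlim : Tendsto (fun n => τ ^ n / |m n|) atTop (𝓝 0))
    (hp : ∀ n, (z (n + 1)).1 = (z n).1 + γ n * ((z n).2 / m n) + α n)
    (hq : ∀ n, (z (n + 1)).2 / m (n + 1) = (z n).2 / m n + β n)
    (hα : ∀ n, τ ^ n * |α n| ≤ η * θ ^ n * ‖z n‖)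
    (hβ : ∀ n, ∀ j ≤ n, |m j| * (τ ^ n * |β n|) ≤ η * θ ^ n * ‖z n‖)
    (hX₀ : ∀ n, ‖z n‖ ≤ X₀ * τ ^ n) (hs : |(z 0).1| ≤ |s| + η * ‖z 0‖ + B * |(z 0).2|) (n : ℕ) :
    ‖z n‖ ≤ 2 * |s| := by
  have hτn : ∀ n, (0 : ℝ) < τ ^ n := fun n => by positivity
  have hτ1 : ∀ n, (1 : ℝ) ≤ τ ^ n := fun n => one_le_pow₀ hτ
  have hM : ∀ n, 0 < |m n| := fun n => abs_pos.2 (hm n)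
  have hc : 0 < (1 - θ)⁻¹ := inv_pos.2 (by linarith)
  have hbdd : BddAbove (range fun n => ‖z n‖ / τ ^ n) := ⟨X₀, by
    rintro _ ⟨n, rfl⟩
    exact (div_le_iff₀ (hτn n)).2 (hX₀ n)⟩
  -- The weighted supremum is finite by `hX₀`. The aim is the self-improving inequality X ≤ |s| + X
  -- / 2, which removes the dependence on X₀.
  set X := ⨆ n, ‖z n‖ / τ ^ n
  have hX : ∀ n, ‖z n‖ ≤ X * τ ^ n := fun n =>
    (div_le_iff₀ (hτn n)).1 (le_ciSup hbdd n)
  have hXn : 0 ≤ X := (by positivity : (0 : ℝ) ≤ ‖z 0‖ / τ ^ 0).trans (le_ciSup hbdd 0)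
  -- Slow growth enters only here: the transverse coordinate grows at most like τⁿ, which is
  -- negligible against |m n|.
  have hlim : Tendsto (fun n => (z n).2 / m n) atTop (𝓝 0) := by
    rw [tendsto_zero_iff_abs_tendsto_zero]
    refine squeeze_zero (fun n => abs_nonneg _) (fun n => ?_)
      (by simpa using hmlim.const_mul X)
    simp only [Function.comp, abs_div]
    rw [← mul_div_assoc]
    have := (norm_snd_le (z n)).trans (hX n)
    gcongr
    exact this
  have hdiv : ∀ n x, τ ^ n * x ≤ η * θ ^ n * ‖z n‖ → x ≤ η * X * θ ^ n := by
    intro n x hx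
    refine le_of_mul_le_mul_left (hx.trans ?_) (hτn n)
    calc η * θ ^ n * ‖z n‖ ≤ η * θ ^ n * (X * τ ^ n) := by gcongr; exact hX n
      _ = _ := by ring
  obtain ⟨h1, h2⟩ := shear_bounds (p := fun n => (z n).1) (q := fun n => (z n).2 / m n)
    (α := α) (β := β) (γ := γ) (M := fun n => |m n|) (B := B) (X := η * X) hθ0 hθ1 hB
    (by positivity) hM hp hq hγ (fun n => hdiv n _ (hα n))
    (fun n j hj => hdiv n _ (by linarith [hβ n j hj])) hlim
  have hz2 : ∀ n, |(z n).2| ≤ η * X * (1 - θ)⁻¹ := by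
    intro n
    have := h1 n
    rw [abs_div, mul_div_cancel₀ _ (hM n).ne'] at this
    refine this.trans (mul_le_of_le_one_right (by positivity) (pow_le_one₀ hθ0 hθ1.le))
  have hL1 := one_le_shearConst hθ1 hB
  have hz : ∀ n, ‖z n‖ ≤ |s| + X / 2 := by
    intro n
    have hz0 : ‖z 0‖ ≤ X := by simpa using hX 0
    have e : |s| + η * X * shearConst B θ ≤ |s| + X / 2 := by nlinarith
    refine le_trans ?_ e
    have hBc : 0 ≤ B * (1 - θ)⁻¹ := by positivity
    have hηX : 0 ≤ η * X := by positivity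
    refine (norm_prod_le_iff).2 ⟨?_, ?_⟩
    · have e1 : |(z n).1| ≤ |(z 0).1| + |(z n).1 - (z 0).1| := by
        have := abs_add_le (z 0).1 ((z n).1 - (z 0).1)
        simpa using this
      have e2 := h2 n
      have e3 := mul_le_mul_of_nonneg_left (hz2 0) hB
      have e4 := mul_le_mul_of_nonneg_left hz0 hη
      have e5 : η * X * shearConst B θ = η * X + B * (η * X * (1 - θ)⁻¹) +
        η * X * (B * (1 - θ)⁻¹ + 1) * (1 - θ)⁻¹ := by unfold shearConst; ring
      rw [Real.norm_eq_abs]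
      linarith
    · rw [Real.norm_eq_abs]
      refine (hz2 n).trans ?_
      have : (1 - θ)⁻¹ ≤ shearConst B θ := by unfold shearConst; nlinarith
      have := mul_le_mul_of_nonneg_left this hηX
      linarith [abs_nonneg s]
  have hXs : X ≤ |s| + X / 2 := by
    refine ciSup_le fun n => ?_
    rw [div_le_iff₀ (hτn n)]
    refine (hz n).trans (le_mul_of_one_le_right (by positivity) (hτ1 n))
  linarith [hz n]

end SurfaceStable

/-! ### Conformal coordinates along a pinched orbit in the plane -/

namespace SurfaceStable

/-- The plane in which charts take their values. -/
abbrev Plane := EuclideanSpace ℝ (Fin 2)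

/-- The oriented area of the parallelogram spanned by two plane vectors. -/
def area (u w : Plane) : ℝ := u 0 * w 1 - u 1 * w 0

/-- The rotation by a right angle. -/
def rot (u : Plane) : Plane := !₂[-u 1, u 0]

theorem plane_inner (u w : Plane) : inner ℝ u w = u 0 * w 0 + u 1 * w 1 := by
  simp [PiLp.inner_apply, Fin.sum_univ_two, mul_comm]

theorem plane_norm_sq (u : Plane) : ‖u‖ ^ 2 = u 0 ^ 2 + u 1 ^ 2 := by
  simp [EuclideanSpace.norm_sq_eq, Fin.sum_univ_two]

theorem area_add_right (u w w' : Plane) : area u (w + w') = area u w + area u w' := by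
  simp [area]; ring

theorem area_sub_right (u w w' : Plane) : area u (w - w') = area u w - area u w' := by
  simp [area]; ring

theorem inner_sq_add_area_sq (u w : Plane) :
    (inner ℝ u w) ^ 2 + area u w ^ 2 = ‖u‖ ^ 2 * ‖w‖ ^ 2 := by
  rw [plane_inner, plane_norm_sq, plane_norm_sq, area]; ring

theorem abs_area_le (u w : Plane) : |area u w| ≤ ‖u‖ * ‖w‖ := by
  refine abs_le_of_sq_le_sq ?_ (by positivity)
  rw [mul_pow, ← inner_sq_add_area_sq]
  nlinarith [sq_nonneg (inner ℝ u w)]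

theorem norm_rot (u : Plane) : ‖rot u‖ = ‖u‖ := by
  rw [← sq_eq_sq₀ (norm_nonneg _) (norm_nonneg _), plane_norm_sq, plane_norm_sq]
  simp [rot]; ring

/-- The conformal coordinates of `ζ` with respect to the vector `v`. -/
noncomputable def conf (v ζ : Plane) : ℝ × ℝ := (inner ℝ v ζ / ‖v‖ ^ 2, area v ζ / ‖v‖ ^ 2)

/-- The vector with given conformal coordinates with respect to `v`. -/
noncomputable def unconf (v : Plane) (z : ℝ × ℝ) : Plane := z.1 • v + z.2 • rot v

theorem unconf_conf {v : Plane} (hv : v ≠ 0) (ζ : Plane) : unconf v (conf v ζ) = ζ := by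
  have h : ‖v‖ ^ 2 ≠ 0 := by simpa using hv
  have e := plane_norm_sq v
  ext i
  fin_cases i <;> simp [unconf, conf, plane_inner, area, rot] <;> field_simp <;> rw [e] <;> ring

theorem conf_unconf {v : Plane} (hv : v ≠ 0) (z : ℝ × ℝ) : conf v (unconf v z) = z := by
  have h : ‖v‖ ^ 2 ≠ 0 := by simpa using hv
  have e := plane_norm_sq v
  ext <;> simp [unconf, conf, plane_inner, area, rot] <;> field_simp <;> rw [e] <;> ring

theorem conf_sub (v ζ ζ' : Plane) : conf v (ζ - ζ') = conf v ζ - conf v ζ' := by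
  simp [conf, inner_sub_right, area_sub_right, sub_div]

theorem unconf_sub (v : Plane) (z z' : ℝ × ℝ) :
    unconf v (z - z') = unconf v z - unconf v z' := by
  simp [unconf, sub_smul]; abel

theorem norm_conf_le {v : Plane} (hv : v ≠ 0) (ζ : Plane) : ‖conf v ζ‖ ≤ ‖ζ‖ / ‖v‖ := by
  have h : 0 < ‖v‖ := norm_pos_iff.2 hv
  have e : ‖ζ‖ / ‖v‖ = ‖v‖ * ‖ζ‖ / ‖v‖ ^ 2 := by field_simp
  rw [e, conf, Prod.norm_mk]
  refine max_le ?_ ?_ <;> rw [Real.norm_eq_abs, abs_div, abs_of_pos (by positivity : 0 < ‖v‖ ^ 2)]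
  · gcongr; exact abs_real_inner_le_norm _ _
  · gcongr; exact abs_area_le _ _

theorem norm_unconf_le (v : Plane) (z : ℝ × ℝ) : ‖unconf v z‖ ≤ 2 * ‖v‖ * ‖z‖ := by
  refine (norm_add_le _ _).trans ?_
  rw [norm_smul, norm_smul, norm_rot]
  have h1 := norm_fst_le z
  have h2 := norm_snd_le z
  have h3 := norm_nonneg v
  nlinarith

/-- A quantitatively `C^{1,1}` map near the origin, fixing the origin. -/
structure HasLipDeriv {E G : Type*} [NormedAddCommGroup E] [NormedSpace ℝ E]
    [NormedAddCommGroup G] [NormedSpace ℝ G] (K : ℝ) (F : E → G) (F' : E → E →L[ℝ] G) :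
    Prop where
  map_zero : F 0 = 0
  hasFDerivAt : ∀ ζ, ‖ζ‖ ≤ K⁻¹ → HasFDerivAt F (F' ζ) ζ
  norm_le : ‖F' 0‖ ≤ K
  lip : ∀ ζ ζ', ‖ζ‖ ≤ K⁻¹ → ‖ζ'‖ ≤ K⁻¹ → ‖F' ζ - F' ζ'‖ ≤ K * ‖ζ - ζ'‖

/-- Mean value inequality for F minus its linear part at 0. On the ball of radius R the derivative
of this difference is at most K R, so the remainder is Lipschitz with a constant proportional to the
radius. -/
theorem HasLipDeriv.norm_remainder_le {E G : Type*} [NormedAddCommGroup E] [NormedSpace ℝ E]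
    [NormedAddCommGroup G] [NormedSpace ℝ G] {K : ℝ} {F : E → G} {F' : E → E →L[ℝ] G}
    (h : HasLipDeriv K F F') (hK : 0 < K) {R : ℝ} (hR : R ≤ K⁻¹) {ζ ζ' : E} (hζ : ‖ζ‖ ≤ R)
    (hζ' : ‖ζ'‖ ≤ R) :
    ‖(F ζ - F' 0 ζ) - (F ζ' - F' 0 ζ')‖ ≤ K * R * ‖ζ - ζ'‖ := by
  have hb : ∀ x : E, x ∈ Metric.closedBall (0 : E) R ↔ ‖x‖ ≤ R := fun x => by simp
  refine (convex_closedBall (0 : E) R).norm_image_sub_le_of_norm_hasFDerivWithin_le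
    (f := fun x => F x - F' 0 x) (f' := fun x => F' x - F' 0) (fun x hx => ?_) (fun x hx => ?_)
    ((hb _).2 hζ') ((hb _).2 hζ)
  · exact ((h.hasFDerivAt x (((hb x).1 hx).trans hR)).sub (F' 0).hasFDerivAt).hasFDerivWithinAt
  · refine (h.lip x 0 (((hb x).1 hx).trans hR) (by simpa using hK.le)).trans ?_
    rw [sub_zero]
    gcongr
    exact (hb x).1 hx

/-- Local representatives `F n` of a map along an orbit (placed at the origin) in the plane, with a
vector `v 0` whose images `v n` under the derivative are pinched, and a function `h` which is a
coordinate along `v 0`. The products of the Jacobians are `d n`. -/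
structure PinchedOrbit (K σ ρ ρ' : ℝ) (F : ℕ → Plane → Plane) (F' : ℕ → Plane → Plane →L[ℝ] Plane)
    (h : Plane → ℝ) (h' : Plane → Plane →L[ℝ] ℝ) (v : ℕ → Plane) (d : ℕ → ℝ) : Prop where
  lipDeriv : ∀ n, HasLipDeriv K (F n) (F' n)
  lipDeriv_h : HasLipDeriv K h h'
  deriv_apply : ∀ n, F' n 0 (v n) = v (n + 1)
  area_deriv : ∀ n u w, area (F' n 0 u) (F' n 0 w) * d n = d (n + 1) * area u w
  v_ne : ∀ n, v n ≠ 0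
  d_ne : ∀ n, d n ≠ 0
  norm_le : ∀ n, ‖v n‖ ≤ K * σ ^ n
  norm_le_succ : ∀ n, ‖v n‖ ≤ K * ‖v (n + 1)‖
  pinch_le : ∀ n, ‖v n‖ ^ 2 ≤ K * ρ ^ n * |d n|
  le_pinch : ∀ n, ρ' ^ n * |d n| ≤ K * ‖v n‖ ^ 2
  h_transverse : K⁻¹ ≤ h' 0 (v 0)

namespace PinchedOrbit

variable {K σ ρ ρ' : ℝ} {F : ℕ → Plane → Plane} {F' : ℕ → Plane → Plane →L[ℝ] Plane}
  {h : Plane → ℝ} {h' : Plane → Plane →L[ℝ] ℝ} {v : ℕ → Plane} {d : ℕ → ℝ}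

/-- The ratio between the transverse and the longitudinal expansion. -/
noncomputable def ratio (v : ℕ → Plane) (d : ℕ → ℝ) (n : ℕ) : ℝ := d n / ‖v n‖ ^ 2

/-- The shear, in conformal coordinates. -/
noncomputable def shear (F' : ℕ → Plane → Plane →L[ℝ] Plane) (v : ℕ → Plane) (d : ℕ → ℝ)
    (n : ℕ) : ℝ :=
  inner ℝ (v (n + 1)) (F' n 0 (rot (v n))) / ‖v (n + 1)‖ ^ 2 * ratio v d n

variable (P : PinchedOrbit K σ ρ ρ' F F' h h' v d)
include P

theorem norm_pos (n : ℕ) : 0 < ‖v n‖ := norm_pos_iff.2 (P.v_ne n)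

theorem ratio_ne (n : ℕ) : ratio v d n ≠ 0 :=
  div_ne_zero (P.d_ne n) (pow_ne_zero _ (P.norm_pos n).ne')

theorem abs_ratio (n : ℕ) : |ratio v d n| = |d n| / ‖v n‖ ^ 2 := by
  rw [ratio, abs_div, abs_of_pos (pow_pos (P.norm_pos n) 2)]

theorem abs_ratio_le (hρ' : 0 < ρ') (n : ℕ) : |ratio v d n| ≤ K * (ρ'⁻¹) ^ n := by
  rw [P.abs_ratio, div_le_iff₀ (pow_pos (P.norm_pos n) 2), inv_pow, mul_right_comm,
    ← div_eq_mul_inv, le_div_iff₀ (by positivity)]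
  linarith [P.le_pinch n]

/-- The transverse expansion dominates by at least ρ⁻ⁿ. This is what forces q to vanish at infinity
along slowly growing orbits. -/
theorem inv_abs_ratio_le (n : ℕ) : |ratio v d n|⁻¹ ≤ K * ρ ^ n := by
  rw [P.abs_ratio, inv_div, div_le_iff₀ (abs_pos.2 (P.d_ne n))]
  exact P.pinch_le n

/-- The shear measures how far the derivative sends `rot (v n)` along `v (n + 1)`. It is bounded
because ‖v n‖ ≤ K ‖v (n + 1)‖, and the factor `ratio` comes from writing z₂ as m q. -/
theorem abs_shear_le (hK : 0 < K) (n : ℕ) : |shear F' v d n| ≤ K ^ 2 * |ratio v d n| := by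
  rw [shear, abs_mul]
  gcongr
  rw [abs_div, abs_of_pos (pow_pos (P.norm_pos (n + 1)) 2),
    div_le_iff₀ (pow_pos (P.norm_pos (n + 1)) 2)]
  have h1 : ‖F' n 0 (rot (v n))‖ ≤ K * ‖v n‖ :=
    ((F' n 0).le_of_opNorm_le (P.lipDeriv n).norm_le _).trans (by rw [norm_rot])
  calc _ ≤ ‖v (n + 1)‖ * ‖F' n 0 (rot (v n))‖ := abs_real_inner_le_norm _ _
    _ ≤ ‖v (n + 1)‖ * (K * (K * ‖v (n + 1)‖)) := by
        gcongr; exact h1.trans (by gcongr; exact P.norm_le_succ n)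
    _ = _ := by ring

/-- The derivative maps `v n` to `v (n + 1)`, so the coefficient along it is transported unchanged.
The rotated vector contributes the shear and ξ the perturbation. -/
theorem conf_succ_fst (n : ℕ) (ζ ξ : Plane) :
    (conf (v (n + 1)) (F' n 0 ζ + ξ)).1 = (conf (v n) ζ).1 +
      shear F' v d n * ((conf (v n) ζ).2 / ratio v d n) + (conf (v (n + 1)) ξ).1 := by
  have h1 : F' n 0 ζ = (conf (v n) ζ).1 • v (n + 1) + (conf (v n) ζ).2 • F' n 0 (rot (v n)) := by
    conv_lhs => rw [← unconf_conf (P.v_ne n) ζ]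
    simp [unconf, P.deriv_apply]
  have h2 := (P.norm_pos (n + 1)).ne'
  have h3 := P.ratio_ne n
  rw [h1]
  generalize conf (v n) ζ = z
  simp only [conf, shear, inner_add_right, inner_smul_right, real_inner_self_eq_norm_sq]
  field_simp

/-- The transverse coordinate times ‖v n‖² is an area, which the derivative multiplies by d_{n+1} /
d_n. Division by `ratio` therefore turns it into a conserved quantity of the linear part. -/
theorem conf_succ_snd (n : ℕ) (ζ ξ : Plane) :
    (conf (v (n + 1)) (F' n 0 ζ + ξ)).2 / ratio v d (n + 1) = (conf (v n) ζ).2 / ratio v d n +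
      area (v (n + 1)) ξ / d (n + 1) := by
  have h2 := (P.norm_pos (n + 1)).ne'
  have h3 := (P.norm_pos n).ne'
  have h4 := P.d_ne n
  have h5 := P.d_ne (n + 1)
  have h6 := P.area_deriv n (v n) ζ
  rw [P.deriv_apply] at h6
  simp only [conf, ratio, area_add_right]
  field_simp
  linarith

/-- Bounds on the coordinates of a remainder. -/
theorem remainder_bounds (hK : 1 ≤ K) (hρ : 0 ≤ ρ) (hρ1 : ρ ≤ 1) (hρ' : 0 < ρ') (hρ'1 : ρ' ≤ 1)
    {n : ℕ} {ξ : Plane} {R D : ℝ} (hR : 0 ≤ R) (hD : 0 ≤ D)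
    (hξ : ‖ξ‖ ≤ K * R * (2 * ‖v n‖ * D)) :
    |(conf (v (n + 1)) ξ).1| ≤ 2 * K ^ 2 * R * D ∧
      ∀ j ≤ n, |ratio v d j| * |area (v (n + 1)) ξ / d (n + 1)| ≤
        2 * K ^ 4 * R * D * (ρ * ρ'⁻¹) ^ n := by
  have hK0 : 0 < K := by linarith
  have h1 := P.norm_pos (n + 1)
  have hξ' : ‖ξ‖ ≤ 2 * K ^ 2 * R * D * ‖v (n + 1)‖ := by
    calc ‖ξ‖ ≤ K * R * (2 * ‖v n‖ * D) := hξ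
      _ ≤ K * R * (2 * (K * ‖v (n + 1)‖) * D) := by gcongr; exact P.norm_le_succ n
      _ = _ := by ring
  constructor
  · refine (norm_fst_le (conf (v (n + 1)) ξ)).trans ?_
    refine (norm_conf_le (P.v_ne _) ξ).trans ?_
    rwa [div_le_iff₀ h1]
  · intro j hj
    have e1 : |area (v (n + 1)) ξ / d (n + 1)| ≤ 2 * K ^ 2 * R * D * (K * ρ ^ n) := by
      rw [abs_div, div_le_iff₀ (abs_pos.2 (P.d_ne _))]
      calc _ ≤ ‖v (n + 1)‖ * ‖ξ‖ := abs_area_le _ _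
        _ ≤ ‖v (n + 1)‖ * (2 * K ^ 2 * R * D * ‖v (n + 1)‖) := by gcongr
        _ = 2 * K ^ 2 * R * D * ‖v (n + 1)‖ ^ 2 := by ring
        _ ≤ 2 * K ^ 2 * R * D * (K * ρ ^ (n + 1) * |d (n + 1)|) := by
            gcongr; exact P.pinch_le _
        _ ≤ 2 * K ^ 2 * R * D * (K * ρ ^ n * |d (n + 1)|) := by
            gcongr ?_ * (?_ * ?_ * ?_)
            exact pow_le_pow_of_le_one hρ hρ1 (Nat.le_succ n)
        _ = _ := by ring
    have e2 : |ratio v d j| ≤ K * (ρ'⁻¹) ^ n := by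
      refine (P.abs_ratio_le hρ' j).trans ?_
      gcongr
      exact (one_le_inv₀ hρ').2 hρ'1
    calc _ ≤ K * (ρ'⁻¹) ^ n * (2 * K ^ 2 * R * D * (K * ρ ^ n)) := by gcongr
      _ = _ := by rw [mul_pow]; ring

end PinchedOrbit

end SurfaceStable

/-! ### Orbits asymptotic to a pinched orbit -/

namespace SurfaceStable

/-- The rate of decay of the nonlinear terms. -/
noncomputable def decayRate (σ ρ ρ' τ : ℝ) : ℝ := τ ^ 2 * σ * (ρ * ρ'⁻¹)

/-- The radius of the weighted balls in which the Lyapunov–Perron argument applies. -/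
noncomputable def perronRadius (K θ : ℝ) : ℝ := (4 * K ^ 5 * shearConst (K ^ 3) θ)⁻¹

theorem perronRadius_pos {K θ : ℝ} (hK : 1 ≤ K) (hθ : θ < 1) : 0 < perronRadius K θ := by
  have := one_le_shearConst hθ (B := K ^ 3) (by positivity)
  unfold perronRadius
  positivity

/-- Keeps the balls of radius `perronRadius` · τⁿ ‖v n‖ inside the domain of radius K⁻¹ where the
local maps are controlled, since τⁿ ‖v n‖ ≤ K when τσ ≤ 1. -/
theorem perronRadius_mul_le {K θ : ℝ} (hK : 1 ≤ K) (hθ : θ < 1) :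
    perronRadius K θ * K ≤ K⁻¹ := by
  have h1 := one_le_shearConst hθ (B := K ^ 3) (by positivity)
  have hK0 : 0 < K := by linarith
  unfold perronRadius
  rw [inv_mul_le_iff₀ (by positivity), le_mul_inv_iff₀ hK0]
  have h2 : K * K ≤ K ^ 5 := by
    rw [← pow_two]; exact pow_le_pow_right₀ hK (by norm_num)
  have : 0 < K ^ 5 := by positivity
  nlinarith

/-- The radius is tuned for this: the remainders have Lipschitz constant 2 K⁵ η, and the abstract
estimates ask that its product with `shearConst` be at most 1/2. -/
theorem perronRadius_mul_shearConst {K θ : ℝ} (hK : 1 ≤ K) (hθ : θ < 1) :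
    2 * K ^ 5 * perronRadius K θ * shearConst (K ^ 3) θ ≤ 1 / 2 := by
  have h1 := one_le_shearConst hθ (B := K ^ 3) (by positivity)
  unfold perronRadius
  have : 0 < K ^ 5 := by positivity
  apply le_of_eq
  field_simp
  norm_num

namespace PinchedOrbit

variable {K σ ρ ρ' : ℝ} {F : ℕ → Plane → Plane} {F' : ℕ → Plane → Plane →L[ℝ] Plane}
  {h : Plane → ℝ} {h' : Plane → Plane →L[ℝ] ℝ} {v : ℕ → Plane} {d : ℕ → ℝ} {τ : ℝ}

/-- Source of `decayRate`. The remainder on a ball of radius η τⁿ ‖v n‖ contributes τⁿ σⁿ relative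
to `v n`, and the weight of the slowly growing orbit contributes another τⁿ. For the transverse
part, 1 / d_{n+1} is paid by the upper pinching ρⁿ and the factor m_j with j ≤ n by the lower
pinching ρ'⁻ⁿ. Indices j ≤ n are needed because q_j sums all later errors. -/
theorem weighted_remainder_bounds (P : PinchedOrbit K σ ρ ρ' F F' h h' v d)
    (hK : 1 ≤ K) (hρ' : 0 < ρ') (hρρ' : ρ' ≤ ρ) (hρ1 : ρ ≤ 1)
    (hτ : 1 ≤ τ) {η D : ℝ} (hη : 0 ≤ η) (hD : 0 ≤ D) {n : ℕ} {ξ : Plane}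
    (hξ : ‖ξ‖ ≤ K * (η * τ ^ n * ‖v n‖) * (2 * ‖v n‖ * D)) :
    τ ^ n * |(conf (v (n + 1)) ξ).1| ≤ 2 * K ^ 5 * η * decayRate σ ρ ρ' τ ^ n * D ∧
      ∀ j ≤ n, |ratio v d j| * (τ ^ n * |area (v (n + 1)) ξ / d (n + 1)|) ≤
        2 * K ^ 5 * η * decayRate σ ρ ρ' τ ^ n * D := by
  have hρ : 0 < ρ := hρ'.trans_le hρρ'
  obtain ⟨h1, h2⟩ := P.remainder_bounds hK hρ.le hρ1 hρ' (hρρ'.trans hρ1)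
    (by positivity) hD hξ
  have hτn : (0 : ℝ) < τ ^ n := by positivity
  have e : ∀ x : ℝ, 0 ≤ x → τ ^ n * (2 * K ^ 4 * (η * τ ^ n * ‖v n‖) * D * x) ≤
      2 * K ^ 5 * η * ((τ ^ 2 * σ) ^ n * x) * D := by
    intro x hx
    calc τ ^ n * (2 * K ^ 4 * (η * τ ^ n * ‖v n‖) * D * x)
        ≤ τ ^ n * (2 * K ^ 4 * (η * τ ^ n * (K * σ ^ n)) * D * x) := by
          gcongr; exact P.norm_le n
      _ = _ := by rw [mul_pow, ← pow_mul, mul_comm 2 n, pow_mul]; ring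
  have hq : 1 ≤ ρ * ρ'⁻¹ := by
    rw [← div_eq_mul_inv, le_div_iff₀ hρ']; linarith
  constructor
  · calc _ ≤ τ ^ n * (2 * K ^ 2 * (η * τ ^ n * ‖v n‖) * D) := by gcongr
      _ ≤ τ ^ n * (2 * K ^ 4 * (η * τ ^ n * ‖v n‖) * D * (ρ * ρ'⁻¹) ^ n) := by
          have h3 : (1 : ℝ) ≤ (ρ * ρ'⁻¹) ^ n := one_le_pow₀ hq
          have h4 : K ^ 2 ≤ K ^ 4 := pow_le_pow_right₀ hK (by norm_num)
          have h5 : 2 * K ^ 2 * (η * τ ^ n * ‖v n‖) * D ≤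
            2 * K ^ 4 * (η * τ ^ n * ‖v n‖) * D := by gcongr
          refine mul_le_mul_of_nonneg_left ?_ hτn.le
          exact h5.trans (le_mul_of_one_le_right (by positivity) h3)
      _ ≤ _ := by
          refine (e _ (by positivity)).trans (le_of_eq ?_)
          rw [decayRate, mul_pow (τ ^ 2 * σ)]
  · intro j hj
    calc _ = τ ^ n * (|ratio v d j| * |area (v (n + 1)) ξ / d (n + 1)|) := by ring
      _ ≤ τ ^ n * (2 * K ^ 4 * (η * τ ^ n * ‖v n‖) * D * (ρ * ρ'⁻¹) ^ n) := 
          mul_le_mul_of_nonneg_left (h2 j hj) hτn.le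
      _ ≤ _ := by
          refine (e _ (by positivity)).trans (le_of_eq ?_)
          rw [decayRate, mul_pow (τ ^ 2 * σ)]

/-- The weaker power K³ lets one constant B serve both for the shear and for the initial condition,
where inverting `h' 0 (v 0)` costs an extra factor K. -/
theorem abs_shear_le' (P : PinchedOrbit K σ ρ ρ' F F' h h' v d) (hK : 1 ≤ K) (n : ℕ) :
    |shear F' v d n| ≤ K ^ 3 * |ratio v d n| :=
  (P.abs_shear_le (by linarith) n).trans (by gcongr; norm_num)

theorem h'_apply (v₀ ζ : Plane) (hv : v₀ ≠ 0) (L : Plane →L[ℝ] ℝ) :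
    L ζ = (conf v₀ ζ).1 * L v₀ + (conf v₀ ζ).2 * L (rot v₀) := by
  conv_lhs => rw [← unconf_conf hv ζ]
  simp [unconf]

theorem abs_h'_rot_le (P : PinchedOrbit K σ ρ ρ' F F' h h' v d) (hK : 1 ≤ K) :
    |h' 0 (rot (v 0))| ≤ K ^ 2 := by
  have h1 := (h' 0).le_of_opNorm_le P.lipDeriv_h.norm_le (rot (v 0))
  rw [norm_rot, Real.norm_eq_abs] at h1
  have h2 := P.norm_le 0
  simp only [pow_zero, mul_one] at h2
  nlinarith

/-- Slowly growing solutions of perturbations of the linearized equation along a pinched orbit are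
controlled by their initial coordinate along the pinched direction. -/
theorem norm_le_of_variation (P : PinchedOrbit K σ ρ ρ' F F' h h' v d)
    (hK : 1 ≤ K) (hσ : 0 < σ) (hρ' : 0 < ρ') (hρρ' : ρ' ≤ ρ) (hρ1 : ρ ≤ 1)
    (hτ : 1 ≤ τ) (hτρ : τ * ρ < 1) (hθ : decayRate σ ρ ρ' τ < 1) {ξ ω₁ : ℕ → Plane} {s X₀ : ℝ}
    (hξ : ∀ n, ξ (n + 1) = F' n 0 (ξ n) + ω₁ n)
    (hω : ∀ n, ‖ω₁ n‖ ≤ K * (perronRadius K (decayRate σ ρ ρ' τ) * τ ^ n * ‖v n‖) * ‖ξ n‖)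
    (hs : |h' 0 (ξ 0) - s| ≤ K * (perronRadius K (decayRate σ ρ ρ' τ) * ‖v 0‖) * ‖ξ 0‖)
    (hX : ∀ n, ‖ξ n‖ ≤ X₀ * τ ^ n * ‖v n‖) (n : ℕ) : ‖ξ n‖ ≤ 4 * K * ‖v n‖ * |s| := by
  set θ := decayRate σ ρ ρ' τ with hθdef
  set η := perronRadius K θ with hηdef
  have hK0 : 0 < K := by linarith
  have hη : 0 < η := perronRadius_pos hK hθ
  have hρ : 0 < ρ := hρ'.trans_le hρρ'
  have hθ0 : 0 ≤ θ := by rw [hθdef, decayRate]; positivity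
  have hτ0 : 0 < τ := by linarith
  set a := h' 0 (v 0) with ha
  have ha0 : 0 < a := (inv_pos.2 hK0).trans_le P.h_transverse
  have hainv : a⁻¹ ≤ K := inv_le_of_inv_le₀ hK0 P.h_transverse
  have hv0 : ‖v 0‖ ≤ K := by simpa using P.norm_le 0
  have hξz : ∀ n, ‖ξ n‖ ≤ 2 * ‖v n‖ * ‖conf (v n) (ξ n)‖ := fun n => by
    conv_lhs => rw [← unconf_conf (P.v_ne n) (ξ n)]
    exact norm_unconf_le _ _
  have hrem := fun n => P.weighted_remainder_bounds hK hρ' hρρ' hρ1 hτ hη.le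
    (norm_nonneg (conf (v n) (ξ n))) (ξ := ω₁ n)
    ((hω n).trans (mul_le_mul_of_nonneg_left (hξz n) (by positivity)))
  -- The parameter is s / a because `h' 0` equals a on `v 0`; its value on `rot (v 0)` is absorbed
  -- by the term in B.
  have main := norm_le_of_slow_growth (z := fun n => conf (v n) (ξ n))
    (α := fun n => (conf (v (n + 1)) (ω₁ n)).1) (β := fun n => area (v (n + 1)) (ω₁ n) / d (n + 1))
    (γ := shear F' v d) (m := ratio v d) (B := K ^ 3) (η := 2 * K ^ 5 * η) (θ := θ) (τ := τ)
    (s := s / a) (X₀ := X₀) hθ0 hθ (by positivity) (by positivity)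
    (perronRadius_mul_shearConst hK hθ) hτ P.ratio_ne (P.abs_shear_le' hK) ?_
    (fun n => by rw [hξ]; exact P.conf_succ_fst n _ _)
    (fun n => by rw [hξ]; exact P.conf_succ_snd n _ _)
    (fun n => (hrem n).1) (fun n => (hrem n).2) (fun n => ?_) ?_ n
  · have h1 : |s / a| ≤ K * |s| := by
      rw [abs_div, abs_of_pos ha0, div_eq_inv_mul]; gcongr
    calc ‖ξ n‖ ≤ 2 * ‖v n‖ * ‖conf (v n) (ξ n)‖ := hξz n
      _ ≤ 2 * ‖v n‖ * (2 * (K * |s|)) := by gcongr; linarith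
      _ = _ := by ring
  · refine squeeze_zero (fun n => by positivity) (fun n => ?_)
      (by simpa using (tendsto_pow_atTop_nhds_zero_of_lt_one (by positivity) hτρ).const_mul K)
    rw [div_eq_mul_inv, mul_pow]
    have := P.inv_abs_ratio_le n
    calc τ ^ n * |ratio v d n|⁻¹ ≤ τ ^ n * (K * ρ ^ n) := by gcongr
      _ = _ := by ring
  · refine (norm_conf_le (P.v_ne n) _).trans ?_
    rw [div_le_iff₀ (P.norm_pos n)]
    exact hX n
  · have e1 := h'_apply (v 0) (ξ 0) (P.v_ne 0) (h' 0)
    have e2 := P.abs_h'_rot_le hK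
    have e3 := hξz 0
    generalize hz : conf (v 0) (ξ 0) = z at *
    rw [← ha] at e1
    have e4 : a * |z.1| ≤ |s| + 2 * K ^ 3 * η * ‖z‖ * K + K ^ 2 * |z.2| := by
      have : z.1 * a = (h' 0 (ξ 0) - s) + s - z.2 * h' 0 (rot (v 0)) := by rw [e1]; ring
      have h5 : |z.1| * a = |z.1 * a| := by rw [abs_mul, abs_of_pos ha0]
      rw [mul_comm, h5, this]
      have h6 := abs_sub ((h' 0 (ξ 0) - s) + s) (z.2 * h' 0 (rot (v 0)))
      have h7 := abs_add_le (h' 0 (ξ 0) - s) s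
      have h8 : |z.2 * h' 0 (rot (v 0))| ≤ K ^ 2 * |z.2| := by
        rw [abs_mul, mul_comm]; gcongr
      have h9 : K * (η * ‖v 0‖) * ‖ξ 0‖ ≤ 2 * K ^ 3 * η * ‖z‖ * 1 := by
        calc K * (η * ‖v 0‖) * ‖ξ 0‖ ≤ K * (η * K) * (2 * K * ‖z‖) := by
              gcongr; exact e3.trans (by gcongr)
          _ = _ := by ring
      have h10 : 2 * K ^ 3 * η * ‖z‖ * 1 ≤ 2 * K ^ 3 * η * ‖z‖ * K := by gcongr
      linarith
    have e5 : |z.1| ≤ a⁻¹ * (|s| + 2 * K ^ 3 * η * ‖z‖ * K + K ^ 2 * |z.2|) := by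
      rw [inv_mul_eq_div, le_div_iff₀ ha0]; linarith
    refine e5.trans ?_
    rw [abs_div, abs_of_pos ha0]
    have e6 : a⁻¹ * (|s| + 2 * K ^ 3 * η * ‖z‖ * K + K ^ 2 * |z.2|) ≤
        |s| / a + K * (2 * K ^ 3 * η * ‖z‖ * K + K ^ 2 * |z.2|) := by
      rw [add_assoc, mul_add, inv_mul_eq_div]
      gcongr
    refine e6.trans (le_of_eq ?_)
    ring

/-- Uniqueness and Lipschitz dependence on the initial coordinate of the orbits which are
asymptotic to a pinched orbit. -/
theorem norm_sub_le (P : PinchedOrbit K σ ρ ρ' F F' h h' v d)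
    (hK : 1 ≤ K) (hσ : 0 < σ) (hρ' : 0 < ρ') (hρρ' : ρ' ≤ ρ) (hρ1 : ρ ≤ 1)
    (hτ : 1 ≤ τ) (hτσ : τ * σ ≤ 1) (hτρ : τ * ρ < 1) (hθ : decayRate σ ρ ρ' τ < 1)
    {ζ ζ' : ℕ → Plane} (hF : ∀ n, ζ (n + 1) = F n (ζ n)) (hF' : ∀ n, ζ' (n + 1) = F n (ζ' n))
    (hζ : ∀ n, ‖ζ n‖ ≤ perronRadius K (decayRate σ ρ ρ' τ) * τ ^ n * ‖v n‖)
    (hζ' : ∀ n, ‖ζ' n‖ ≤ perronRadius K (decayRate σ ρ ρ' τ) * τ ^ n * ‖v n‖) (n : ℕ) :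
    ‖ζ n - ζ' n‖ ≤ 4 * K * ‖v n‖ * |h (ζ 0) - h (ζ' 0)| := by
  have hη := perronRadius_pos hK hθ
  have hK0 : 0 < K := by linarith
  have hR : ∀ n, perronRadius K (decayRate σ ρ ρ' τ) * τ ^ n * ‖v n‖ ≤ K⁻¹ := fun n => by
    refine le_trans ?_ (perronRadius_mul_le hK hθ)
    have h1 : τ ^ n * σ ^ n ≤ 1 := by rw [← mul_pow]; exact pow_le_one₀ (by positivity) hτσ
    calc _ ≤ perronRadius K (decayRate σ ρ ρ' τ) * τ ^ n * (K * σ ^ n) := by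
          gcongr; exact P.norm_le n
      _ = perronRadius K (decayRate σ ρ ρ' τ) * K * (τ ^ n * σ ^ n) := by ring
      _ ≤ _ := mul_le_of_le_one_right (by positivity) h1
  -- The difference of two orbits solves the linearized equation at the pinched orbit up to the
  -- difference of two remainders, which is small by `norm_remainder_le`.
  refine P.norm_le_of_variation hK hσ hρ' hρρ' hρ1 hτ hτρ hθ (ξ := fun n => ζ n - ζ' n)
    (ω₁ := fun n => (F n (ζ n) - F' n 0 (ζ n)) - (F n (ζ' n) - F' n 0 (ζ' n)))
    (X₀ := 2 * perronRadius K (decayRate σ ρ ρ' τ)) (fun n => ?_) (fun n => ?_) ?_ (fun n => ?_) n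
  · simp only [hF, hF', map_sub]; abel
  · exact (P.lipDeriv n).norm_remainder_le hK0 (hR n) (hζ n) (hζ' n)
  · have h0 := P.lipDeriv_h.norm_remainder_le hK0 (hR 0) (hζ 0) (hζ' 0)
    simp only [pow_zero, mul_one, Real.norm_eq_abs] at h0
    rw [abs_sub_comm]
    convert h0 using 2
    simp only [map_sub]; ring
  · have := _root_.norm_sub_le (ζ n) (ζ' n)
    linarith [hζ n, hζ' n]

/-- Control of the slowly growing solutions of the linearized equation along an orbit asymptotic to
a pinched orbit. -/
theorem norm_tangent_le (P : PinchedOrbit K σ ρ ρ' F F' h h' v d)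
    (hK : 1 ≤ K) (hσ : 0 < σ) (hρ' : 0 < ρ') (hρρ' : ρ' ≤ ρ) (hρ1 : ρ ≤ 1)
    (hτ : 1 ≤ τ) (hτσ : τ * σ ≤ 1) (hτρ : τ * ρ < 1) (hθ : decayRate σ ρ ρ' τ < 1)
    {ζ ξ : ℕ → Plane} {X₀ : ℝ}
    (hζ : ∀ n, ‖ζ n‖ ≤ perronRadius K (decayRate σ ρ ρ' τ) * τ ^ n * ‖v n‖)
    (hξ : ∀ n, ξ (n + 1) = F' n (ζ n) (ξ n))
    (hX : ∀ n, ‖ξ n‖ ≤ X₀ * τ ^ n * ‖v n‖) (n : ℕ) :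
    ‖ξ n‖ ≤ 4 * K * ‖v n‖ * |h' (ζ 0) (ξ 0)| := by
  have hη := perronRadius_pos hK hθ
  have hK0 : 0 < K := by linarith
  have hR : ∀ n, ‖ζ n‖ ≤ K⁻¹ := fun n => by
    refine (hζ n).trans (le_trans ?_ (perronRadius_mul_le hK hθ))
    have h1 : τ ^ n * σ ^ n ≤ 1 := by rw [← mul_pow]; exact pow_le_one₀ (by positivity) hτσ
    calc _ ≤ perronRadius K (decayRate σ ρ ρ' τ) * τ ^ n * (K * σ ^ n) := by
          gcongr; exact P.norm_le n
      _ = perronRadius K (decayRate σ ρ ρ' τ) * K * (τ ^ n * σ ^ n) := by ring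
      _ ≤ _ := mul_le_of_le_one_right (by positivity) h1
  have h0K : ‖(0 : Plane)‖ ≤ K⁻¹ := by simpa using hK0.le
  refine P.norm_le_of_variation hK hσ hρ' hρρ' hρ1 hτ hτρ hθ (ξ := ξ)
    (ω₁ := fun n => (F' n (ζ n) - F' n 0) (ξ n)) (fun n => ?_) (fun n => ?_) ?_ hX n
  · rw [hξ]; simp
  · refine ContinuousLinearMap.le_of_opNorm_le _ (((P.lipDeriv n).lip _ _ (hR n) h0K).trans ?_) _
    rw [sub_zero]
    gcongr
    exact hζ n
  · have e : h' 0 (ξ 0) - h' (ζ 0) (ξ 0) = (h' 0 - h' (ζ 0)) (ξ 0) := by simp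
    rw [e, ← Real.norm_eq_abs]
    refine ContinuousLinearMap.le_of_opNorm_le _ ((P.lipDeriv_h.lip _ _ h0K (hR 0)).trans ?_) _
    rw [zero_sub, norm_neg]
    gcongr
    simpa using hζ 0

/-- Existence of orbits asymptotic to a pinched orbit, with prescribed initial coordinate. -/
theorem exists_asymptotic_orbit (P : PinchedOrbit K σ ρ ρ' F F' h h' v d)
    (hK : 1 ≤ K) (hσ : 0 < σ) (hσ1 : σ ≤ 1) (hρ' : 0 < ρ') (hρρ' : ρ' ≤ ρ) (hρ1 : ρ ≤ 1)
    (hθ : decayRate σ ρ ρ' 1 < 1) {s : ℝ}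
    (hs : 4 * K * |s| ≤ perronRadius K (decayRate σ ρ ρ' 1)) :
    ∃ ζ : ℕ → Plane, (∀ n, ζ (n + 1) = F n (ζ n)) ∧ h (ζ 0) = s ∧
      ∀ n, ‖ζ n‖ ≤ 4 * K * ‖v n‖ * |s| := by
  set θ := decayRate σ ρ ρ' 1 with hθdef
  set η := perronRadius K θ with hηdef
  have hK0 : 0 < K := by linarith
  have hη : 0 < η := perronRadius_pos hK hθ
  have hρ : 0 < ρ := hρ'.trans_le hρρ'
  have hθ0 : 0 ≤ θ := by rw [hθdef, decayRate]; positivity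
  set a := h' 0 (v 0) with ha
  have ha0 : 0 < a := (inv_pos.2 hK0).trans_le P.h_transverse
  have hainv : a⁻¹ ≤ K := inv_le_of_inv_le₀ hK0 P.h_transverse
  have hv0 : ‖v 0‖ ≤ K := by simpa using P.norm_le 0
  have hsa : |s / a| ≤ K * |s| := by rw [abs_div, abs_of_pos ha0, div_eq_inv_mul]; gcongr
  have hR : ∀ n, η * ‖v n‖ ≤ K⁻¹ := fun n => by
    refine le_trans ?_ (perronRadius_mul_le hK hθ)
    have h1 : σ ^ n ≤ 1 := pow_le_one₀ hσ.le hσ1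
    have h2 := P.norm_le n
    gcongr
    nlinarith
  have hball : ∀ n (z : ℝ × ℝ), ‖z‖ ≤ η / 2 → ‖unconf (v n) z‖ ≤ η * ‖v n‖ := fun n z hz => by
    refine (norm_unconf_le _ _).trans ?_
    have := norm_nonneg (v n)
    nlinarith
  let W : ℕ → ℝ × ℝ → Plane := fun n z => F n (unconf (v n) z) - F' n 0 (unconf (v n) z)
  have hW : ∀ n (z z' : ℝ × ℝ), ‖z‖ ≤ η / 2 → ‖z'‖ ≤ η / 2 →
      ‖W n z - W n z'‖ ≤ K * (η * 1 ^ n * ‖v n‖) * (2 * ‖v n‖ * ‖z - z'‖) := by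
    intro n z z' hz hz'
    refine ((P.lipDeriv n).norm_remainder_le hK0 (hR n) (hball n z hz) (hball n z' hz')).trans ?_
    rw [one_pow, mul_one, ← unconf_sub]
    gcongr
    exact norm_unconf_le _ _
  have hW' := fun n z z' hz hz' => P.weighted_remainder_bounds hK hρ' hρρ' hρ1 le_rfl hη.le
    (norm_nonneg (z - z')) (hW n z z' hz hz')
  have hW0 : ∀ n, W n 0 = 0 := fun n => by simp [W, unconf, (P.lipDeriv n).map_zero]
  -- The choice of χ turns z₁ + χ(z) = s / a into the condition that h of the initial point equals
  -- s. Its linear part only involves z₂, so in z₁ it is as small as the remainder of h.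
  obtain ⟨z, hz, hz0, hz1, hz2⟩ := exists_bounded_orbit
    (α := fun n z => (conf (v (n + 1)) (W n z)).1)
    (β := fun n z => area (v (n + 1)) (W n z) / d (n + 1)) (γ := shear F' v d) (m := ratio v d)
    (χ := fun z => a⁻¹ * h (unconf (v 0) z) - z.1)
    (B := K ^ 3) (η := 2 * K ^ 5 * η) (θ := θ) (b := η / 2) (s := s / a)
    hθ0 hθ (by positivity) (by positivity) (perronRadius_mul_shearConst hK hθ) P.ratio_ne
    (P.abs_shear_le' hK) (fun n => by simp [hW0, conf]) (fun n => by simp [hW0, area])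
    (by simp [unconf, P.lipDeriv_h.map_zero])
    (fun n z z' hz hz' => by
      have := (hW' n z z' hz hz').1
      rw [one_pow, one_mul, conf_sub] at this
      exact this)
    (fun n j hj z z' hz hz' => by
      have := (hW' n z z' hz hz').2 j hj
      rw [one_pow, one_mul, area_sub_right, sub_div] at this
      exact this)
    (fun z z' hz hz' => by
      have e1 := P.lipDeriv_h.norm_remainder_le hK0 (hR 0) (hball 0 z hz) (hball 0 z' hz')
      have e2 := P.abs_h'_rot_le hK
      rw [← unconf_sub, Real.norm_eq_abs] at e1
      have e3 : ∀ z : ℝ × ℝ, h' 0 (unconf (v 0) z) = z.1 * a + z.2 * h' 0 (rot (v 0)) :=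
        fun z => by simp [unconf, ha]
      set r := h (unconf (v 0) z) - h' 0 (unconf (v 0) z) -
        (h (unconf (v 0) z') - h' 0 (unconf (v 0) z')) with hr
      have e4 : a⁻¹ * h (unconf (v 0) z) - z.1 - (a⁻¹ * h (unconf (v 0) z') - z'.1) =
          a⁻¹ * (r + (z.2 - z'.2) * h' 0 (rot (v 0))) := by
        rw [hr, e3, e3]; field_simp; ring
      rw [e4, abs_mul, abs_of_pos (inv_pos.2 ha0)]
      have e5 : |r| ≤ 2 * K ^ 3 * η * ‖z - z'‖ := by
        calc |r| ≤ K * (η * ‖v 0‖) * ‖unconf (v 0) (z - z')‖ := e1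
          _ ≤ K * (η * K) * (2 * K * ‖z - z'‖) := by
              gcongr; exact (norm_unconf_le _ _).trans (by gcongr)
          _ = _ := by ring
      have e6 : |(z.2 - z'.2) * h' 0 (rot (v 0))| ≤ K ^ 2 * |z.2 - z'.2| := by
        rw [abs_mul, mul_comm]; gcongr
      calc a⁻¹ * |r + (z.2 - z'.2) * h' 0 (rot (v 0))|
          ≤ K * (2 * K ^ 3 * η * ‖z - z'‖ + K ^ 2 * |z.2 - z'.2|) := by
            gcongr; exact (abs_add_le _ _).trans (add_le_add e5 e6)
        _ = 2 * K ^ 4 * η * ‖z - z'‖ + K ^ 3 * |z.2 - z'.2| := by ring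
        _ ≤ _ := by gcongr; norm_num)
    (by nlinarith)
  refine ⟨fun n => unconf (v n) (z n), fun n => ?_, ?_, fun n => ?_⟩
  · have e1 : F n (unconf (v n) (z n)) = F' n 0 (unconf (v n) (z n)) + W n (z n) := by
      simp [W]
    rw [e1, ← unconf_conf (P.v_ne (n + 1)) (F' n 0 (unconf (v n) (z n)) + W n (z n))]
    refine congrArg (unconf (v (n + 1))) ?_
    have f1 := P.conf_succ_fst n (unconf (v n) (z n)) (W n (z n))
    have f2 := P.conf_succ_snd n (unconf (v n) (z n)) (W n (z n))
    rw [conf_unconf (P.v_ne n)] at f1 f2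
    refine Prod.ext ?_ ?_
    · rw [f1, hz1]
    · rw [← hz2, div_left_inj' (P.ratio_ne _)] at f2
      exact f2.symm
  · simp only [add_sub_cancel] at hz0
    field_simp at hz0
    exact hz0
  · calc _ ≤ 2 * ‖v n‖ * ‖z n‖ := norm_unconf_le _ _
      _ ≤ 2 * ‖v n‖ * (2 * (K * |s|)) := by gcongr; linarith [hz n]
      _ = _ := by ring

end PinchedOrbit

end SurfaceStable

/-! ### Charts and the Riemannian distance -/

namespace SurfaceStable

section LocalGeometry

open scoped ENNReal NNReal
open MeasureTheory

variable {S : Type*} [EMetricSpace S] [ChartedSpace (EuclideanSpace ℝ (Fin 2)) S]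
  [IsManifold (𝓡 2) ∞ S]

/-- The derivative at `y` of the chart at `p`. -/
noncomputable def chartDeriv (p y : S) : TangentSpace (𝓡 2) y →L[ℝ] Plane :=
  mfderiv (𝓡 2) 𝓘(ℝ, Plane) (extChartAt (𝓡 2) p) y

theorem chartDeriv_bijective {p y : S} (hy : y ∈ (extChartAt (𝓡 2) p).source) :
    Function.Bijective (chartDeriv p y) := by
  obtain ⟨A, hA⟩ := isInvertible_mfderiv_extChartAt (I := 𝓡 2) hy
  have : ⇑(chartDeriv p y) = A := by
    funext v
    exact (congrArg (fun L => L v) hA).symm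
  rw [this]
  exact A.bijective

theorem chartDeriv_eq_trivialization {p y : S} (hy : y ∈ (chartAt Plane p).source) :
    chartDeriv p y = (trivializationAt Plane (TangentSpace (𝓡 2)) p).continuousLinearMapAt ℝ y :=
  (TangentBundle.continuousLinearMapAt_trivializationAt hy).symm

/-- The chain rule for the expression of a curve in a chart. -/
theorem hasDerivWithinAt_chart_comp {p : S} {γ : ℝ → S} {s : Set ℝ} {t : ℝ}
    (hγ : MDifferentiableWithinAt 𝓘(ℝ, ℝ) (𝓡 2) γ s t)
    (ht : γ t ∈ (extChartAt (𝓡 2) p).source) :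
    HasDerivWithinAt (extChartAt (𝓡 2) p ∘ γ)
      (chartDeriv p (γ t) (mfderivWithin 𝓘(ℝ, ℝ) (𝓡 2) γ s t (1 : ℝ))) s t := by
  have h1 : MDifferentiableAt (𝓡 2) 𝓘(ℝ, Plane) (extChartAt (𝓡 2) p) (γ t) :=
    mdifferentiableAt_extChartAt (by simpa using ht)
  have h2 := h1.hasMFDerivAt.comp_hasMFDerivWithinAt t hγ.hasMFDerivWithinAt
  have h3 : HasFDerivWithinAt (extChartAt (𝓡 2) p ∘ γ)
      ((chartDeriv p (γ t)).comp (mfderivWithin 𝓘(ℝ, ℝ) (𝓡 2) γ s t) : ℝ →L[ℝ] Plane) s t :=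
    hasMFDerivWithinAt_iff_hasFDerivWithinAt.1 h2
  exact h3.hasDerivWithinAt

variable [RiemannianBundle (fun x : S => TangentSpace (𝓡 2) x)]
  [IsContinuousRiemannianBundle (EuclideanSpace ℝ (Fin 2)) (fun x : S => TangentSpace (𝓡 2) x)]

theorem eventually_norm_chartDeriv_le (p : S) :
    ∃ C : ℝ≥0, 0 < C ∧ ∀ᶠ y in 𝓝 p, ∀ v : TangentSpace (𝓡 2) y,
      ‖chartDeriv p y v‖ ≤ C * ‖v‖ := by
  obtain ⟨C, hC, h⟩ := eventually_norm_trivializationAt_lt Plane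
    (fun x : S => TangentSpace (𝓡 2) x) p
  refine ⟨⟨C, hC.le⟩, hC, ?_⟩
  filter_upwards [h, chart_source_mem_nhds Plane p] with y hy hys v
  rw [chartDeriv_eq_trivialization hys]
  exact ContinuousLinearMap.le_of_opNorm_le _ hy.le v

theorem eventually_le_norm_chartDeriv (p : S) :
    ∃ C : ℝ≥0, 0 < C ∧ ∀ᶠ y in 𝓝 p, ∀ v : TangentSpace (𝓡 2) y,
      ‖v‖ ≤ C * ‖chartDeriv p y v‖ := by
  obtain ⟨C, hC, h⟩ := eventually_norm_symmL_trivializationAt_lt Plane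
    (fun x : S => TangentSpace (𝓡 2) x) p
  refine ⟨⟨C, hC.le⟩, hC, ?_⟩
  filter_upwards [h, chart_source_mem_nhds Plane p] with y hy hys v
  rw [chartDeriv_eq_trivialization hys]
  have e : (trivializationAt Plane (TangentSpace (𝓡 2)) p).symmL ℝ y
      ((trivializationAt Plane (TangentSpace (𝓡 2)) p).continuousLinearMapAt ℝ y v) = v :=
    Trivialization.symmL_continuousLinearMapAt _ (by simpa using hys) v
  conv_lhs => rw [← e]
  exact ContinuousLinearMap.le_of_opNorm_le _ hy.le _

variable [IsRiemannianManifold (𝓡 2) S]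

/-- The inverse of a chart is locally Lipschitz for the Riemannian distance. -/
theorem exists_edist_le_edist_chart (p : S) :
    ∃ C : ℝ≥0, 0 < C ∧ ∃ r > (0 : ℝ), ∀ ζ ∈ Metric.ball (extChartAt (𝓡 2) p p) r,
      ∀ ζ' ∈ Metric.ball (extChartAt (𝓡 2) p p) r,
      edist ((extChartAt (𝓡 2) p).symm ζ) ((extChartAt (𝓡 2) p).symm ζ') ≤ C * edist ζ ζ' := by
  obtain ⟨C, hC, h⟩ := eventually_le_norm_chartDeriv p
  have h1 : ∀ᶠ ζ in 𝓝 (extChartAt (𝓡 2) p p), ζ ∈ (extChartAt (𝓡 2) p).target ∧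
      ∀ v : TangentSpace (𝓡 2) ((extChartAt (𝓡 2) p).symm ζ),
        ‖v‖ ≤ C * ‖chartDeriv p ((extChartAt (𝓡 2) p).symm ζ) v‖ := by
    refine Filter.Eventually.and (extChartAt_target_mem_nhds (I := 𝓡 2) p) ?_
    have := (continuousAt_extChartAt_symm (I := 𝓡 2) p).tendsto
    rw [extChartAt_to_inv] at this
    exact this.eventually h
  obtain ⟨r, hr, hball⟩ := Metric.eventually_nhds_iff_ball.1 h1
  refine ⟨C, hC, r, hr, fun ζ hζ ζ' hζ' => ?_⟩
  -- The distance is at most the length of the image of the straight segment, and the inverse chart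
  -- stretches this length by at most C.
  let η : ℝ → Plane := ContinuousAffineMap.lineMap (R := ℝ) ζ ζ'
  have hη0 : η 0 = ζ := by simp [η, ContinuousAffineMap.coe_lineMap_eq]
  have hη1 : η 1 = ζ' := by simp [η, ContinuousAffineMap.coe_lineMap_eq]
  have hηb : ∀ t ∈ Icc (0 : ℝ) 1, η t ∈ Metric.ball (extChartAt (𝓡 2) p p) r := by
    intro t ht
    refine (convex_ball _ _).segment_subset hζ hζ' ?_
    rw [segment_eq_image_lineMap]
    exact ⟨t, ht, rfl⟩
  have hηs : ContMDiff 𝓘(ℝ, ℝ) 𝓘(ℝ, Plane) 1 η := by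
    rw [contMDiff_iff_contDiff]
    exact ContinuousAffineMap.contDiff _
  set γ : ℝ → S := (extChartAt (𝓡 2) p).symm ∘ η with hγ
  have hγs : ContMDiffOn 𝓘(ℝ, ℝ) (𝓡 2) 1 γ (Icc 0 1) :=
    (contMDiffOn_extChartAt_symm p).comp hηs.contMDiffOn fun t ht => (hball _ (hηb t ht)).1
  rw [IsRiemannianManifold.out (I := 𝓡 2)]
  refine (Manifold.riemannianEDist_le_pathELength hγs (by simp [hγ, hη0])
    (by simp [hγ, hη1]) zero_le_one).trans ?_
  rw [Manifold.pathELength_eq_lintegral_mfderivWithin_Icc,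
    ← lintegral_fderiv_lineMap_eq_edist, ← lintegral_const_mul' _ _ ENNReal.coe_ne_top]
  refine setLIntegral_mono' measurableSet_Icc fun t ht => ?_
  have ht' := hball _ (hηb t ht)
  have hd := hasDerivWithinAt_chart_comp (p := p) (hγs.mdifferentiableOn one_ne_zero t ht)
    ((extChartAt (𝓡 2) p).map_target ht'.1)
  have e : derivWithin η (Icc 0 1) t =
      chartDeriv p (γ t) (mfderivWithin 𝓘(ℝ, ℝ) (𝓡 2) γ (Icc 0 1) t (1 : ℝ)) := by
    refine HasDerivWithinAt.derivWithin (hd.congr_of_mem (fun u hu => ?_) ht)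
      (uniqueDiffOn_Icc zero_lt_one t ht)
    simp only [hγ, Function.comp_apply]
    exact ((extChartAt (𝓡 2) p).right_inv (hball _ (hηb u hu)).1).symm
  have h3 := ht'.2 (mfderivWithin 𝓘(ℝ, ℝ) (𝓡 2) γ (Icc 0 1) t (1 : ℝ))
  change ‖mfderivWithin 𝓘(ℝ, ℝ) (𝓡 2) γ (Icc 0 1) t (1 : ℝ)‖ ≤ C * ‖chartDeriv p (γ t)
    (mfderivWithin 𝓘(ℝ, ℝ) (𝓡 2) γ (Icc 0 1) t (1 : ℝ))‖ at h3
  rw [← e] at h3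
  change _ ≤ (C : ℝ≥0∞) * ‖derivWithin η (Icc 0 1) t‖ₑ
  simp only [enorm_eq_nnnorm]
  exact_mod_cast h3

/-- A chart is locally Lipschitz for the Riemannian distance. -/
theorem exists_edist_chart_le_edist (p : S) :
    ∃ C : ℝ≥0, 0 < C ∧ ∃ c > (0 : ℝ≥0∞), ∀ y y' : S, edist p y < c → edist p y' < c →
      y ∈ (extChartAt (𝓡 2) p).source ∧
      edist (extChartAt (𝓡 2) p y) (extChartAt (𝓡 2) p y') ≤ C * edist y y' := by
  obtain ⟨C, hC, h⟩ := eventually_norm_chartDeriv_le p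
  obtain ⟨c₁, hc₁, hball⟩ := EMetric.mem_nhds_iff.1
    (h.and (extChartAt_source_mem_nhds (I := 𝓡 2) p))
  set c := min c₁ 1
  have hc : 0 < c := lt_min hc₁ one_pos
  have hctop : c ≠ ⊤ := ne_top_of_le_ne_top ENNReal.one_ne_top (min_le_right _ _)
  have hball' : ∀ y, edist p y < c → (∀ v : TangentSpace (𝓡 2) y, ‖chartDeriv p y v‖ ≤ C * ‖v‖) ∧
    y ∈ (extChartAt (𝓡 2) p).source := fun y hy =>
      hball (by simpa [edist_comm] using hy.trans_le (min_le_left _ _))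
  -- Two points within c/3 of p are joined by curves of length less than 2c/3, and such curves stay
  -- within c of p, where the derivative of the chart is bounded.
  refine ⟨C, hC, c / 3, ENNReal.div_pos hc.ne' (by simp), fun y y' hy hy' => ⟨(hball' y
    (hy.trans_le (ENNReal.div_le_of_le_mul (le_mul_of_one_le_right' (by norm_num))))).2, ?_⟩⟩
  have hc3 : c / 3 + (c / 3 + c / 3) = c := by rw [← add_assoc, ENNReal.add_thirds]
  have hyy : edist y y' < c / 3 + c / 3 :=
    (edist_triangle_left y y' p).trans_lt (ENNReal.add_lt_add hy hy')
  have key : ∀ R, edist y y' < R → R ≤ c / 3 + c / 3 →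
      edist (extChartAt (𝓡 2) p y) (extChartAt (𝓡 2) p y') ≤ C * R := by
    intro R hR hRc
    rw [IsRiemannianManifold.out (I := 𝓡 2)] at hR
    obtain ⟨γ, h0, h1, hγs, hlen⟩ := Manifold.exists_lt_of_riemannianEDist_lt hR
    have hγb : ∀ t ∈ Icc (0 : ℝ) 1, edist p (γ t) < c := by
      intro t ht
      have e1 : edist y (γ t) ≤ R := by
        rw [IsRiemannianManifold.out (I := 𝓡 2)]
        exact ((Manifold.riemannianEDist_le_pathELength (hγs.mono (Icc_subset_Icc_right ht.2)) h0
          rfl ht.1).trans (Manifold.pathELength_mono le_rfl ht.2)).trans hlen.le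
      calc edist p (γ t) ≤ edist p y + edist y (γ t) := edist_triangle _ _ _
        _ < c / 3 + (c / 3 + c / 3) := ENNReal.add_lt_add_of_lt_of_le
            (ne_top_of_le_ne_top hctop ((e1.trans hRc).trans
              (le_add_self.trans hc3.le))) hy (e1.trans hRc)
        _ = c := hc3
    have hγ's : ContMDiffOn 𝓘(ℝ, ℝ) 𝓘(ℝ, Plane) 1 (extChartAt (𝓡 2) p ∘ γ) (Icc 0 1) :=
      contMDiffOn_extChartAt.comp hγs fun t ht => by
        simpa using (hball' _ (hγb t ht)).2
    calc edist (extChartAt (𝓡 2) p y) (extChartAt (𝓡 2) p y')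
        = ‖(extChartAt (𝓡 2) p ∘ γ) 1 - (extChartAt (𝓡 2) p ∘ γ) 0‖ₑ := by
          rw [edist_comm, edist_eq_enorm_sub]; simp [h0, h1]
      _ ≤ ∫⁻ t in Icc (0 : ℝ) 1, ‖derivWithin (extChartAt (𝓡 2) p ∘ γ) (Icc 0 1) t‖ₑ :=
          enorm_sub_le_lintegral_derivWithin_Icc_of_contDiffOn_Icc
            (contMDiffOn_iff_contDiffOn.1 hγ's) zero_le_one
      _ ≤ ∫⁻ t in Icc (0 : ℝ) 1, C * ‖mfderivWithin 𝓘(ℝ, ℝ) (𝓡 2) γ (Icc 0 1) t (1 : ℝ)‖ₑ := by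
          refine setLIntegral_mono' measurableSet_Icc fun t ht => ?_
          have hb := hball' _ (hγb t ht)
          rw [(hasDerivWithinAt_chart_comp (p := p) (hγs.mdifferentiableOn one_ne_zero t ht)
            hb.2).derivWithin (uniqueDiffOn_Icc zero_lt_one t ht)]
          simp only [enorm_eq_nnnorm]
          exact_mod_cast hb.1 _
      _ = C * Manifold.pathELength (𝓡 2) γ 0 1 := by
          rw [lintegral_const_mul' _ _ ENNReal.coe_ne_top,
            Manifold.pathELength_eq_lintegral_mfderivWithin_Icc]
          rfl
      _ ≤ C * R := by gcongr
  have hC0 : (C : ℝ≥0∞) ≠ 0 := by exact_mod_cast hC.ne'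
  rw [mul_comm, ← ENNReal.div_le_iff_le_mul (Or.inl hC0) (Or.inl ENNReal.coe_ne_top)]
  -- Infimum over the lengths R of connecting curves; replacing R by its minimum with 2c/3 keeps the
  -- curves in the good ball.
  refine le_of_forall_gt_imp_ge_of_dense fun R hR => ?_
  rw [ENNReal.div_le_iff_le_mul (Or.inl hC0) (Or.inl ENNReal.coe_ne_top), mul_comm]
  refine (key (min R (c / 3 + c / 3)) (lt_min hR hyy) (min_le_right _ _)).trans ?_
  gcongr
  exact min_le_left _ _

end LocalGeometry

end SurfaceStable

/-! ### Uniform control of charts over a compact set -/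

namespace SurfaceStable

set_option linter.unusedSectionVars false

section UniformCharts

open scoped ENNReal NNReal

variable {S : Type*} [EMetricSpace S] [ChartedSpace (EuclideanSpace ℝ (Fin 2)) S]
  [IsManifold (𝓡 2) ∞ S]

/-- The parametrization of a neighborhood of `x` by the chart at `p`, centered at `x`. -/
noncomputable def par (p x : S) (ζ : Plane) : S := (extChartAt (𝓡 2) p).symm (extChartAt (𝓡 2) p x + ζ)

/-- The coordinates centered at `x` in the chart at `p`. -/
noncomputable def crd (p x y : S) : Plane := extChartAt (𝓡 2) p y - extChartAt (𝓡 2) p x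

variable [RiemannianBundle (fun x : S => TangentSpace (𝓡 2) x)]

/-- The chart at `p` behaves well around `x`: the compact set `Q` lies in `U` and in the domain of
the chart, contains balls around `x`, and the chart distorts norms and distances by a bounded
factor. -/
structure ChartControl (U : Set S) (p x : S) (Q : Set S) (K : ℝ) : Prop where
  one_le : 1 ≤ K
  isCompact : IsCompact Q
  subset : Q ⊆ U
  subset_source : Q ⊆ (extChartAt (𝓡 2) p).source
  mem : x ∈ Q
  add_mem : ∀ ζ : Plane, ‖ζ‖ ≤ K⁻¹ → extChartAt (𝓡 2) p x + ζ ∈ (extChartAt (𝓡 2) p).target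
  par_mem : ∀ ζ : Plane, ‖ζ‖ ≤ K⁻¹ → par p x ζ ∈ Q
  norm_le : ∀ y ∈ Q, ∀ v : TangentSpace (𝓡 2) y, ‖chartDeriv p y v‖ ≤ K * ‖v‖
  le_norm : ∀ y ∈ Q, ∀ v : TangentSpace (𝓡 2) y, ‖v‖ ≤ K * ‖chartDeriv p y v‖
  edist_le : ∀ ζ ζ' : Plane, ‖ζ‖ ≤ K⁻¹ → ‖ζ'‖ ≤ K⁻¹ →
    edist (par p x ζ) (par p x ζ') ≤ ENNReal.ofReal (K * ‖ζ - ζ'‖)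
  mem_of_edist_le : ∀ y, edist x y ≤ ENNReal.ofReal K⁻¹ → y ∈ Q
  norm_crd_sub_le : ∀ y y', edist x y ≤ ENNReal.ofReal K⁻¹ → edist x y' ≤ ENNReal.ofReal K⁻¹ →
    ∀ t : ℝ, 0 ≤ t → edist y y' ≤ ENNReal.ofReal t → ‖crd p x y - crd p x y'‖ ≤ K * t

theorem ChartControl.mono {U Q : Set S} {p x : S} {K K' : ℝ} (h : ChartControl U p x Q K)
    (hK : K ≤ K') : ChartControl U p x Q K' := by
  have h0 : 0 < K := one_pos.trans_le h.one_le
  have hi : K'⁻¹ ≤ K⁻¹ := inv_anti₀ h0 hK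
  have ho : ENNReal.ofReal K'⁻¹ ≤ ENNReal.ofReal K⁻¹ := ENNReal.ofReal_le_ofReal hi
  refine ⟨h.one_le.trans hK, h.isCompact, h.subset, h.subset_source, h.mem,
    fun ζ hζ => h.add_mem ζ (hζ.trans hi), fun ζ hζ => h.par_mem ζ (hζ.trans hi),
    fun y hy v => (h.norm_le y hy v).trans (by gcongr),
    fun y hy v => (h.le_norm y hy v).trans (by gcongr),
    fun ζ ζ' hζ hζ' => (h.edist_le ζ ζ' (hζ.trans hi) (hζ'.trans hi)).trans
      (ENNReal.ofReal_le_ofReal (by gcongr)),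
    fun y hy => h.mem_of_edist_le y (hy.trans ho), fun y y' hy hy' t ht hyt =>
      (h.norm_crd_sub_le y y' (hy.trans ho) (hy'.trans ho) t ht hyt).trans (by gcongr)⟩

theorem crd_par {U Q : Set S} {p x : S} {K : ℝ} (h : ChartControl U p x Q K) {ζ : Plane}
    (hζ : ‖ζ‖ ≤ K⁻¹) : crd p x (par p x ζ) = ζ := by
  rw [crd, par, (extChartAt (𝓡 2) p).right_inv (h.add_mem ζ hζ)]
  simp

theorem par_crd {U Q : Set S} {p x : S} {K : ℝ} (h : ChartControl U p x Q K) {y : S}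
    (hy : y ∈ Q) : par p x (crd p x y) = y := by
  rw [crd, par, add_sub_cancel, (extChartAt (𝓡 2) p).left_inv (h.subset_source hy)]

variable [IsContinuousRiemannianBundle (EuclideanSpace ℝ (Fin 2))
    (fun x : S => TangentSpace (𝓡 2) x)] [IsRiemannianManifold (𝓡 2) S]

/-- Q is a closed coordinate ball of radius 2R at p. When x is within R of p in coordinates, the
ball of radius R around x is still in Q, so one pair (Q, K) serves all x near p and compactness can
be applied. -/
theorem exists_chartControl {U : Set S} (hU : IsOpen U) {p : S} (hp : p ∈ U) :
    ∃ (Q : Set S) (K : ℝ), ∀ᶠ x in 𝓝 p, ChartControl U p x Q K := by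
  obtain ⟨C₁, hC₁, h₁⟩ := eventually_norm_chartDeriv_le p
  obtain ⟨C₂, hC₂, h₂⟩ := eventually_le_norm_chartDeriv p
  obtain ⟨C₃, hC₃, r₃, hr₃, h₃⟩ := exists_edist_le_edist_chart p
  obtain ⟨C₄, hC₄, c₄, hc₄, h₄⟩ := exists_edist_chart_le_edist p
  have hnear : ∀ᶠ ζ in 𝓝 (extChartAt (𝓡 2) p p), ζ ∈ (extChartAt (𝓡 2) p).target ∧
      ((extChartAt (𝓡 2) p).symm ζ ∈ U ∧
      (∀ v : TangentSpace (𝓡 2) ((extChartAt (𝓡 2) p).symm ζ),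
        ‖chartDeriv p ((extChartAt (𝓡 2) p).symm ζ) v‖ ≤ C₁ * ‖v‖) ∧
      ∀ v : TangentSpace (𝓡 2) ((extChartAt (𝓡 2) p).symm ζ),
        ‖v‖ ≤ C₂ * ‖chartDeriv p ((extChartAt (𝓡 2) p).symm ζ) v‖) := by
    refine Filter.Eventually.and (extChartAt_target_mem_nhds (I := 𝓡 2) p) ?_
    have := (continuousAt_extChartAt_symm (I := 𝓡 2) p).tendsto
    rw [extChartAt_to_inv] at this
    exact this.eventually (Filter.Eventually.and (hU.mem_nhds hp) (h₁.and h₂))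
  obtain ⟨r₁, hr₁, hball⟩ := Metric.eventually_nhds_iff_ball.1 hnear
  set R := min (r₁ / 3) (r₃ / 3)
  have hR : 0 < R := lt_min (by positivity) (by positivity)
  have hR1 : 2 * R < r₁ := by have := min_le_left (r₁ / 3) (r₃ / 3); linarith
  have hR3 : 2 * R < r₃ := by have := min_le_right (r₁ / 3) (r₃ / 3); linarith
  have hsub : Metric.closedBall (extChartAt (𝓡 2) p p) (2 * R) ⊆
    Metric.ball (extChartAt (𝓡 2) p p) r₁ := Metric.closedBall_subset_ball hR1
  have hsub3 : Metric.closedBall (extChartAt (𝓡 2) p p) (2 * R) ⊆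
    Metric.ball (extChartAt (𝓡 2) p p) r₃ := Metric.closedBall_subset_ball hR3
  set Q := (extChartAt (𝓡 2) p).symm '' Metric.closedBall (extChartAt (𝓡 2) p p) (2 * R)
  have hmemQ : ∀ y, y ∈ (extChartAt (𝓡 2) p).source →
      ‖extChartAt (𝓡 2) p y - extChartAt (𝓡 2) p p‖ ≤ 2 * R → y ∈ Q := fun y hy hyR =>
    ⟨extChartAt (𝓡 2) p y, by simpa [dist_eq_norm] using hyR, (extChartAt (𝓡 2) p).left_inv hy⟩
  -- a small metric ball around `p` lies in `Q`
  have hnb : ∀ᶠ y in 𝓝 p, y ∈ (extChartAt (𝓡 2) p).source ∧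
      ‖extChartAt (𝓡 2) p y - extChartAt (𝓡 2) p p‖ < R := by
    refine Filter.Eventually.and (extChartAt_source_mem_nhds (I := 𝓡 2) p) ?_
    have := (continuousAt_extChartAt (I := 𝓡 2) p).tendsto.eventually
      (Metric.ball_mem_nhds _ hR)
    simpa [dist_eq_norm] using this
  obtain ⟨c, hc, hcball⟩ := EMetric.mem_nhds_iff.1 hnb
  obtain ⟨e, he, hec⟩ : ∃ e : ℝ, 0 < e ∧ ENNReal.ofReal e + ENNReal.ofReal e < min c c₄ := by
    obtain ⟨e, he, he'⟩ := ENNReal.lt_iff_exists_nnreal_btwn.1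
      (lt_min hc hc₄ : (0 : ℝ≥0∞) < min c c₄)
    refine ⟨e / 2, by simpa using he, ?_⟩
    rw [← ENNReal.ofReal_add (by positivity) (by positivity), add_halves]
    simpa using he'
  set K := 1 + C₁ + C₂ + C₃ + C₄ + R⁻¹ + e⁻¹ with hKdef
  have hK : 1 ≤ K ∧ C₁ ≤ K ∧ C₂ ≤ K ∧ C₃ ≤ K ∧ C₄ ≤ K ∧ R⁻¹ ≤ K ∧ e⁻¹ ≤ K := by
    have := inv_pos.2 hR
    have := inv_pos.2 he
    have h1 := C₁.2
    have h2 := C₂.2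
    have h3 := C₃.2
    have h4 := C₄.2
    simp only [hKdef]
    refine ⟨?_, ?_, ?_, ?_, ?_, ?_, ?_⟩ <;> simp only [NNReal.val_eq_coe] at * <;> linarith
  obtain ⟨k0, k1, k2, k3, k4, k5, k6⟩ := hK
  have hKR : K⁻¹ ≤ R := inv_le_of_inv_le₀ hR k5
  have hKe : K⁻¹ ≤ e := inv_le_of_inv_le₀ he k6
  refine ⟨Q, K, ?_⟩
  have hnb2 : ∀ᶠ x in 𝓝 p, edist p x < ENNReal.ofReal e := by
    filter_upwards [Metric.eball_mem_nhds p (ENNReal.ofReal_pos.2 he)] with x hx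
    rwa [edist_comm]
  filter_upwards [hnb, hnb2] with x hx hxe
  have hclose : ∀ y, edist x y ≤ ENNReal.ofReal K⁻¹ → edist p y < min c c₄ := fun y hy =>
    calc edist p y ≤ edist p x + edist x y := edist_triangle _ _ _
      _ ≤ ENNReal.ofReal e + ENNReal.ofReal e :=
        add_le_add hxe.le (hy.trans (ENNReal.ofReal_le_ofReal hKe))
      _ < _ := hec
  have hin : ∀ ζ : Plane, ‖ζ‖ ≤ K⁻¹ →
      extChartAt (𝓡 2) p x + ζ ∈ Metric.closedBall (extChartAt (𝓡 2) p p) (2 * R) := by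
    intro ζ hζ
    rw [mem_closedBall_iff_norm, add_sub_right_comm]
    have := norm_add_le (extChartAt (𝓡 2) p x - extChartAt (𝓡 2) p p) ζ
    linarith [hx.2]
  refine ⟨k0, ?_, ?_, ?_, hmemQ x hx.1 (by linarith [hx.2]), fun ζ hζ => (hball _ (hsub (hin ζ hζ))).1,
    fun ζ hζ => ⟨_, hin ζ hζ, rfl⟩, ?_, ?_, fun ζ ζ' hζ hζ' => ?_, fun y hy => ?_,
    fun y y' hy hy' t ht hyt => ?_⟩
  · refine (isCompact_closedBall _ _).image_of_continuousOn ?_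
    exact (continuousOn_extChartAt_symm p).mono fun ζ hζ => (hball ζ (hsub hζ)).1
  · rintro _ ⟨ζ, hζ, rfl⟩
    exact (hball ζ (hsub hζ)).2.1
  · rintro _ ⟨ζ, hζ, rfl⟩
    exact (extChartAt (𝓡 2) p).map_target (hball ζ (hsub hζ)).1
  · rintro _ ⟨ζ, hζ, rfl⟩ v
    exact ((hball ζ (hsub hζ)).2.2.1 v).trans (by gcongr)
  · rintro _ ⟨ζ, hζ, rfl⟩ v
    exact ((hball ζ (hsub hζ)).2.2.2 v).trans (by gcongr)
  · refine (h₃ _ (hsub3 (hin ζ hζ)) _ (hsub3 (hin ζ' hζ'))).trans ?_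
    rw [edist_dist, dist_add_left, dist_eq_norm, ENNReal.ofReal_mul (by linarith)]
    gcongr
    rw [← ENNReal.ofReal_coe_nnreal]
    exact ENNReal.ofReal_le_ofReal k3
  · have := hcball (show y ∈ Metric.eball p c by
      simpa [edist_comm] using (hclose y hy).trans_le (min_le_left _ _))
    exact hmemQ y this.1 (by linarith [this.2])
  · have := (h₄ y y' ((hclose y hy).trans_le (min_le_right _ _))
      ((hclose y' hy').trans_le (min_le_right _ _))).2
    have e1 : crd p x y - crd p x y' = extChartAt (𝓡 2) p y - extChartAt (𝓡 2) p y' := by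
      simp [crd]
    rw [e1, ← dist_eq_norm]
    refine (edist_le_ofReal (by positivity)).1 (this.trans ?_)
    rw [ENNReal.ofReal_mul (by linarith)]
    gcongr
    rw [← ENNReal.ofReal_coe_nnreal]
    exact ENNReal.ofReal_le_ofReal k4

/-- Finitely many charts with uniform control around all points of a compact set. -/
theorem exists_uniform_charts {Λ U : Set S} (hΛ : IsCompact Λ) (hU : IsOpen U) (hΛU : Λ ⊆ U) :
    ∃ (c : S → S) (P : Finset S) (Q : S → Set S) (K : ℝ), 1 ≤ K ∧
      ∀ x ∈ Λ, c x ∈ P ∧ ChartControl U (c x) x (Q (c x)) K := by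
  have h : ∀ p : S, ∃ (Q : Set S) (K : ℝ), p ∈ Λ → ∀ᶠ x in 𝓝 p, ChartControl U p x Q K := by
    intro p
    by_cases hp : p ∈ Λ
    · obtain ⟨Q, K, h⟩ := exists_chartControl hU (hΛU hp)
      exact ⟨Q, K, fun _ => h⟩
    · exact ⟨∅, 0, fun h => absurd h hp⟩
  choose Q K hQK using h
  obtain ⟨P, hP, hcov⟩ := hΛ.elim_nhds_subcover (fun p => {x | p ∈ Λ → ChartControl U p x (Q p) (K p)})
    fun p hp => (hQK p hp).mono fun x hx _ => hx
  have : ∀ x, ∃ p, x ∈ Λ → p ∈ P ∧ ChartControl U p x (Q p) (K p) := by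
    intro x
    by_cases hx : x ∈ Λ
    · obtain ⟨p, hp, hxp⟩ := mem_iUnion₂.1 (hcov hx)
      exact ⟨p, fun _ => ⟨hp, hxp (hP p hp)⟩⟩
    · exact ⟨x, fun h => absurd h hx⟩
  choose c hc using this
  obtain ⟨M, hM⟩ := (P.image K).exists_le
  refine ⟨c, P, Q, max 1 M, le_max_left _ _, fun x hx => ⟨(hc x hx).1, (hc x hx).2.mono ?_⟩⟩
  exact (hM _ (Finset.mem_image_of_mem K (hc x hx).1)).trans (le_max_right _ _)

end UniformCharts

end SurfaceStable

/-! ### Local representatives of the maps -/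

namespace SurfaceStable

set_option linter.unusedSectionVars false

/-- The mean value inequality on the convex ball turns the bound on the second derivative into a
Lipschitz bound on the first. -/
theorem hasLipDeriv_of_iteratedFDeriv_bound {E G : Type*} [NormedAddCommGroup E] [NormedSpace ℝ E]
    [NormedAddCommGroup G] [NormedSpace ℝ G] {g : E → G} {b : E} {C K r : ℝ}
    (hg : ∀ ζ : E, ‖ζ‖ ≤ r → ContDiffAt ℝ 2 g (b + ζ))
    (hC : ∀ ζ : E, ‖ζ‖ ≤ r → ∀ k : ℕ, k ≤ 2 → ‖iteratedFDeriv ℝ k g (b + ζ)‖ ≤ C)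
    (hCK : C ≤ K) (hK : 0 < K) (hr : K⁻¹ ≤ r) :
    HasLipDeriv K (fun ζ => g (b + ζ) - g b) (fun ζ => fderiv ℝ g (b + ζ)) := by
  have h1 : ∀ ζ : E, ‖ζ‖ ≤ r → ‖fderiv ℝ g (b + ζ)‖ ≤ C := fun ζ hζ => by
    rw [← norm_iteratedFDeriv_one]; exact hC ζ hζ 1 (by norm_num)
  refine ⟨by simp, fun ζ hζ => ?_, (h1 0 (by simpa using (inv_pos.2 hK).le.trans hr)).trans hCK,
    fun ζ ζ' hζ hζ' => ?_⟩
  · have := ((hg ζ (hζ.trans hr)).differentiableAt two_ne_zero).hasFDerivAt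
    exact ((hasFDerivAt_comp_add_left b).2 this).sub_const _
  · have hd : ∀ ζ : E, ‖ζ‖ ≤ r → DifferentiableAt ℝ (fderiv ℝ g) (b + ζ) := fun ζ hζ =>
      ((hg ζ hζ).fderiv_right (m := 1) (by norm_num)).differentiableAt one_ne_zero
    refine (convex_closedBall (0 : E) K⁻¹).norm_image_sub_le_of_norm_hasFDerivWithin_le
      (f := fun ζ => fderiv ℝ g (b + ζ)) (f' := fun ζ => fderiv ℝ (fderiv ℝ g) (b + ζ))
      (fun ξ hξ => ?_) (fun ξ hξ => ?_) (by simpa using hζ') (by simpa using hζ)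
    · exact ((hasFDerivAt_comp_add_left b).2
        (hd ξ ((mem_closedBall_zero_iff.1 hξ).trans hr)).hasFDerivAt).hasFDerivWithinAt
    · rw [← norm_iteratedFDeriv_one, norm_iteratedFDeriv_fderiv]
      exact (hC ξ ((mem_closedBall_zero_iff.1 hξ).trans hr) 2 le_rfl).trans hCK

section LocalRepresentatives

open scoped ENNReal NNReal

variable {S : Type*} [EMetricSpace S] [ChartedSpace (EuclideanSpace ℝ (Fin 2)) S]
  [IsManifold (𝓡 2) ∞ S]

/-- The expression of `f` near `x`, in charts at `p` and `q` centered at `x` and `f x`. -/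
noncomputable def localRep (f : S → S) (p q x : S) (ζ : Plane) : Plane :=
  crd q (f x) (f (par p x ζ))

/-- The expression of `f` in the charts at `p` and `q`. -/
noncomputable def inCharts (f : S → S) (p q : S) : Plane → Plane :=
  extChartAt (𝓡 2) q ∘ f ∘ (extChartAt (𝓡 2) p).symm

variable {U V : Set S}

theorem DiffeoInto.contMDiffAt (f : DiffeoInto U V) {y : S} (hy : y ∈ U) :
    ContMDiffAt (𝓡 2) (𝓡 2) 2 f y := by
  have h := f.contMDiffOn_toFun
  have ho := f.open_source
  rw [f.source_eq] at h ho
  exact h.contMDiffAt (ho.mem_nhds hy)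

theorem contDiffAt_inCharts {f : S → S} {p q : S} {ζ : Plane}
    (hζ : ζ ∈ (extChartAt (𝓡 2) p).target)
    (hf : ContMDiffAt (𝓡 2) (𝓡 2) 2 f ((extChartAt (𝓡 2) p).symm ζ))
    (hq : f ((extChartAt (𝓡 2) p).symm ζ) ∈ (extChartAt (𝓡 2) q).source) :
    ContDiffAt ℝ 2 (inCharts f p q) ζ := by
  rw [← contMDiffAt_iff_contDiffAt]
  have h1 : ContMDiffAt 𝓘(ℝ, Plane) (𝓡 2) 2 (extChartAt (𝓡 2) p).symm ζ :=
    (contMDiffOn_extChartAt_symm p).contMDiffAt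
      ((isOpen_extChartAt_target p).mem_nhds hζ)
  have h2 : ContMDiffAt (𝓡 2) 𝓘(ℝ, Plane) 2 (extChartAt (𝓡 2) q)
      (f ((extChartAt (𝓡 2) p).symm ζ)) := contMDiffAt_extChartAt' (by simpa using hq)
  exact h2.comp ζ (hf.comp ζ h1)

variable [RiemannianBundle (fun x : S => TangentSpace (𝓡 2) x)]

theorem localRep_eq {f : S → S} {p q x : S} (hx : x ∈ (extChartAt (𝓡 2) p).source) (ζ : Plane) :
    localRep f p q x ζ = inCharts f p q (extChartAt (𝓡 2) p x + ζ) -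
      inCharts f p q (extChartAt (𝓡 2) p x) := by
  simp only [localRep, inCharts, crd, par, Function.comp_apply, (extChartAt (𝓡 2) p).left_inv hx]

/-- Bootstrapping: a map which is `C^1`-bounded as long as it takes values in a chart maps small
balls into the chart. -/
theorem mem_of_fderiv_bound {f : S → S} {p q x : S} {Q Q' : Set S} {K C : ℝ}
    (hf : ∀ y ∈ U, ContMDiffAt (𝓡 2) (𝓡 2) 2 f y) (hp : ChartControl U p x Q K)
    (hq : ChartControl U q (f x) Q' K)
    (hC : ∀ y ∈ Q, f y ∈ Q' → ‖fderiv ℝ (inCharts f p q) (extChartAt (𝓡 2) p y)‖ ≤ C)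
    {ζ : Plane} (hζ : ‖ζ‖ ≤ K⁻¹) (hζ' : C * ‖ζ‖ < K⁻¹) (hC0 : 0 ≤ C) : f (par p x ζ) ∈ Q' := by
  have hK : 0 < K := one_pos.trans_le hp.one_le
  set Z := par q (f x) '' Metric.closedBall 0 K⁻¹ with hZ
  have hZQ : Z ⊆ Q' := by
    rintro _ ⟨ξ, hξ, rfl⟩
    exact hq.par_mem ξ (mem_closedBall_zero_iff.1 hξ)
  have hZc : IsClosed Z := by
    refine (IsCompact.image_of_continuousOn (isCompact_closedBall _ _) ?_).isClosed
    refine (continuousOn_extChartAt_symm q).comp (by fun_prop) fun ξ hξ => ?_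
    exact hq.add_mem ξ (mem_closedBall_zero_iff.1 hξ)
  have htζ : ∀ t ∈ Icc (0 : ℝ) 1, ‖t • ζ‖ ≤ K⁻¹ := fun t ht => by
    rw [norm_smul, Real.norm_eq_abs, abs_of_nonneg ht.1]
    exact (mul_le_of_le_one_left (norm_nonneg _) ht.2).trans hζ
  have hgc : ContinuousOn (fun t : ℝ => f (par p x (t • ζ))) (Icc 0 1) := by
    intro t ht
    have h1 : ContinuousAt f (par p x (t • ζ)) :=
      (hf _ (hp.subset (hp.par_mem _ (htζ t ht)))).continuousAt
    have h2 : ContinuousAt (fun t : ℝ => par p x (t • ζ)) t := by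
      refine ContinuousAt.comp (g := (extChartAt (𝓡 2) p).symm)
        (f := fun t : ℝ => extChartAt (𝓡 2) p x + t • ζ) ?_ (by fun_prop)
      exact continuousAt_extChartAt_symm'' (hp.add_mem _ (htζ t ht))
    exact (ContinuousAt.comp (f := fun t : ℝ => par p x (t • ζ)) h1 h2).continuousWithinAt
  -- Continuity argument along the segment from x: the times at which the image lies in the closed
  -- coordinate ball Z form a closed set. It is open to the right since, up to such a time, the
  -- derivative bound places the image at coordinate distance at most C ‖ζ‖ < K⁻¹, strictly inside.
  set A := {t : ℝ | f (par p x (t • ζ)) ∈ Z}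
  have hAc : IsClosed (A ∩ Icc 0 1) := by
    rw [inter_comm]
    exact hgc.preimage_isClosed_of_isClosed isClosed_Icc hZc
  have h0 : (0 : ℝ) ∈ A := by
    refine ⟨0, by simpa using hK.le, ?_⟩
    have := crd_par hp (ζ := 0) (by simpa using hK.le)
    simp only [par, add_zero, zero_smul, (extChartAt (𝓡 2) p).left_inv (hp.subset_source hp.mem),
      (extChartAt (𝓡 2) q).left_inv (hq.subset_source hq.mem)]
  suffices Icc (0 : ℝ) 1 ⊆ A by
    have := hZQ (this (right_mem_Icc.2 zero_le_one))
    rwa [one_smul] at this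
  refine hAc.Icc_subset_of_forall_mem_nhdsGT_of_Icc_subset h0 fun t ht hA => ?_
  have hder : ∀ s ∈ Icc (0 : ℝ) t, HasDerivWithinAt (fun s : ℝ => localRep f p q x (s • ζ))
      (fderiv ℝ (inCharts f p q) (extChartAt (𝓡 2) p x + s • ζ) ζ) (Icc 0 t) s := by
    intro s hs
    have hs1 : s ∈ Icc (0 : ℝ) 1 := ⟨hs.1, hs.2.trans ht.2.le⟩
    have hm := hp.par_mem _ (htζ s hs1)
    have h1 : DifferentiableAt ℝ (inCharts f p q) (extChartAt (𝓡 2) p x + s • ζ) :=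
      (contDiffAt_inCharts (hp.add_mem _ (htζ s hs1)) (hf _ (hp.subset hm))
        (hq.subset_source (hZQ (hA hs)))).differentiableAt two_ne_zero
    have h2 : HasDerivAt (fun s : ℝ => extChartAt (𝓡 2) p x + s • ζ) ζ s := by
      simpa using ((hasDerivAt_id s).smul_const ζ).const_add (extChartAt (𝓡 2) p x)
    have h3 := (h1.hasFDerivAt.comp_hasDerivAt s h2).sub_const
      (inCharts f p q (extChartAt (𝓡 2) p x))
    refine (h3.congr_of_eventuallyEq (Eventually.of_forall fun u => ?_)).hasDerivWithinAt
    exact localRep_eq (hp.subset_source hp.mem) _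
  have hbound := norm_image_sub_le_of_norm_deriv_le_segment' (C := C * ‖ζ‖) hder (fun s hs => by
    have hs' : s ∈ Icc (0 : ℝ) t := ⟨hs.1, hs.2.le⟩
    have hs1 : s ∈ Icc (0 : ℝ) 1 := ⟨hs.1, hs'.2.trans ht.2.le⟩
    refine ContinuousLinearMap.le_of_opNorm_le _ ?_ _
    have := hC _ (hp.par_mem _ (htζ s hs1)) (hZQ (hA hs'))
    rwa [par, (extChartAt (𝓡 2) p).right_inv (hp.add_mem _ (htζ s hs1))] at this) t
    (right_mem_Icc.2 ht.1)
  have hz : localRep f p q x ((0 : ℝ) • ζ) = 0 := by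
    rw [localRep_eq (hp.subset_source hp.mem)]; simp
  rw [hz, sub_zero, sub_zero] at hbound
  have hlt : ‖localRep f p q x (t • ζ)‖ < K⁻¹ := by
    refine lt_of_le_of_lt (hbound.trans ?_) hζ'
    exact mul_le_of_le_one_right (by positivity) ht.2.le
  have htA : f (par p x (t • ζ)) ∈ (extChartAt (𝓡 2) q).source :=
    hq.subset_source (hZQ (hA (right_mem_Icc.2 ht.1)))
  have hnb : ∀ᶠ y in 𝓝 (f (par p x (t • ζ))), y ∈ Z := by
    have h1 : ContinuousAt (fun y => ‖crd q (f x) y‖) (f (par p x (t • ζ))) :=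
      ((continuousAt_extChartAt' (I := 𝓡 2) htA).sub continuousAt_const).norm
    filter_upwards [(isOpen_extChartAt_source (I := 𝓡 2) q).mem_nhds htA,
      h1.eventually_lt_const hlt] with y hy hy'
    refine ⟨crd q (f x) y, mem_closedBall_zero_iff.2 hy'.le, ?_⟩
    rw [crd, par, add_sub_cancel, (extChartAt (𝓡 2) q).left_inv hy]
  have := (hgc t ⟨ht.1, ht.2.le⟩).eventually hnb
  have h5 : 𝓝[>] t ≤ 𝓝[Icc 0 1] t := by
    rw [← nhdsWithin_Ioc_eq_nhdsGT ht.2]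
    exact nhdsWithin_mono _ fun u hu => ⟨ht.1.trans hu.1.le, hu.2⟩
  exact h5 this

end LocalRepresentatives

end SurfaceStable

/-! ### Uniform bounds for the maps and for an immersion -/

namespace SurfaceStable

set_option linter.unusedSectionVars false

section Uniformity

open scoped ENNReal NNReal

variable {S : Type*} [EMetricSpace S] [ChartedSpace (EuclideanSpace ℝ (Fin 2)) S]
  [IsManifold (𝓡 2) ∞ S]

/-- A neighborhood of a compact subset of a surface can be immersed in a Euclidean space by a
globally defined smooth map. -/
theorem exists_immersion_of_isCompact {Λ : Set S} (hΛ : IsCompact Λ) :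
    ∃ (P : Finset S) (Φ : S → PiLp 2 fun _ : P => Plane),
      ContMDiff (𝓡 2) 𝓘(ℝ, PiLp 2 fun _ : P => Plane) ∞ Φ ∧
      ∀ x ∈ Λ, Function.Injective (mfderiv (𝓡 2) 𝓘(ℝ, PiLp 2 fun _ : P => Plane) Φ x) := by
  let f : ∀ p : S, SmoothBumpFunction (𝓡 2) p := fun p => Classical.choice inferInstance
  obtain ⟨P, -, hP⟩ := hΛ.elim_nhds_subcover (fun p => {x | f p =ᶠ[𝓝 x] 1})
    fun p _ => eventually_eventually_nhds.2 (f p).eventuallyEq_one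
  -- The bump functions make each block globally smooth. Near every point of Λ some bump function is
  -- identically 1, so that block is a chart and Ψ is immersive there.
  let Ψ : S → ∀ _ : P, Plane := fun x p => f p x • extChartAt (𝓡 2) (p : S) x
  have hΨ : ContMDiff (𝓡 2) 𝓘(ℝ, ∀ _ : P, Plane) ∞ Ψ :=
    contMDiff_pi_space.2 fun p => (f p).contMDiff_smul contMDiffOn_extChartAt
  let L := (PiLp.continuousLinearEquiv 2 ℝ fun _ : P => Plane).symm
  have hΦ : ContMDiff (𝓡 2) 𝓘(ℝ, PiLp 2 fun _ : P => Plane) ∞ (L ∘ Ψ) :=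
    L.contDiff.contMDiff.comp hΨ
  refine ⟨P, L ∘ Ψ, hΦ, fun x hx => ?_⟩
  obtain ⟨p, hp, hxp⟩ := mem_iUnion₂.1 (hP hx)
  have hxs : x ∈ (chartAt Plane p).source := by
    refine (f p).support_subset_source ?_
    rw [Function.mem_support, hxp.self_of_nhds]
    exact one_ne_zero
  let pr : (PiLp 2 fun _ : P => Plane) →L[ℝ] Plane := PiLp.proj 2 (fun _ : P => Plane) ⟨p, hp⟩
  have h1 : HasMFDerivAt (𝓡 2) 𝓘(ℝ, Plane) (pr ∘ (L ∘ Ψ)) x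
      (pr.comp (mfderiv (𝓡 2) 𝓘(ℝ, PiLp 2 fun _ : P => Plane) (L ∘ Ψ) x)) :=
    pr.hasMFDerivAt.comp x ((hΦ.mdifferentiableAt (by simp)).hasMFDerivAt)
  have h2 : HasMFDerivAt (𝓡 2) 𝓘(ℝ, Plane) (pr ∘ (L ∘ Ψ)) x (chartDeriv p x) := by
    refine (mdifferentiableAt_extChartAt hxs).hasMFDerivAt.congr_of_eventuallyEq ?_
    filter_upwards [hxp] with y hy
    change f p y • extChartAt (𝓡 2) p y = _
    rw [hy, Pi.one_apply, one_smul]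
  have h3 := hasMFDerivAt_unique h1 h2
  have hinj := (chartDeriv_bijective (p := p) (y := x) (by simpa using hxs)).1
  rw [← h3] at hinj
  intro u w huw
  exact hinj (congrArg pr huw)

variable [RiemannianBundle (fun x : S => TangentSpace (𝓡 2) x)]

/-- Finitely many charts with uniform control around all points of a compact set. -/
structure UniformCharts (Λ U : Set S) (c : S → S) (P : Finset S) (Q : S → Set S) (K : ℝ) :
    Prop where
  one_le : 1 ≤ K
  mem : ∀ x ∈ Λ, c x ∈ P
  control : ∀ x ∈ Λ, ChartControl U (c x) x (Q (c x)) K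

variable {Λ U V : Set S} {c : S → S} {P : Finset S} {Q : S → Set S} {K : ℝ}

theorem UniformCharts.mono (h : UniformCharts Λ U c P Q K) {K' : ℝ} (hK : K ≤ K') :
    UniformCharts Λ U c P Q K' :=
  ⟨h.one_le.trans hK, h.mem, fun x hx => (h.control x hx).mono hK⟩

/-- The local representatives of the maps of a `C^2`-bounded set are uniformly `C^{1,1}` around the
points of a compact set that are mapped to the compact set. -/
theorem exists_uniform_localRep (h : UniformCharts Λ U c P Q K) {D : Set (DiffeoInto U V)}
    (hD : IsC2Bounded D) :
    ∃ K' : ℝ, K ≤ K' ∧ ∀ f ∈ D, ∀ x ∈ Λ, f x ∈ Λ →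
      HasLipDeriv K' (localRep f (c x) (c (f x)) x)
        (fun ζ => fderiv ℝ (inCharts f (c x) (c (f x))) (extChartAt (𝓡 2) (c x) x + ζ)) ∧
      ∀ ζ : Plane, ‖ζ‖ ≤ K'⁻¹ → f (par (c x) x ζ) ∈ Q (c (f x)) := by
  have hex : ∀ pq : S × S, ∃ C : ℝ, IsCompact (Q pq.1) → Q pq.1 ⊆ U →
      Q pq.1 ⊆ (extChartAt (𝓡 2) pq.1).source → IsCompact (Q pq.2) →
      Q pq.2 ⊆ (extChartAt (𝓡 2) pq.2).source → ∀ f ∈ D, ∀ y ∈ Q pq.1, f y ∈ Q pq.2 →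
        ∀ k : ℕ, k ≤ 2 →
        ‖iteratedFDeriv ℝ k (inCharts f pq.1 pq.2) (extChartAt (𝓡 2) pq.1 y)‖ ≤ C := by
    intro pq
    by_cases hc : IsCompact (Q pq.1) ∧ Q pq.1 ⊆ U ∧ Q pq.1 ⊆ (extChartAt (𝓡 2) pq.1).source ∧
      IsCompact (Q pq.2) ∧ Q pq.2 ⊆ (extChartAt (𝓡 2) pq.2).source
    · obtain ⟨C, hC⟩ := hD pq.1 pq.2 (Q pq.1) (Q pq.2) hc.1 hc.2.1 hc.2.2.1 hc.2.2.2.1 hc.2.2.2.2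
      exact ⟨C, fun _ _ _ _ _ => hC⟩
    · exact ⟨0, fun h1 h2 h3 h4 h5 => absurd ⟨h1, h2, h3, h4, h5⟩ hc⟩
  choose C hC using hex
  obtain ⟨M, hM⟩ := ((P ×ˢ P).image C).exists_le
  set M' := max M 0
  have hM0 : 0 ≤ M' := le_max_right _ _
  -- The summand K (M' + 1) gives M' / K' < 1 / K, the strict inequality of the continuity argument
  -- in `mem_of_fderiv_bound`.
  set K' := K + M' + (K * (M' + 1)) with hK'
  have hK := h.one_le
  have hKK : K ≤ K' := by rw [hK']; nlinarith
  have hK0 : 0 < K' := by linarith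
  have hsmall : K'⁻¹ ≤ K⁻¹ := inv_anti₀ (by linarith) hKK
  have hMK : M' * K'⁻¹ < K⁻¹ := by
    have h1 : K * (M' + 1) ≤ K' := by rw [hK']; linarith
    rw [← div_eq_mul_inv, div_lt_iff₀ hK0, inv_mul_eq_div, lt_div_iff₀ (by linarith)]
    nlinarith
  refine ⟨K', hKK, fun f hf x hx hfx => ?_⟩
  have hp := h.control x hx
  have hq := h.control (f x) hfx
  have hbd : ∀ y ∈ Q (c x), f y ∈ Q (c (f x)) → ∀ k : ℕ, k ≤ 2 →
      ‖iteratedFDeriv ℝ k (inCharts f (c x) (c (f x))) (extChartAt (𝓡 2) (c x) y)‖ ≤ M' := by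
    intro y hy hfy k hk
    refine (hC (c x, c (f x)) hp.isCompact hp.subset hp.subset_source hq.isCompact
      hq.subset_source f hf y hy hfy k hk).trans (le_trans ?_ (le_max_left _ _))
    exact hM _ (Finset.mem_image_of_mem C (Finset.mk_mem_product (h.mem x hx) (h.mem _ hfx)))
  have hmem : ∀ ζ : Plane, ‖ζ‖ ≤ K'⁻¹ → f (par (c x) x ζ) ∈ Q (c (f x)) := by
    intro ζ hζ
    refine mem_of_fderiv_bound (fun y hy => f.contMDiffAt hy) hp hq (C := M') ?_
      (hζ.trans hsmall) ?_ hM0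
    · intro y hy hfy
      rw [← norm_iteratedFDeriv_one]
      exact hbd y hy hfy 1 (by norm_num)
    · exact (mul_le_mul_of_nonneg_left hζ hM0).trans_lt hMK
  refine ⟨?_, hmem⟩
  have e : localRep f (c x) (c (f x)) x = fun ζ =>
      inCharts f (c x) (c (f x)) (extChartAt (𝓡 2) (c x) x + ζ) -
        inCharts f (c x) (c (f x)) (extChartAt (𝓡 2) (c x) x) :=
    funext fun ζ => localRep_eq (hp.subset_source hp.mem) ζ
  rw [e]
  refine hasLipDeriv_of_iteratedFDeriv_bound (C := M') (r := K'⁻¹) (fun ζ hζ => ?_)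
    (fun ζ hζ k hk => ?_) (by rw [hK']; nlinarith) hK0 le_rfl
  · have hζ' := hζ.trans hsmall
    exact contDiffAt_inCharts (hp.add_mem ζ hζ') (f.contMDiffAt (hp.subset (hp.par_mem ζ hζ')))
      (hq.subset_source (hmem ζ hζ))
  · have hζ' := hζ.trans hsmall
    have := hbd _ (hp.par_mem ζ hζ') (hmem ζ hζ) k hk
    rwa [par, (extChartAt (𝓡 2) (c x)).right_inv (hp.add_mem ζ hζ')] at this

variable {G : Type*} [NormedAddCommGroup G]

/-- A smooth map is uniformly `C^{1,1}` in uniform charts. -/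
theorem exists_uniform_smooth [NormedSpace ℝ G] (h : UniformCharts Λ U c P Q K) {Φ : S → G}
    (hΦ : ContMDiff (𝓡 2) 𝓘(ℝ, G) ∞ Φ) :
    ∃ K' : ℝ, K ≤ K' ∧ ∀ x ∈ Λ, HasLipDeriv K' (fun ζ => Φ (par (c x) x ζ) - Φ x)
      (fun ζ => fderiv ℝ (Φ ∘ (extChartAt (𝓡 2) (c x)).symm) (extChartAt (𝓡 2) (c x) x + ζ)) := by
  have hsm : ∀ p : S, ∀ ζ ∈ (extChartAt (𝓡 2) p).target,
      ContDiffAt ℝ 2 (Φ ∘ (extChartAt (𝓡 2) p).symm) ζ := by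
    intro p ζ hζ
    rw [← contMDiffAt_iff_contDiffAt]
    have h1 : ContMDiffAt 𝓘(ℝ, Plane) (𝓡 2) 2 (extChartAt (𝓡 2) p).symm ζ :=
      (contMDiffOn_extChartAt_symm p).contMDiffAt
        ((isOpen_extChartAt_target p).mem_nhds hζ)
    exact ((hΦ.of_le (by norm_cast)).contMDiffAt).comp ζ h1
  have hex : ∀ p : S, ∃ C : ℝ, IsCompact (Q p) → Q p ⊆ (extChartAt (𝓡 2) p).source →
      ∀ y ∈ Q p, ∀ k : ℕ, k ≤ 2 →
      ‖iteratedFDeriv ℝ k (Φ ∘ (extChartAt (𝓡 2) p).symm) (extChartAt (𝓡 2) p y)‖ ≤ C := by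
    intro p
    by_cases hc : IsCompact (Q p) ∧ Q p ⊆ (extChartAt (𝓡 2) p).source
    · have hk : ∀ k : ℕ, ∃ C : ℝ, k ≤ 2 → ∀ y ∈ Q p,
          ‖iteratedFDeriv ℝ k (Φ ∘ (extChartAt (𝓡 2) p).symm) (extChartAt (𝓡 2) p y)‖ ≤ C := by
        intro k
        by_cases hk : k ≤ 2
        · have hcont : ContinuousOn (fun y => iteratedFDeriv ℝ k (Φ ∘ (extChartAt (𝓡 2) p).symm)
              (extChartAt (𝓡 2) p y)) (Q p) := by
            intro y hy
            have hy' := hc.2 hy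
            have h1 := (hsm p _ ((extChartAt (𝓡 2) p).map_source hy')).continuousAt_iteratedFDeriv
              (k := k) (mod_cast hk)
            exact (ContinuousAt.comp (f := extChartAt (𝓡 2) p) h1
              (continuousAt_extChartAt' hy')).continuousWithinAt
          obtain ⟨C, hC⟩ := hc.1.exists_bound_of_continuousOn hcont
          exact ⟨C, fun _ => hC⟩
        · exact ⟨0, fun h => absurd h hk⟩
      choose C hC using hk
      obtain ⟨M, hM⟩ := ((Finset.range 3).image C).exists_le
      refine ⟨M, fun _ _ y hy k hk => (hC k hk y hy).trans (hM _ ?_)⟩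
      exact Finset.mem_image_of_mem C (Finset.mem_range.2 (by omega))
    · exact ⟨0, fun h1 h2 => absurd ⟨h1, h2⟩ hc⟩
  choose C hC using hex
  obtain ⟨M, hM⟩ := (P.image C).exists_le
  have hK := h.one_le
  refine ⟨max K M, le_max_left _ _, fun x hx => ?_⟩
  have hp := h.control x hx
  have hr : (max K M)⁻¹ ≤ K⁻¹ := inv_anti₀ (by linarith) (le_max_left _ _)
  have e : (fun ζ => Φ (par (c x) x ζ) - Φ x) = fun ζ =>
      (Φ ∘ (extChartAt (𝓡 2) (c x)).symm) (extChartAt (𝓡 2) (c x) x + ζ) -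
        (Φ ∘ (extChartAt (𝓡 2) (c x)).symm) (extChartAt (𝓡 2) (c x) x) := by
    funext ζ
    simp only [par, Function.comp_apply,
      (extChartAt (𝓡 2) (c x)).left_inv (hp.subset_source hp.mem)]
  rw [e]
  refine hasLipDeriv_of_iteratedFDeriv_bound (C := M) (r := K⁻¹)
    (fun ζ hζ => hsm _ _ (hp.add_mem ζ hζ)) (fun ζ hζ k hk => ?_) (le_max_right _ _)
    (lt_max_of_lt_left (by linarith)) hr
  have := hC _ hp.isCompact hp.subset_source _ (hp.par_mem ζ hζ) k hk
  rw [par, (extChartAt (𝓡 2) (c x)).right_inv (hp.add_mem ζ hζ)] at this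
  exact this.trans (hM _ (Finset.mem_image_of_mem C (h.mem x hx)))

end Uniformity

end SurfaceStable

/-! ### Gram determinants and derivatives of iterates -/

namespace SurfaceStable

set_option linter.unusedSectionVars false

section Gram

variable {E F : Type*} [NormedAddCommGroup E] [InnerProductSpace ℝ E]
  [NormedAddCommGroup F] [InnerProductSpace ℝ F]

/-- The Gram determinant of two vectors. -/
def gramDet (u w : E) : ℝ := ‖u‖ ^ 2 * ‖w‖ ^ 2 - inner ℝ u w ^ 2

theorem gramDet_combination (p q : E) (a b c d : ℝ) :
    gramDet (a • p + b • q) (c • p + d • q) = (a * d - b * c) ^ 2 * gramDet p q := by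
  simp only [gramDet, ← real_inner_self_eq_norm_sq, inner_add_left, inner_add_right,
    real_inner_smul_left, real_inner_smul_right, real_inner_comm q p]
  ring

theorem gramDet_le (u w : E) : gramDet u w ≤ ‖u‖ ^ 2 * ‖w‖ ^ 2 := by
  unfold gramDet; nlinarith [sq_nonneg (inner ℝ u w)]

/-- A linear map expanding norms by at most K expands squared areas by at most K⁴. Subtracting from
w its component along u changes neither Gram determinant, and makes the one of (u, w) a product of
squared norms. -/
theorem gramDet_le_of_norm_le {u w : E} {u' w' : F} {K : ℝ}
    (h : ∀ a b : ℝ, ‖a • u' + b • w'‖ ≤ K * ‖a • u + b • w‖) :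
    gramDet u' w' ≤ K ^ 4 * gramDet u w := by
  have hu := h 1 0
  simp only [one_smul, zero_smul, add_zero] at hu
  rcases eq_or_ne u 0 with rfl | hu0
  · have : u' = 0 := by simpa using hu
    simp [gramDet, this]
  set t := inner ℝ u w / ‖u‖ ^ 2 with ht
  have hun : ‖u‖ ^ 2 ≠ 0 := by simpa using hu0
  have ho : inner ℝ u (-t • u + (1 : ℝ) • w) = 0 := by
    rw [inner_add_right, real_inner_smul_right, real_inner_smul_right, real_inner_self_eq_norm_sq,
      ht]
    field_simp
    ring
  have e1 := gramDet_combination u w 1 0 (-t) 1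
  have e2 := gramDet_combination u' w' 1 0 (-t) 1
  simp only [one_smul, zero_smul, add_zero, mul_one, zero_mul, sub_zero, one_pow, one_mul]
    at e1 e2 ho
  have e3 : gramDet u (-t • u + w) = ‖u‖ ^ 2 * ‖-t • u + w‖ ^ 2 := by simp only [gramDet, ho]; ring
  have hw := h (-t) 1
  simp only [one_smul] at hw
  rw [← e1, ← e2, e3]
  refine (gramDet_le _ _).trans ?_
  calc ‖u'‖ ^ 2 * ‖-t • u' + w'‖ ^ 2 ≤ (K * ‖u‖) ^ 2 * (K * ‖-t • u + w‖) ^ 2 := by gcongr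
    _ = _ := by ring

/-- By `gramDet_combination` both sides scale in the same way, so it suffices to compare them on an
orthonormal basis, where the Gram determinant of the images is the squared Jacobian. -/
theorem gramDet_map [FiniteDimensional ℝ E] (hE : Module.finrank ℝ E = 2) (L : E →ₗ[ℝ] F)
    (u w : E) : gramDet (L u) (L w) = L.normDet ^ 2 * gramDet u w := by
  let b : OrthonormalBasis (Fin 2) ℝ E := (stdOrthonormalBasis ℝ E).reindex (finCongr hE)
  have hd : L.normDet ^ 2 = gramDet (L (b 0)) (L (b 1)) := by
    have := L.normDet_sq_eq_det_gram b
    simp only [Matrix.det_fin_two, Matrix.gram_apply, real_inner_self_eq_norm_sq,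
      real_inner_comm (L (b 0)) (L (b 1))] at this
    rw [gramDet, pow_two (inner ℝ _ _)]
    exact_mod_cast this
  have h1 : gramDet (b 0) (b 1) = 1 := by
    simp [gramDet, b.orthonormal.norm_eq_one, b.orthonormal.inner_eq_zero zero_ne_one]
  have hu := b.sum_repr u
  have hw := b.sum_repr w
  rw [Fin.sum_univ_two] at hu hw
  rw [hd, ← hu, ← hw]
  simp only [map_add, map_smul, gramDet_combination, h1]
  ring

theorem gramDet_plane (u w : Plane) : gramDet u w = area u w ^ 2 := by
  have := inner_sq_add_area_sq u w
  rw [gramDet, ← this]; ring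

/-- In dimension two, every unit vector can be completed to an orthonormal basis. -/
theorem exists_norm_eq_one_gramDet_eq_one [FiniteDimensional ℝ E] (hE : Module.finrank ℝ E = 2)
    {u : E} (hu : ‖u‖ = 1) : ∃ w : E, ‖w‖ = 1 ∧ gramDet u w = 1 := by
  have h1 : Module.finrank ℝ (ℝ ∙ u)ᗮ = 1 := by
    have := Submodule.finrank_add_finrank_orthogonal (ℝ ∙ u)
    have hu0 : u ≠ 0 := by rintro rfl; simp at hu
    rw [finrank_span_singleton hu0, hE] at this
    omega
  have : Nontrivial (ℝ ∙ u)ᗮ := Module.nontrivial_of_finrank_pos (R := ℝ) (by omega)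
  obtain ⟨w, hw⟩ := exists_norm_eq (ℝ ∙ u)ᗮ zero_le_one
  have hw' : ‖(w : E)‖ = 1 := by simpa using hw
  refine ⟨w, hw', ?_⟩
  rw [gramDet, hu, hw', Submodule.mem_orthogonal_singleton_iff_inner_right.1 w.2]
  norm_num

/-- Two vectors with vanishing Gram determinant are proportional. -/
theorem eq_smul_of_gramDet_le_zero {u w : E} (hu : ‖u‖ = 1) (h : gramDet u w ≤ 0) :
    w = inner ℝ u w • u := by
  have : ‖w - inner ℝ u w • u‖ ^ 2 = gramDet u w := by
    rw [norm_sub_sq_real, norm_smul, real_inner_smul_right, gramDet, hu, mul_pow,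
      Real.norm_eq_abs, sq_abs, real_inner_comm]
    ring
  rw [← sub_eq_zero, ← norm_eq_zero]
  nlinarith [norm_nonneg (w - inner ℝ u w • u), this]

end Gram

section TangentDynamics

open scoped ENNReal NNReal

variable {S : Type*} [EMetricSpace S] [ChartedSpace (EuclideanSpace ℝ (Fin 2)) S]
  [IsManifold (𝓡 2) ∞ S]

variable {U V : Set S}

theorem DiffeoInto.mdifferentiableAt (f : DiffeoInto U V) {y : S} (hy : y ∈ U) :
    MDifferentiableAt (𝓡 2) (𝓡 2) f y :=
  (f.contMDiffAt hy).mdifferentiableAt two_ne_zero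

theorem DiffeoInto.isOpen_source (f : DiffeoInto U V) : IsOpen U := f.source_eq ▸ f.open_source

theorem DiffeoInto.mdifferentiableAt_iterate (f : DiffeoInto U V) {y : S} {n : ℕ}
    (hy : ∀ k < n, f^[k] y ∈ U) : MDifferentiableAt (𝓡 2) (𝓡 2) f^[n] y := by
  induction n with
  | zero => exact mdifferentiableAt_id
  | succ n ih =>
    rw [Function.iterate_succ']
    exact (f.mdifferentiableAt (hy n n.lt_succ_self)).comp y
      (ih fun k hk => hy k (hk.trans n.lt_succ_self))

theorem DiffeoInto.injective_mfderiv (f : DiffeoInto U V) {y : S} (hy : y ∈ U) :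
    Function.Injective (mfderiv (𝓡 2) (𝓡 2) f y) := by
  have hy' : y ∈ f.source := f.source_eq.symm ▸ hy
  have hg : MDifferentiableAt (𝓡 2) (𝓡 2) f.invFun (f y) :=
    (f.contMDiffOn_invFun.contMDiffAt (f.open_target.mem_nhds
      (f.map_source hy'))).mdifferentiableAt two_ne_zero
  have h1 := mfderiv_comp y hg (f.mdifferentiableAt hy)
  have h2 : f.invFun ∘ f =ᶠ[𝓝 y] id := by
    filter_upwards [f.open_source.mem_nhds hy'] with z hz
    exact f.left_inv hz
  rw [h2.mfderiv_eq, mfderiv_id] at h1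
  intro u w huw
  have h3 : ∀ u, mfderiv (𝓡 2) (𝓡 2) f.invFun (f y) (mfderiv (𝓡 2) (𝓡 2) f y u) = u := fun u =>
    (congrArg (fun L => L u) h1).symm
  rw [← h3 u, ← h3 w, huw]

theorem tangentMap_iterate_proj (f : S → S) (n : ℕ) (W : TangentBundle (𝓡 2) S) :
    ((tangentMap (𝓡 2) (𝓡 2) f)^[n] W).proj = f^[n] W.proj := by
  induction n with
  | zero => rfl
  | succ n ih => rw [Function.iterate_succ_apply', Function.iterate_succ_apply', ← ih]; rfl

/-- Chain rule. It lets Dfⁿ be handled as the n-th iterate of one bundle map, so that limits can be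
taken one step at a time. -/
theorem DiffeoInto.tangentMap_iterate (f : DiffeoInto U V) {W : TangentBundle (𝓡 2) S} {n : ℕ}
    (hW : ∀ k < n, f^[k] W.proj ∈ U) :
    (tangentMap (𝓡 2) (𝓡 2) f)^[n] W = tangentMap (𝓡 2) (𝓡 2) f^[n] W := by
  induction n with
  | zero => exact (congrFun (tangentMap_id (I := 𝓡 2) (M := S)) W).symm
  | succ n ih =>
    have hn : ∀ k < n, f^[k] W.proj ∈ U := fun k hk => hW k (hk.trans n.lt_succ_self)
    rw [Function.iterate_succ_apply', ih hn, Function.iterate_succ']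
    exact (tangentMap_comp_at W (f.mdifferentiableAt (hW n n.lt_succ_self))
      (f.mdifferentiableAt_iterate hn)).symm

/-- The coordinates of a tangent vector in the chart at `p`. -/
noncomputable def tcrd (p : S) (W : TangentBundle (𝓡 2) S) : Plane := chartDeriv p W.proj W.2

theorem hasFDerivAt_inCharts {G : Type*} [NormedAddCommGroup G] [NormedSpace ℝ G] {g : S → G}
    {p y : S} (hy : y ∈ (extChartAt (𝓡 2) p).source)
    (hg : MDifferentiableAt (𝓡 2) 𝓘(ℝ, G) g y) :
    ∃ A : Plane →L[ℝ] G, HasFDerivAt (g ∘ (extChartAt (𝓡 2) p).symm) A (extChartAt (𝓡 2) p y) ∧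
      ∀ w : TangentSpace (𝓡 2) y, A (chartDeriv p y w) = mfderiv (𝓡 2) 𝓘(ℝ, G) g y w := by
  have hinv := (extChartAt (𝓡 2) p).left_inv hy
  have h1 : MDifferentiableAt 𝓘(ℝ, Plane) (𝓡 2) (extChartAt (𝓡 2) p).symm
      (extChartAt (𝓡 2) p y) :=
    ((contMDiffOn_extChartAt_symm (n := 1) p).contMDiffAt ((isOpen_extChartAt_target p).mem_nhds
      ((extChartAt (𝓡 2) p).map_source hy))).mdifferentiableAt one_ne_zero
  have hg' : MDifferentiableAt (𝓡 2) 𝓘(ℝ, G) g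
      ((extChartAt (𝓡 2) p).symm (extChartAt (𝓡 2) p y)) := by rwa [hinv]
  have h2 : DifferentiableAt ℝ (g ∘ (extChartAt (𝓡 2) p).symm) (extChartAt (𝓡 2) p y) :=
    mdifferentiableAt_iff_differentiableAt.1 (hg'.comp _ h1)
  refine ⟨_, h2.hasFDerivAt, fun w => ?_⟩
  have h3 : MDifferentiableAt (𝓡 2) 𝓘(ℝ, Plane) (extChartAt (𝓡 2) p) y :=
    mdifferentiableAt_extChartAt (by simpa using hy)
  have h4 : HasMFDerivAt (𝓡 2) 𝓘(ℝ, G) ((g ∘ (extChartAt (𝓡 2) p).symm) ∘ extChartAt (𝓡 2) p) y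
      ((fderiv ℝ (g ∘ (extChartAt (𝓡 2) p).symm) (extChartAt (𝓡 2) p y)).comp
        (chartDeriv p y)) := h2.hasFDerivAt.hasMFDerivAt.comp y h3.hasMFDerivAt
  have h5 : g =ᶠ[𝓝 y] (g ∘ (extChartAt (𝓡 2) p).symm) ∘ extChartAt (𝓡 2) p := by
    filter_upwards [(isOpen_extChartAt_source (I := 𝓡 2) p).mem_nhds hy] with z hz
    simp only [Function.comp_apply, (extChartAt (𝓡 2) p).left_inv hz]
  rw [(h4.congr_of_eventuallyEq h5).mfderiv]
  rfl

theorem tcrd_tangentMap {f : S → S} {p q : S} {W : TangentBundle (𝓡 2) S}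
    (hp : W.proj ∈ (extChartAt (𝓡 2) p).source) (hf : MDifferentiableAt (𝓡 2) (𝓡 2) f W.proj)
    (hq : f W.proj ∈ (extChartAt (𝓡 2) q).source) :
    tcrd q (tangentMap (𝓡 2) (𝓡 2) f W) =
      fderiv ℝ (inCharts f p q) (extChartAt (𝓡 2) p W.proj) (tcrd p W) := by
  have hq' : MDifferentiableAt (𝓡 2) 𝓘(ℝ, Plane) (extChartAt (𝓡 2) q) (f W.proj) :=
    mdifferentiableAt_extChartAt (by simpa using hq)
  obtain ⟨A, hA, hA'⟩ := hasFDerivAt_inCharts hp (hq'.comp W.proj hf)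
  have h := hA.fderiv
  rw [Function.comp_assoc] at h
  rw [inCharts, h, tcrd, tcrd]
  refine Eq.trans ?_ (hA' W.2).symm
  rw [mfderiv_comp W.proj hq' hf]
  rfl

end TangentDynamics

end SurfaceStable

/-! ### Convergence and compactness in the tangent bundle -/

namespace SurfaceStable

set_option linter.unusedSectionVars false

section TangentTopology

open scoped ENNReal NNReal

variable {S : Type*} [EMetricSpace S] [ChartedSpace (EuclideanSpace ℝ (Fin 2)) S]
  [IsManifold (𝓡 2) ∞ S]

variable {U V : Set S}

theorem locallyCompactSpace_tangentBundle : LocallyCompactSpace (TangentBundle (𝓡 2) S) := by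
  have : LocallyCompactSpace (ModelProd (EuclideanSpace ℝ (Fin 2)) (EuclideanSpace ℝ (Fin 2))) :=
    inferInstanceAs (LocallyCompactSpace (Plane × Plane))
  exact ChartedSpace.locallyCompactSpace
    (ModelProd (EuclideanSpace ℝ (Fin 2)) (EuclideanSpace ℝ (Fin 2))) _

theorem DiffeoInto.continuousOn_tangentMap (f : DiffeoInto U V) :
    ContinuousOn (tangentMap (𝓡 2) (𝓡 2) f) {W : TangentBundle (𝓡 2) S | W.proj ∈ U} := by
  have ho := f.isOpen_source
  have h1 : ContMDiffOn (𝓡 2) (𝓡 2) 2 f U := fun y hy => (f.contMDiffAt hy).contMDiffWithinAt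
  refine (h1.continuousOn_tangentMapWithin (by norm_num) ho.uniqueMDiffOn).congr fun W hW => ?_
  exact (tangentMapWithin_eq_tangentMap (ho.uniqueMDiffOn _ hW) (f.mdifferentiableAt hW)).symm

/-- The tangent maps depend continuously on the map in the `C^1`-topology. -/
theorem tendsto_tangentMap {ι : Type*} {l : Filter ι} {f : ι → DiffeoInto U V}
    {f₀ : DiffeoInto U V} (hf : Tendsto f l (𝓝 f₀)) {W : ι → TangentBundle (𝓡 2) S}
    {W₀ : TangentBundle (𝓡 2) S} (hW : Tendsto W l (𝓝 W₀)) (hU : W₀.proj ∈ U) :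
    Tendsto (fun i => tangentMap (𝓡 2) (𝓡 2) (f i) (W i)) l
      (𝓝 (tangentMap (𝓡 2) (𝓡 2) f₀ W₀)) := by
  have := locallyCompactSpace_tangentBundle (S := S)
  rw [tendsto_nhds]
  intro O hO hmem
  have hπ : IsOpen {W : TangentBundle (𝓡 2) S | W.proj ∈ U} :=
    f₀.isOpen_source.preimage (FiberBundle.continuous_proj Plane (TangentSpace (𝓡 2)))
  have hN : {W : TangentBundle (𝓡 2) S | W.proj ∈ U} ∩ tangentMap (𝓡 2) (𝓡 2) f₀ ⁻¹' O ∈ 𝓝 W₀ :=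
    (f₀.continuousOn_tangentMap.isOpen_inter_preimage hπ hO).mem_nhds ⟨hU, hmem⟩
  -- The topology only tests maps on compact sets, so local compactness of TS is used to trap the
  -- moving vectors in one compact neighborhood of the limit.
  obtain ⟨K, hK, hKs, hKc⟩ := local_compact_nhds hN
  have hA : ∀ᶠ g in 𝓝 f₀, MapsTo (tangentMap (𝓡 2) (𝓡 2) (g : DiffeoInto U V)) K O := by
    refine IsOpen.mem_nhds (TopologicalSpace.isOpen_generateFrom_of_mem
      ⟨K, O, hKc, fun v hv => (hKs hv).1, hO, rfl⟩) ?_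
    exact fun v hv => (hKs hv).2
  filter_upwards [hf.eventually hA, hW.eventually hK] with i hi hi'
  exact hi hi'

theorem tendsto_tangentMap_iterate {ι : Type*} {l : Filter ι} {f : ι → DiffeoInto U V}
    {f₀ : DiffeoInto U V} (hf : Tendsto f l (𝓝 f₀)) {W : ι → TangentBundle (𝓡 2) S}
    {W₀ : TangentBundle (𝓡 2) S} (hW : Tendsto W l (𝓝 W₀)) {n : ℕ}
    (hU : ∀ k < n, f₀^[k] W₀.proj ∈ U) :
    Tendsto (fun i => (tangentMap (𝓡 2) (𝓡 2) (f i))^[n] (W i)) l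
      (𝓝 ((tangentMap (𝓡 2) (𝓡 2) f₀)^[n] W₀)) := by
  induction n with
  | zero => exact hW
  | succ n ih =>
    simp only [Function.iterate_succ_apply']
    refine tendsto_tangentMap hf (ih fun k hk => hU k (hk.trans n.lt_succ_self)) ?_
    rw [tangentMap_iterate_proj]
    exact hU n n.lt_succ_self

theorem tendsto_proj {ι : Type*} {l : Filter ι} {W : ι → TangentBundle (𝓡 2) S}
    {W₀ : TangentBundle (𝓡 2) S} (hW : Tendsto W l (𝓝 W₀)) :
    Tendsto (fun i => (W i).proj) l (𝓝 W₀.proj) :=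
  ((FiberBundle.continuous_proj Plane (TangentSpace (𝓡 2))).tendsto W₀).comp hW

theorem tendsto_tcrd {ι : Type*} {l : Filter ι} {W : ι → TangentBundle (𝓡 2) S}
    {W₀ : TangentBundle (𝓡 2) S} {p : S} (hp : W₀.proj ∈ (extChartAt (𝓡 2) p).source)
    (hW : Tendsto W l (𝓝 W₀)) : Tendsto (fun i => tcrd p (W i)) l (𝓝 (tcrd p W₀)) := by
  have hp' : W₀.proj ∈ (chartAt Plane p).source := by simpa using hp
  set e := trivializationAt Plane (TangentSpace (𝓡 2) : S → Type) p with he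
  have key : ∀ X : TangentBundle (𝓡 2) S, X.proj ∈ (chartAt Plane p).source →
      tcrd p X = (e X).2 := by
    intro X hX
    rw [tcrd, chartDeriv_eq_trivialization hX, Trivialization.continuousLinearMapAt_apply,
      Trivialization.linearMapAt_apply, if_pos (by simpa [he] using hX)]
  have hcont : ContinuousAt (fun X => (e X).2) W₀ :=
    (e.continuousAt (by rw [e.mem_source]; simpa [he] using hp')).snd
  rw [key W₀ hp']
  refine (hcont.tendsto.comp hW).congr' ?_
  filter_upwards [(tendsto_proj hW).eventually
    ((chartAt Plane p).open_source.mem_nhds hp')] with i hi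
  exact (key _ hi).symm

/-- A trivialization is a homeomorphism onto a product, so convergence of base points and of
coordinates in one chart is convergence in TS. -/
theorem tendsto_of_tendsto_tcrd {ι : Type*} {l : Filter ι} {W : ι → TangentBundle (𝓡 2) S}
    {x : S} {p : S} (hp : x ∈ (extChartAt (𝓡 2) p).source)
    (hx : Tendsto (fun i => (W i).proj) l (𝓝 x)) {u : Plane}
    (hu : Tendsto (fun i => tcrd p (W i)) l (𝓝 u)) :
    ∃ w : TangentSpace (𝓡 2) x, chartDeriv p x w = u ∧ Tendsto W l (𝓝 ⟨x, w⟩) := by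
  have hp' : x ∈ (chartAt Plane p).source := by simpa using hp
  set e := trivializationAt Plane (TangentSpace (𝓡 2) : S → Type) p with he
  obtain ⟨w, hw⟩ := (chartDeriv_bijective hp).2 u
  refine ⟨w, hw, ?_⟩
  have hs : (⟨x, w⟩ : TangentBundle (𝓡 2) S) ∈ e.source := by
    rw [e.mem_source]; simpa [he] using hp'
  have key : ∀ X : TangentBundle (𝓡 2) S, X.proj ∈ (chartAt Plane p).source →
      e X = (X.proj, tcrd p X) := by
    intro X hX
    refine Prod.ext (e.coe_fst (by rw [e.mem_source]; simpa [he] using hX)) ?_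
    rw [tcrd, chartDeriv_eq_trivialization hX, Trivialization.continuousLinearMapAt_apply,
      Trivialization.linearMapAt_apply, if_pos (by simpa [he] using hX)]
  have hev : ∀ᶠ i in l, (W i).proj ∈ (chartAt Plane p).source :=
    hx.eventually ((chartAt Plane p).open_source.mem_nhds hp')
  have h1 : Tendsto (fun i => e (W i)) l (𝓝 (e ⟨x, w⟩)) := by
    rw [key ⟨x, w⟩ hp']
    have h2 : tcrd p ⟨x, w⟩ = u := hw
    rw [h2]
    refine (hx.prodMk_nhds hu).congr' ?_
    filter_upwards [hev] with i hi
    exact (key _ hi).symm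
  have h3 := ((e.toOpenPartialHomeomorph.continuousAt_symm (e.map_source hs)).tendsto.comp h1)
  have h4 : e.toOpenPartialHomeomorph.symm (e ⟨x, w⟩) = ⟨x, w⟩ := e.left_inv hs
  replace h3 : Tendsto _ _ (𝓝 (e.toOpenPartialHomeomorph.symm (e ⟨x, w⟩))) := h3
  rw [h4] at h3
  refine h3.congr' ?_
  filter_upwards [hev] with i hi
  exact e.left_inv (by rw [e.mem_source]; simpa [he] using hi)

variable [RiemannianBundle (fun x : S => TangentSpace (𝓡 2) x)]
  [IsContinuousRiemannianBundle (EuclideanSpace ℝ (Fin 2)) (fun x : S => TangentSpace (𝓡 2) x)]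

theorem continuous_norm_snd : Continuous fun W : TangentBundle (𝓡 2) S => ‖W.2‖ := by
  have h : Continuous fun W : TangentBundle (𝓡 2) S => inner ℝ W.2 W.2 :=
    Continuous.inner_bundle (F := Plane) (E := fun x : S => TangentSpace (𝓡 2) x)
      (b := fun W : TangentBundle (𝓡 2) S => W.proj) (v := fun W => W.2) (w := fun W => W.2)
      continuous_id continuous_id
  simp only [real_inner_self_eq_norm_sq] at h
  simpa [Real.sqrt_sq] using h.sqrt

theorem tendsto_inner {ι : Type*} {l : Filter ι} {x : ι → S} {x₀ : S}
    {v w : ∀ i, TangentSpace (𝓡 2) (x i)} {v₀ w₀ : TangentSpace (𝓡 2) x₀}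
    (hv : Tendsto (fun i => (⟨x i, v i⟩ : TangentBundle (𝓡 2) S)) l (𝓝 ⟨x₀, v₀⟩))
    (hw : Tendsto (fun i => (⟨x i, w i⟩ : TangentBundle (𝓡 2) S)) l (𝓝 ⟨x₀, w₀⟩)) :
    Tendsto (fun i => inner ℝ (v i) (w i)) l (𝓝 (inner ℝ v₀ w₀)) := by
  -- M is the fibre product TS ×_S TS, on which the inner product is a continuous function; `w'`
  -- moves the second vector to the fibre of the first along the equality of base points.
  let M := {P : TangentBundle (𝓡 2) S × TangentBundle (𝓡 2) S // P.2.proj = P.1.proj}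
  let w' : ∀ m : M, TangentSpace (𝓡 2) m.1.1.proj := fun m => m.2 ▸ m.1.2.2
  have hw' : ∀ m : M, (⟨m.1.1.proj, w' m⟩ : TangentBundle (𝓡 2) S) = m.1.2 := by
    rintro ⟨⟨⟨y, a⟩, ⟨z, b⟩⟩, h⟩
    obtain rfl : z = y := h
    rfl
  have hc : Continuous fun m : M => inner ℝ m.1.1.2 (w' m) := by
    refine Continuous.inner_bundle (F := Plane) (E := fun x : S => TangentSpace (𝓡 2) x)
      (b := fun m : M => m.1.1.proj) (v := fun m => m.1.1.2) (w := w') ?_ ?_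
    · exact continuous_fst.comp continuous_subtype_val
    · simp only [hw']
      exact continuous_snd.comp continuous_subtype_val
  let m : ι → M := fun i => ⟨(⟨x i, v i⟩, ⟨x i, w i⟩), rfl⟩
  have hm : Tendsto m l (𝓝 (⟨(⟨x₀, v₀⟩, ⟨x₀, w₀⟩), rfl⟩ : M)) :=
    tendsto_subtype_rng.2 (hv.prodMk_nhds hw)
  exact (hc.tendsto _).comp hm

/-- Bounded tangent vectors at converging points accumulate. -/
theorem exists_tendsto_of_norm_le {ι : Type*} {l : Ultrafilter ι} {W : ι → TangentBundle (𝓡 2) S}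
    {x : S} (hx : Tendsto (fun i => (W i).proj) l (𝓝 x)) {C : ℝ}
    (hC : ∀ᶠ i in (l : Filter ι), ‖(W i).2‖ ≤ C) :
    ∃ w : TangentSpace (𝓡 2) x, Tendsto W l (𝓝 ⟨x, w⟩) := by
  obtain ⟨B, hB, hev⟩ := eventually_norm_chartDeriv_le x
  have hb : ∀ᶠ i in (l : Filter ι), tcrd x (W i) ∈ Metric.closedBall (0 : Plane) (B * C) := by
    filter_upwards [hx.eventually hev, hC] with i hi hCi
    rw [mem_closedBall_zero_iff]
    exact (hi _).trans (by gcongr)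
  obtain ⟨u, -, hu⟩ := (isCompact_closedBall (0 : Plane) (B * C)).ultrafilter_le_nhds
    (l.map fun i => tcrd x (W i)) (le_principal_iff.2 hb)
  obtain ⟨w, -, hw⟩ := tendsto_of_tendsto_tcrd (mem_extChartAt_source (I := 𝓡 2) x) hx hu
  exact ⟨w, hw⟩

/-- The unit tangent vectors over a set. -/
def unitTangent (Λ : Set S) : Set (TangentBundle (𝓡 2) S) := {W | W.proj ∈ Λ ∧ ‖W.2‖ = 1}

theorem isCompact_unitTangent {Λ : Set S} (hΛ : IsCompact Λ) : IsCompact (unitTangent Λ) := by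
  rw [isCompact_iff_ultrafilter_le_nhds]
  intro l hl
  rw [le_principal_iff] at hl
  have hl' : ∀ᶠ W : TangentBundle (𝓡 2) S in (l : Filter _), W.proj ∈ Λ := by
    filter_upwards [hl] with W hW using hW.1
  obtain ⟨x, hx, hlx⟩ := hΛ.ultrafilter_le_nhds 
    (l.map fun W : TangentBundle (𝓡 2) S => W.proj) (le_principal_iff.2 hl')
  have h1 : Tendsto (fun W : TangentBundle (𝓡 2) S => W.proj) l (𝓝 x) := hlx
  obtain ⟨w, hw⟩ := exists_tendsto_of_norm_le (W := fun W => W) (C := 1) h1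
    (by filter_upwards [hl] with W hW using hW.2.le)
  refine ⟨⟨x, w⟩, ⟨hx, ?_⟩, hw⟩
  refine tendsto_nhds_unique ((continuous_norm_snd.tendsto _).comp hw)
    (tendsto_const_nhds.congr' ?_)
  filter_upwards [hl] with W hW using hW.2.symm

/-- The smallest expansion of `Df` over `Λ`. -/
noncomputable def minNorm (f : S → S) (Λ : Set S) : ℝ :=
  sInf ((fun W : unitTangent Λ => ‖(tangentMap (𝓡 2) (𝓡 2) f W.1).2‖) '' univ)

/-- C²-boundedness gives no uniform lower bound on Df, so the constants of the construction must
depend on f. This makes the dependence continuous. -/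
theorem continuous_minNorm {Λ : Set S} (hΛ : IsCompact Λ) (hΛU : Λ ⊆ U) :
    Continuous fun f : DiffeoInto U V => minNorm f Λ := by
  have := isCompact_iff_compactSpace.1 (isCompact_unitTangent hΛ)
  refine isCompact_univ.continuous_sInf (f := fun (f : DiffeoInto U V) (W : unitTangent Λ) =>
    ‖(tangentMap (𝓡 2) (𝓡 2) f W.1).2‖) (continuous_iff_continuousAt.2 fun q => ?_)
  refine (continuous_norm_snd.tendsto _).comp (tendsto_tangentMap (continuousAt_fst (p := q)) (W := fun q : DiffeoInto U V × unitTangent Λ => q.2.1) ?_ (hΛU q.2.2.1))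
  exact (continuous_subtype_val.comp continuous_snd).continuousAt

theorem DiffeoInto.minNorm_pos (f : DiffeoInto U V) {Λ : Set S} (hΛ : IsCompact Λ) (hΛU : Λ ⊆ U)
    (hne : (unitTangent Λ).Nonempty) : 0 < minNorm f Λ := by
  have := isCompact_iff_compactSpace.1 (isCompact_unitTangent hΛ)
  have : Nonempty (unitTangent Λ) := hne.to_subtype
  obtain ⟨W, -, hW⟩ := isCompact_univ.exists_sInf_image_eq (univ_nonempty (α := unitTangent Λ))
    (f := fun W : unitTangent Λ => ‖(tangentMap (𝓡 2) (𝓡 2) f W.1).2‖)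
    (continuous_norm_snd.comp_continuousOn (f.continuousOn_tangentMap.comp
      continuous_subtype_val.continuousOn fun W _ => hΛU W.2.1))
  rw [minNorm, hW, norm_pos_iff]
  intro h0
  have h1 : mfderiv (𝓡 2) (𝓡 2) f W.1.proj W.1.2 = 0 := h0
  have h2 := f.injective_mfderiv (hΛU W.2.1) (h1.trans (map_zero _).symm)
  have h3 := W.2.2
  rw [h2, norm_zero] at h3
  exact zero_ne_one h3

theorem DiffeoInto.minNorm_mul_le (f : DiffeoInto U V) {Λ : Set S}
    {W : TangentBundle (𝓡 2) S} (hW : W.proj ∈ Λ) :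
    minNorm f Λ * ‖W.2‖ ≤ ‖(tangentMap (𝓡 2) (𝓡 2) f W).2‖ := by
  rcases eq_or_ne ‖W.2‖ 0 with h0 | h0
  · rw [h0, mul_zero]; exact norm_nonneg _
  set W' : TangentBundle (𝓡 2) S := ⟨W.proj, ‖W.2‖⁻¹ • W.2⟩ with hW'
  have hu : W' ∈ unitTangent Λ := by
    refine ⟨hW, ?_⟩
    change ‖‖W.2‖⁻¹ • W.2‖ = 1
    rw [norm_smul, norm_inv, norm_norm, inv_mul_cancel₀ h0]
  have h1 : minNorm f Λ ≤ ‖(tangentMap (𝓡 2) (𝓡 2) f W').2‖ := by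
    refine csInf_le ⟨0, ?_⟩ ⟨⟨W', hu⟩, mem_univ _, rfl⟩
    rintro _ ⟨X, -, rfl⟩
    exact norm_nonneg _
  have h2 : ‖(tangentMap (𝓡 2) (𝓡 2) f W').2‖ = ‖W.2‖⁻¹ * ‖(tangentMap (𝓡 2) (𝓡 2) f W).2‖ := by
    change ‖mfderiv (𝓡 2) (𝓡 2) f W.proj (‖W.2‖⁻¹ • W.2)‖ = _
    rw [map_smul, norm_smul, norm_inv, norm_norm]
    rfl
  have hpos : 0 < ‖W.2‖ := lt_of_le_of_ne (norm_nonneg _) h0.symm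
  rw [h2, inv_mul_eq_div, le_div_iff₀ hpos] at h1
  exact h1

end TangentTopology

end SurfaceStable

/-! ### Uniqueness and continuity of pinched directions -/

namespace SurfaceStable

set_option linter.unusedSectionVars false

section PinchedVectors

open scoped ENNReal NNReal

variable {S : Type*} [EMetricSpace S] [ChartedSpace (EuclideanSpace ℝ (Fin 2)) S]
  [IsManifold (𝓡 2) ∞ S]

variable {U V : Set S}

variable [RiemannianBundle (fun x : S => TangentSpace (𝓡 2) x)]

/-- The norm of the image of a tangent vector by the `n`-th iterate. -/
noncomputable def speed (f : S → S) (n : ℕ) (W : TangentBundle (𝓡 2) S) : ℝ :=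
  ‖((tangentMap (𝓡 2) (𝓡 2) f)^[n] W).2‖

theorem speed_nonneg (f : S → S) (n : ℕ) (W : TangentBundle (𝓡 2) S) : 0 ≤ speed f n W :=
  norm_nonneg _

theorem DiffeoInto.speed_eq (f : DiffeoInto U V) {n : ℕ} {x : S} (hx : ∀ k, f^[k] x ∈ U)
    (w : TangentSpace (𝓡 2) x) : speed f n ⟨x, w⟩ = ‖mfderiv (𝓡 2) (𝓡 2) f^[n] x w‖ := by
  rw [speed, f.tangentMap_iterate (W := ⟨x, w⟩) fun k _ => hx k]
  rfl

theorem finrank_tangentSpace (x : S) : Module.finrank ℝ (TangentSpace (𝓡 2) x) = 2 :=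
  finrank_euclideanSpace_fin (𝕜 := ℝ) (n := 2)

theorem DiffeoInto.gramDet_iterate (f : DiffeoInto U V) (n : ℕ) {x : S}
    (v w : TangentSpace (𝓡 2) x) :
    gramDet (mfderiv (𝓡 2) (𝓡 2) f^[n] x v) (mfderiv (𝓡 2) (𝓡 2) f^[n] x w) =
      absDet f n x ^ 2 * gramDet v w :=
  gramDet_map (finrank_tangentSpace x) (mfderiv (𝓡 2) (𝓡 2) f^[n] x).toLinearMap v w

/-- A unit vector spanning a pinched direction. -/
structure IsPinchedVector (f : S → S) (σ σ' ρ ρ' : ℝ) (W : TangentBundle (𝓡 2) S) : Prop where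
  norm_eq : ‖W.2‖ = 1
  le_speed : ∀ n : ℕ, σ' ^ n ≤ speed f n W
  speed_le : ∀ n : ℕ, speed f n W ≤ σ ^ n
  absDet_pos : ∀ n : ℕ, 0 < absDet f n W.proj
  le_sq : ∀ n : ℕ, ρ' ^ n * absDet f n W.proj ≤ speed f n W ^ 2
  sq_le : ∀ n : ℕ, speed f n W ^ 2 ≤ ρ ^ n * absDet f n W.proj

variable {σ σ' ρ ρ' : ℝ}

theorem normAlong_eq {f : S → S} {n : ℕ} {x : S} {E : Submodule ℝ (TangentSpace (𝓡 2) x)}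
    (hE : Module.finrank ℝ E = 1) {e : TangentSpace (𝓡 2) x} (he : e ∈ E) (he1 : ‖e‖ = 1) :
    normAlong f n x E = ‖mfderiv (𝓡 2) (𝓡 2) f^[n] x e‖ := by
  refine le_antisymm (ContinuousLinearMap.opNorm_le_bound _ (norm_nonneg _) fun z => ?_) ?_
  · have h0 : (⟨e, he⟩ : E) ≠ 0 := fun h => by
      rw [show e = 0 from congrArg Subtype.val h, norm_zero] at he1
      exact zero_ne_one he1
    obtain ⟨c, hc⟩ := exists_smul_eq_of_finrank_eq_one hE h0 z
    have hz : (z : TangentSpace (𝓡 2) x) = c • e := (congrArg Subtype.val hc).symm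
    change ‖mfderiv (𝓡 2) (𝓡 2) f^[n] x z‖ ≤ _ * ‖(z : TangentSpace (𝓡 2) x)‖
    rw [hz, map_smul, norm_smul, norm_smul, he1, mul_one, mul_comm]
  · have := ((mfderiv (𝓡 2) (𝓡 2) f^[n] x).comp E.subtypeL).le_opNorm ⟨e, he⟩
    have h1 : ‖(⟨e, he⟩ : E)‖ = 1 := he1
    rw [h1, mul_one] at this
    exact this

theorem IsPinchedDirection.exists_vector {f : DiffeoInto U V} {x : S} (hx : ∀ k, f^[k] x ∈ U)
    (hρ' : 0 < ρ') {E : Submodule ℝ (TangentSpace (𝓡 2) x)}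
    (h : IsPinchedDirection f σ σ' ρ ρ' x E) :
    ∃ e ∈ E, IsPinchedVector f σ σ' ρ ρ' ⟨x, e⟩ ∧ ∀ n, normAlong f n x E = speed f n ⟨x, e⟩ := by
  have : Nontrivial E := Module.nontrivial_of_finrank_pos (R := ℝ) (by rw [h.finrank_eq]; simp)
  obtain ⟨e, he⟩ := exists_norm_eq E zero_le_one
  have he1 : ‖(e : TangentSpace (𝓡 2) x)‖ = 1 := he
  have hn : ∀ n, normAlong f n x E = speed f n ⟨x, e⟩ := fun n => by
    rw [f.speed_eq hx, normAlong_eq h.finrank_eq e.2 he1]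
  -- Division by zero being zero, a vanishing Jacobian would contradict the positive lower pinching
  -- bound.
  have hpos : ∀ n, 0 < absDet f n x := fun n => by
    refine lt_of_le_of_ne (LinearMap.normDet_nonneg _) fun h0 => ?_
    have := (h.pinching n).1
    rw [← h0, div_zero] at this
    exact absurd (pow_pos hρ' n) this.not_gt
  refine ⟨e, e.2, ⟨he1, fun n => ?_, fun n => ?_, hpos, fun n => ?_, fun n => ?_⟩, hn⟩
  · rw [← hn]; exact (h.contraction n).1
  · rw [← hn]; exact (h.contraction n).2
  · rw [← hn, ← le_div_iff₀ (hpos n)]; exact (h.pinching n).1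
  · rw [← hn, ← div_le_iff₀ (hpos n)]; exact (h.pinching n).2

/-- A vector which is pinched from above spans the same line as any pinched vector. -/
theorem IsPinchedVector.eq_inner_smul {f : DiffeoInto U V} {x : S} (hx : ∀ k, f^[k] x ∈ U)
    (hρ : 0 ≤ ρ) (hρ1 : ρ < 1) {e w : TangentSpace (𝓡 2) x}
    (he : IsPinchedVector f σ σ' ρ ρ' ⟨x, e⟩)
    (hw : ∀ n, speed f n ⟨x, w⟩ ^ 2 ≤ ρ ^ n * absDet f n x) : w = inner ℝ e w • e := by
  -- Dfⁿ multiplies the Gram determinant by the squared Jacobian, while the images of both vectors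
  -- have squared norm at most ρⁿ times the Jacobian. Hence the original Gram determinant is at most
  -- ρ²ⁿ for every n, and thus nonpositive.
  have key : ∀ n : ℕ, gramDet e w ≤ (ρ ^ 2) ^ n := by
    intro n
    have h1 := gramDet_le (mfderiv (𝓡 2) (𝓡 2) f^[n] x e) (mfderiv (𝓡 2) (𝓡 2) f^[n] x w)
    rw [f.gramDet_iterate, ← f.speed_eq hx, ← f.speed_eq hx] at h1
    have h2 := he.sq_le n
    have h3 := hw n
    have hp : 0 < absDet f n x := he.absDet_pos n
    have h4 : absDet f n x ^ 2 * gramDet e w ≤ absDet f n x ^ 2 * (ρ ^ 2) ^ n := by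
      calc _ ≤ _ := h1
        _ ≤ (ρ ^ n * absDet f n x) * (ρ ^ n * absDet f n x) := by
          gcongr
        _ = _ := by rw [← pow_mul, mul_comm 2 n, pow_mul]; ring
    exact le_of_mul_le_mul_left h4 (by positivity)
  refine eq_smul_of_gramDet_le_zero he.norm_eq (ge_of_tendsto' (tendsto_pow_atTop_nhds_zero_of_lt_one
    (by positivity) ?_) key)
  exact pow_lt_one₀ hρ hρ1 two_ne_zero

variable [IsContinuousRiemannianBundle (EuclideanSpace ℝ (Fin 2))
  (fun x : S => TangentSpace (𝓡 2) x)]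

theorem tendsto_norm_snd {ι : Type*} {l : Filter ι} {W : ι → TangentBundle (𝓡 2) S}
    {W₀ : TangentBundle (𝓡 2) S} (hW : Tendsto W l (𝓝 W₀)) :
    Tendsto (fun i => ‖(W i).2‖) l (𝓝 ‖W₀.2‖) :=
  (continuous_norm_snd.tendsto W₀).comp hW

theorem tendsto_speed {ι : Type*} {l : Filter ι} {f : ι → DiffeoInto U V}
    {f₀ : DiffeoInto U V} (hf : Tendsto f l (𝓝 f₀)) {W : ι → TangentBundle (𝓡 2) S}
    {W₀ : TangentBundle (𝓡 2) S} (hW : Tendsto W l (𝓝 W₀)) {n : ℕ}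
    (hU : ∀ k < n, f₀^[k] W₀.proj ∈ U) :
    Tendsto (fun i => speed (f i) n (W i)) l (𝓝 (speed f₀ n W₀)) :=
  tendsto_norm_snd (tendsto_tangentMap_iterate hf hW hU)

theorem tendsto_gramDet {ι : Type*} {l : Filter ι} {x : ι → S} {x₀ : S}
    {v w : ∀ i, TangentSpace (𝓡 2) (x i)} {v₀ w₀ : TangentSpace (𝓡 2) x₀}
    (hv : Tendsto (fun i => (⟨x i, v i⟩ : TangentBundle (𝓡 2) S)) l (𝓝 ⟨x₀, v₀⟩))
    (hw : Tendsto (fun i => (⟨x i, w i⟩ : TangentBundle (𝓡 2) S)) l (𝓝 ⟨x₀, w₀⟩)) :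
    Tendsto (fun i => gramDet (v i) (w i)) l (𝓝 (gramDet v₀ w₀)) :=
  (((tendsto_norm_snd hv).pow 2).mul ((tendsto_norm_snd hw).pow 2)).sub
    ((tendsto_inner hv hw).pow 2)

/-- Limits of pinched vectors are proportional to the pinched vectors. -/
theorem IsPinchedVector.limit_eq_inner_smul {ι : Type*} {l : Ultrafilter ι}
    {f : ι → DiffeoInto U V} {f₀ : DiffeoInto U V} (hf : Tendsto f l (𝓝 f₀)) {x : ι → S} {x₀ : S}
    {v : ∀ i, TangentSpace (𝓡 2) (x i)} {v₀ e : TangentSpace (𝓡 2) x₀}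
    (hv : Tendsto (fun i => (⟨x i, v i⟩ : TangentBundle (𝓡 2) S)) l (𝓝 ⟨x₀, v₀⟩))
    (hx : ∀ᶠ i in (l : Filter ι), ∀ k, (f i)^[k] (x i) ∈ U) (hx₀ : ∀ k, f₀^[k] x₀ ∈ U)
    (hρ : 0 ≤ ρ) (hρ1 : ρ < 1)
    (hp : ∀ᶠ i in (l : Filter ι), IsPinchedVector (f i) σ σ' ρ ρ' ⟨x i, v i⟩)
    (he : IsPinchedVector f₀ σ σ' ρ ρ' ⟨x₀, e⟩) :
    ‖v₀‖ = 1 ∧ v₀ = inner ℝ e v₀ • e := by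
  -- Completing v i by b i to an orthonormal pair expresses the squared Jacobian as the Gram
  -- determinant of the images, and this expression passes to the limit. The limit v₀ therefore
  -- inherits the upper pinching bound.
  have hex : ∀ i, ∃ b : TangentSpace (𝓡 2) (x i), ‖v i‖ = 1 → ‖b‖ = 1 ∧ gramDet (v i) b = 1 := by
    intro i
    by_cases h : ‖v i‖ = 1
    · obtain ⟨b, hb, hb'⟩ := exists_norm_eq_one_gramDet_eq_one
        (finrank_tangentSpace (x i)) h
      exact ⟨b, fun _ => ⟨hb, hb'⟩⟩
    · exact ⟨0, fun h' => absurd h' h⟩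
  choose b hb using hex
  have hb1 : ∀ᶠ i in (l : Filter ι), ‖(⟨x i, b i⟩ : TangentBundle (𝓡 2) S).2‖ ≤ 1 := by
    filter_upwards [hp] with i hi using (hb i hi.norm_eq).1.le
  obtain ⟨b₀, hb₀⟩ := exists_tendsto_of_norm_le (x := x₀) (W := fun i => ⟨x i, b i⟩)
    (show Tendsto x l (𝓝 x₀) from tendsto_proj hv) hb1
  have hg₀ : gramDet v₀ b₀ = 1 := by
    refine tendsto_nhds_unique (tendsto_gramDet hv hb₀) (tendsto_const_nhds.congr' ?_)
    filter_upwards [hp] with i hi using (hb i hi.norm_eq).2.symm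
  refine ⟨?_, he.eq_inner_smul hx₀ hρ hρ1 fun n => ?_⟩
  · refine tendsto_nhds_unique (tendsto_norm_snd hv) (tendsto_const_nhds.congr' ?_)
    filter_upwards [hp] with i hi using hi.norm_eq.symm
  have hT : ∀ {w : ∀ i, TangentSpace (𝓡 2) (x i)} {w₀ : TangentSpace (𝓡 2) x₀},
      Tendsto (fun i => (⟨x i, w i⟩ : TangentBundle (𝓡 2) S)) l (𝓝 ⟨x₀, w₀⟩) →
      Tendsto (fun i => (⟨(f i)^[n] (x i), mfderiv (𝓡 2) (𝓡 2) (f i)^[n] (x i) (w i)⟩ :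
        TangentBundle (𝓡 2) S)) l (𝓝 ⟨f₀^[n] x₀, mfderiv (𝓡 2) (𝓡 2) f₀^[n] x₀ w₀⟩) := by
    intro w w₀ hw
    have h1 := tendsto_tangentMap_iterate hf hw (n := n) fun k _ => hx₀ k
    rw [f₀.tangentMap_iterate (W := ⟨x₀, w₀⟩) fun k _ => hx₀ k] at h1
    refine h1.congr' ?_
    filter_upwards [hx] with i hi
    exact (f i).tangentMap_iterate (W := ⟨x i, w i⟩) fun k _ => hi k
  have h1 := tendsto_gramDet (hT hv) (hT hb₀)
  have h2 : (speed f₀ n ⟨x₀, v₀⟩ ^ 2) ^ 2 ≤ (ρ ^ n) ^ 2 * (absDet f₀ n x₀ ^ 2 * gramDet v₀ b₀) := by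
    rw [← f₀.gramDet_iterate]
    refine le_of_tendsto_of_tendsto (((tendsto_speed hf hv fun k _ => hx₀ k).pow 2).pow 2)
      (h1.const_mul _) ?_
    filter_upwards [hp] with i hi
    rw [(f i).gramDet_iterate, (hb i hi.norm_eq).2, mul_one, ← mul_pow]
    have := hi.sq_le n
    gcongr
  rw [hg₀, mul_one, ← mul_pow] at h2
  have h0 : 0 < absDet f₀ n x₀ := he.absDet_pos n
  exact (pow_le_pow_iff_left₀ (by positivity) (by positivity) two_ne_zero).1 h2

end PinchedVectors

end SurfaceStable

/-! ### Uniform systems and dynamics in charts -/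

namespace SurfaceStable

set_option linter.unusedSectionVars false

theorem HasLipDeriv.mono {E G : Type*} [NormedAddCommGroup E] [NormedSpace ℝ E]
    [NormedAddCommGroup G] [NormedSpace ℝ G] {K K' : ℝ} {F : E → G} {F' : E → E →L[ℝ] G}
    (h : HasLipDeriv K F F') (hK : 0 < K) (hKK' : K ≤ K') : HasLipDeriv K' F F' := by
  have hi : K'⁻¹ ≤ K⁻¹ := inv_anti₀ hK hKK'
  exact ⟨h.map_zero, fun ζ hζ => h.hasFDerivAt ζ (hζ.trans hi), h.norm_le.trans hKK',
    fun ζ ζ' hζ hζ' => (h.lip ζ ζ' (hζ.trans hi) (hζ'.trans hi)).trans (by gcongr)⟩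

theorem HasLipDeriv.clm_comp {E G H : Type*} [NormedAddCommGroup E] [NormedSpace ℝ E]
    [NormedAddCommGroup G] [NormedSpace ℝ G] [NormedAddCommGroup H] [NormedSpace ℝ H] {K B : ℝ}
    {F : E → G} {F' : E → E →L[ℝ] G} (h : HasLipDeriv K F F') (hK : 0 < K) (hB : 1 ≤ B)
    (L : G →L[ℝ] H) (hL : ‖L‖ ≤ B) :
    HasLipDeriv (B * K) (fun ζ => L (F ζ)) (fun ζ => L.comp (F' ζ)) := by
  have hKB : K ≤ B * K := le_mul_of_one_le_left hK.le hB
  have hi : (B * K)⁻¹ ≤ K⁻¹ := inv_anti₀ hK hKB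
  refine ⟨by simp [h.map_zero],
    fun ζ hζ => L.hasFDerivAt.comp ζ (h.hasFDerivAt ζ (hζ.trans hi)), ?_, fun ζ ζ' hζ hζ' => ?_⟩
  · refine (L.opNorm_comp_le _).trans ?_
    have := h.norm_le
    gcongr
  · rw [← ContinuousLinearMap.comp_sub]
    refine (L.opNorm_comp_le _).trans ?_
    have := h.lip ζ ζ' (hζ.trans hi) (hζ'.trans hi)
    rw [mul_assoc]
    gcongr

/-- The Jacobian determinant of a linear map of the plane. -/
noncomputable def areaDet (A : Plane →L[ℝ] Plane) : ℝ := area (A !₂[1, 0]) (A !₂[0, 1])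

theorem area_map (A : Plane →L[ℝ] Plane) (u w : Plane) :
    area (A u) (A w) = areaDet A * area u w := by
  have h : ∀ z : Plane, z = z 0 • !₂[1, 0] + z 1 • !₂[0, 1] := fun z => by
    ext i; fin_cases i <;> simp
  have hA : ∀ z : Plane, A z = z 0 • A !₂[1, 0] + z 1 • A !₂[0, 1] := fun z => by
    conv_lhs => rw [h z]
    simp only [map_add, map_smul]
  rw [hA u, hA w, areaDet]
  simp only [area, PiLp.add_apply, PiLp.smul_apply, smul_eq_mul]
  ring

section Systems

open scoped ENNReal NNReal

variable {S : Type*} [EMetricSpace S] [ChartedSpace (EuclideanSpace ℝ (Fin 2)) S]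
  [IsManifold (𝓡 2) ∞ S]
variable [RiemannianBundle (fun x : S => TangentSpace (𝓡 2) x)]
variable {G : Type*} [NormedAddCommGroup G] [InnerProductSpace ℝ G]

/-- The derivative of a map to a vector space, as a function on the tangent bundle. -/
noncomputable def tderiv (Φ : S → G) (W : TangentBundle (𝓡 2) S) : G :=
  mfderiv (𝓡 2) 𝓘(ℝ, G) Φ W.proj W.2

/-- Uniform bounds, with the constant `K`, for the maps of the set `D` around the points of `Λ`,
read in finitely many charts, and for an immersion `Φ`. -/
structure UniformSystem {U V : Set S} (Λ : Set S) (D : Set (DiffeoInto U V)) (c : S → S)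
    (P : Finset S) (Q : S → Set S) (Φ : S → G) (K : ℝ) : Prop where
  charts : UniformCharts Λ U c P Q K
  localRep : ∀ f ∈ D, ∀ x ∈ Λ, f x ∈ Λ → HasLipDeriv K (localRep f (c x) (c (f x)) x)
    (fun ζ => fderiv ℝ (inCharts f (c x) (c (f x))) (extChartAt (𝓡 2) (c x) x + ζ))
  mem : ∀ f ∈ D, ∀ x ∈ Λ, f x ∈ Λ → ∀ ζ : Plane, ‖ζ‖ ≤ K⁻¹ → f (par (c x) x ζ) ∈ Q (c (f x))
  contMDiff : ContMDiff (𝓡 2) 𝓘(ℝ, G) ∞ Φ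
  smooth : ∀ x ∈ Λ, HasLipDeriv K (fun ζ => Φ (par (c x) x ζ) - Φ x)
    (fun ζ => fderiv ℝ (Φ ∘ (extChartAt (𝓡 2) (c x)).symm) (extChartAt (𝓡 2) (c x) x + ζ))
  tderiv_le : ∀ W ∈ unitTangent Λ, ‖tderiv Φ W‖ ≤ K
  le_tderiv : ∀ W ∈ unitTangent Λ, K⁻¹ ≤ ‖tderiv Φ W‖ ^ 2

theorem continuous_tderiv {Φ : S → G} (hΦ : ContMDiff (𝓡 2) 𝓘(ℝ, G) ∞ Φ) :
    Continuous (tderiv Φ) := by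
  have h := hΦ.continuous_tangentMap (by simp)
  exact continuous_snd.comp ((tangentBundleModelSpaceHomeomorph 𝓘(ℝ, G)).continuous.comp h)

/-- One constant larger than all the bounds obtained by compactness. The lower bound on the
derivative of Φ is its minimum over unit vectors at points of Λ, positive by injectivity. -/
theorem exists_uniformSystem [IsContinuousRiemannianBundle (EuclideanSpace ℝ (Fin 2))
    (fun x : S => TangentSpace (𝓡 2) x)] [IsRiemannianManifold (𝓡 2) S]
    {Λ U V : Set S} (hΛ : IsCompact Λ) (hU : IsOpen U) (hΛU : Λ ⊆ U) {D : Set (DiffeoInto U V)}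
    (hD : IsC2Bounded D) :
    ∃ (c : S → S) (P P' : Finset S) (Q : S → Set S) (Φ : S → PiLp 2 fun _ : P' => Plane) (K : ℝ),
      UniformSystem Λ D c P Q Φ K := by
  obtain ⟨c, P, Q, K₀, hK₀, hc⟩ := exists_uniform_charts hΛ hU hΛU
  have h : UniformCharts Λ U c P Q K₀ := ⟨hK₀, fun x hx => (hc x hx).1, fun x hx => (hc x hx).2⟩
  obtain ⟨P', Φ, hΦ, hinj⟩ := exists_immersion_of_isCompact hΛ
  obtain ⟨K₁, hK₁, h₁⟩ := exists_uniform_localRep h hD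
  obtain ⟨K₂, hK₂, h₂⟩ := exists_uniform_smooth h hΦ
  have hcont := (continuous_tderiv hΦ).norm
  obtain ⟨K₃, hK₃⟩ := ((isCompact_unitTangent hΛ).bddAbove_image hcont.continuousOn)
  have hlow : ∃ K₄ : ℝ, 0 < K₄ ∧ ∀ W ∈ unitTangent Λ, K₄ ≤ ‖tderiv Φ W‖ ^ 2 := by
    rcases (unitTangent Λ).eq_empty_or_nonempty with he | he
    · exact ⟨1, one_pos, by simp [he]⟩
    · obtain ⟨W, hW, hmin⟩ := (isCompact_unitTangent hΛ).exists_isMinOn he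
        (hcont.pow 2).continuousOn
      refine ⟨_, ?_, fun W' hW' => hmin hW'⟩
      have : tderiv Φ W ≠ 0 := fun h0 => by
        have h1 := hinj _ hW.1 (h0.trans (map_zero _).symm)
        have h2 := hW.2
        rw [h1, norm_zero] at h2
        exact zero_ne_one h2
      exact pow_pos (norm_pos_iff.2 this) 2
  obtain ⟨K₄, hK₄, h₄⟩ := hlow
  set K := K₁ + K₂ + |K₃| + K₄⁻¹ with hK
  have h4 : 0 < K₄⁻¹ := inv_pos.2 hK₄
  have h3 := abs_nonneg K₃
  have h3' := le_abs_self K₃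
  refine ⟨c, P, P', Q, Φ, K, h.mono (by linarith), fun f hf x hx hfx => ?_,
    fun f hf x hx hfx ζ hζ => ?_, hΦ, fun x hx => ?_, fun W hW => ?_, fun W hW => ?_⟩
  · exact (h₁ f hf x hx hfx).1.mono (by linarith) (by linarith)
  · exact (h₁ f hf x hx hfx).2 ζ (hζ.trans (inv_anti₀ (by linarith) (by linarith)))
  · exact (h₂ x hx).mono (by linarith) (by linarith)
  · have : ‖tderiv Φ W‖ ≤ K₃ := hK₃ ⟨W, hW, rfl⟩
    linarith
  · refine le_trans ?_ (h₄ W hW)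
    rw [inv_le_comm₀ (by linarith) hK₄]
    linarith

variable {U V Λ : Set S} {D : Set (DiffeoInto U V)} {c : S → S} {P : Finset S} {Q : S → Set S}
  {Φ : S → G} {K : ℝ}

/-- The local representatives along an orbit. -/
noncomputable def orbitRep (f : S → S) (c : S → S) (x : S) (n : ℕ) : Plane → Plane :=
  localRep f (c (f^[n] x)) (c (f (f^[n] x))) (f^[n] x)

/-- The derivatives of the local representatives along an orbit. -/
noncomputable def orbitDeriv (f : S → S) (c : S → S) (x : S) (n : ℕ) (ζ : Plane) :
    Plane →L[ℝ] Plane :=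
  fderiv ℝ (inCharts f (c (f^[n] x)) (c (f (f^[n] x))))
    (extChartAt (𝓡 2) (c (f^[n] x)) (f^[n] x) + ζ)

/-- The coordinates of the images of a tangent vector along an orbit. -/
noncomputable def orbitVec (f : S → S) (c : S → S) (x : S) (n : ℕ) (W : TangentBundle (𝓡 2) S) :
    Plane :=
  tcrd (c (f^[n] x)) ((tangentMap (𝓡 2) (𝓡 2) f)^[n] W)

/-- The determinants of the derivatives along an orbit. -/
noncomputable def orbitDet (f : S → S) (c : S → S) (x : S) (n : ℕ) : ℝ :=
  ∏ k ∈ Finset.range n, areaDet (orbitDeriv f c x k 0)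

/-- The linear function `⟪Φ y - Φ x, DΦ e⟫` for a vector `e` at `x`. -/
noncomputable def height (Φ : S → G) (W : TangentBundle (𝓡 2) S) (y : S) : ℝ :=
  inner ℝ (tderiv Φ W) (Φ y - Φ W.proj)

/-- The derivative of the height. -/
noncomputable def dheight (Φ : S → G) (W X : TangentBundle (𝓡 2) S) : ℝ :=
  inner ℝ (tderiv Φ W) (tderiv Φ X)

namespace UniformSystem

variable (hs : UniformSystem Λ D c P Q Φ K) {f : DiffeoInto U V} (hf : f ∈ D)
include hs

theorem one_le : 1 ≤ K := hs.charts.one_le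

theorem control {x : S} (hx : x ∈ Λ) : ChartControl U (c x) x (Q (c x)) K := hs.charts.control x hx

theorem orbit_mem {x : S} (hx : ∀ k, f^[k] x ∈ Λ) (k : ℕ) : f^[k] x ∈ U :=
  (hs.control (hx k)).subset (hs.control (hx k)).mem

include hf

/-- The derivative acts on tangent vectors at points near an orbit. -/
theorem orbitVec_succ {x : S} (hx : ∀ k, f^[k] x ∈ Λ) {n : ℕ} {W : TangentBundle (𝓡 2) S}
    (hW : f^[n] W.proj ∈ Q (c (f^[n] x)))
    (hW' : f^[n + 1] W.proj ∈ Q (c (f^[n + 1] x))) :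
    orbitVec f c x (n + 1) W =
      orbitDeriv f c x n (crd (c (f^[n] x)) (f^[n] x) (f^[n] W.proj)) (orbitVec f c x n W) := by
  have h1 := hs.control (hx n)
  have h2 := hs.control (hx (n + 1))
  have hp := tangentMap_iterate_proj f n W
  have hW2 := h2.subset_source hW'
  rw [Function.iterate_succ_apply', Function.iterate_succ_apply'] at hW2
  rw [orbitVec, Function.iterate_succ_apply', Function.iterate_succ_apply' (tangentMap _ _ _),
    tcrd_tangentMap (p := c (f^[n] x)) (hp.symm ▸
    h1.subset_source hW) (f.mdifferentiableAt (hp.symm ▸ h1.subset hW)) (hp.symm ▸ hW2)]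
  rw [orbitDeriv, hp, crd, add_sub_cancel, orbitVec]

theorem orbitVec_succ_self {x : S} (hx : ∀ k, f^[k] x ∈ Λ) (n : ℕ) (w : TangentSpace (𝓡 2) x) :
    orbitVec f c x (n + 1) ⟨x, w⟩ = orbitDeriv f c x n 0 (orbitVec f c x n ⟨x, w⟩) := by
  rw [hs.orbitVec_succ hf hx (W := ⟨x, w⟩) (hs.control (hx n)).mem (hs.control (hx (n + 1))).mem]
  simp [crd]

theorem area_orbitVec {x : S} (hx : ∀ k, f^[k] x ∈ Λ) (n : ℕ) (e w : TangentSpace (𝓡 2) x) :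
    area (orbitVec f c x n ⟨x, e⟩) (orbitVec f c x n ⟨x, w⟩) =
      orbitDet f c x n * area (orbitVec f c x 0 ⟨x, e⟩) (orbitVec f c x 0 ⟨x, w⟩) := by
  induction n with
  | zero => simp [orbitDet]
  | succ n ih =>
    rw [hs.orbitVec_succ_self hf hx, hs.orbitVec_succ_self hf hx, area_map, ih, orbitDet, orbitDet,
      Finset.prod_range_succ]
    ring

omit hf in
theorem norm_orbitVec_le {x : S} (hx : ∀ k, f^[k] x ∈ Λ) {n : ℕ} {W : TangentBundle (𝓡 2) S}
    (hW : f^[n] W.proj ∈ Q (c (f^[n] x))) : ‖orbitVec f c x n W‖ ≤ K * speed f n W :=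
  (hs.control (hx n)).norm_le _ (tangentMap_iterate_proj f n W ▸ hW) _

omit hf in
theorem speed_le_norm_orbitVec {x : S} (hx : ∀ k, f^[k] x ∈ Λ) {n : ℕ}
    {W : TangentBundle (𝓡 2) S} (hW : f^[n] W.proj ∈ Q (c (f^[n] x))) :
    speed f n W ≤ K * ‖orbitVec f c x n W‖ :=
  (hs.control (hx n)).le_norm _ (tangentMap_iterate_proj f n W ▸ hW) _

omit hf in
theorem orbitVec_combination (hx : ∀ k, f^[k] x ∈ Λ) (n : ℕ) (e w : TangentSpace (𝓡 2) x)
    (a b : ℝ) : a • orbitVec f c x n ⟨x, e⟩ + b • orbitVec f c x n ⟨x, w⟩ =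
      orbitVec f c x n ⟨x, a • e + b • w⟩ := by
  have hU := hs.orbit_mem hx
  have key : ∀ z : TangentSpace (𝓡 2) x, orbitVec f c x n ⟨x, z⟩ =
      chartDeriv (c (f^[n] x)) (f^[n] x) (mfderiv (𝓡 2) (𝓡 2) f^[n] x z) := fun z => by
    rw [orbitVec, f.tangentMap_iterate (W := ⟨x, z⟩) fun k _ => hU k]
    rfl
  simp only [key, map_add, map_smul]

/-- The coordinates of the images of an orthonormal pair span an area proportional to `orbitDet`.
Charts distort norms by K, hence squared areas by K⁴; this is paid at time 0 and at time n, giving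
K⁸ for the squares. -/
theorem orbitDet_bounds {x : S} (hx : ∀ k, f^[k] x ∈ Λ) (n : ℕ) :
    |orbitDet f c x n| ≤ K ^ 4 * absDet f n x ∧ absDet f n x ≤ K ^ 4 * |orbitDet f c x n| := by
  have hK := hs.one_le
  have hU := hs.orbit_mem hx
  obtain ⟨e, he⟩ : ∃ e : TangentSpace (𝓡 2) x, ‖e‖ = 1 := by
    have : Nontrivial (TangentSpace (𝓡 2) x) :=
      Module.nontrivial_of_finrank_pos (R := ℝ) (by rw [finrank_tangentSpace]; simp)
    exact exists_norm_eq _ zero_le_one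
  obtain ⟨w, hw, hg⟩ := exists_norm_eq_one_gramDet_eq_one (finrank_tangentSpace x) he
  have hup : ∀ n, area (orbitVec f c x n ⟨x, e⟩) (orbitVec f c x n ⟨x, w⟩) ^ 2 ≤
      K ^ 4 * absDet f n x ^ 2 := fun n => by
    rw [← gramDet_plane, ← mul_one (absDet f n x ^ 2), ← hg, ← f.gramDet_iterate n e w]
    refine gramDet_le_of_norm_le fun a b => ?_
    rw [hs.orbitVec_combination hx, ← map_smul, ← map_smul, ← map_add, ← f.speed_eq hU]
    exact hs.norm_orbitVec_le hx (hs.control (hx n)).mem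
  have hlow : ∀ n, absDet f n x ^ 2 ≤ K ^ 4 *
      area (orbitVec f c x n ⟨x, e⟩) (orbitVec f c x n ⟨x, w⟩) ^ 2 := fun n => by
    rw [← gramDet_plane, ← mul_one (absDet f n x ^ 2), ← hg, ← f.gramDet_iterate n e w]
    refine gramDet_le_of_norm_le fun a b => ?_
    rw [hs.orbitVec_combination hx, ← map_smul, ← map_smul, ← map_add, ← f.speed_eq hU]
    exact hs.speed_le_norm_orbitVec hx (hs.control (hx n)).mem
  have h0 : absDet f 0 x ^ 2 = 1 := by
    have := f.gramDet_iterate 0 e w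
    simp only [hg, mul_one] at this
    rw [← this, ← hg]
    have h1 : mfderiv (𝓡 2) (𝓡 2) f^[0] x = ContinuousLinearMap.id ℝ _ := mfderiv_id
    rw [h1]
    rfl
  have hA := hs.area_orbitVec hf hx n e w
  have hup0 := hup 0
  have hlow0 := hlow 0
  rw [h0] at hup0 hlow0
  have hupn := hup n
  have hlown := hlow n
  rw [hA, mul_pow] at hupn hlown
  set d := orbitDet f c x n
  set a := absDet f n x
  set α := area (orbitVec f c x 0 ⟨x, e⟩) (orbitVec f c x 0 ⟨x, w⟩) ^ 2
  have ha : 0 ≤ a := LinearMap.normDet_nonneg _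
  constructor
  · refine abs_le_of_sq_le_sq (le_trans ?_ (le_of_eq (?_ : K ^ 4 * (K ^ 4 * a ^ 2) = _)))
      (by positivity)
    · calc d ^ 2 = d ^ 2 * 1 := by ring
        _ ≤ d ^ 2 * (K ^ 4 * α) := by gcongr
        _ = K ^ 4 * (d ^ 2 * α) := by ring
        _ ≤ _ := by gcongr
    · ring
  · refine (pow_le_pow_iff_left₀ ha (by positivity) two_ne_zero).1 ?_
    calc a ^ 2 ≤ K ^ 4 * (d ^ 2 * α) := hlown
      _ ≤ K ^ 4 * (d ^ 2 * (K ^ 4 * 1)) := by gcongr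
      _ = (K ^ 4 * |d|) ^ 2 := by rw [mul_pow, sq_abs]; ring

end UniformSystem

end Systems

end SurfaceStable

/-! ### Points shadowing an orbit at the rate of a pinched vector -/

namespace SurfaceStable

set_option linter.unusedSectionVars false

section Shadows

open scoped ENNReal NNReal

variable {S : Type*} [EMetricSpace S] [ChartedSpace (EuclideanSpace ℝ (Fin 2)) S]
  [IsManifold (𝓡 2) ∞ S]
variable [RiemannianBundle (fun x : S => TangentSpace (𝓡 2) x)]
variable {G : Type*} [NormedAddCommGroup G] [InnerProductSpace ℝ G]

variable {U V Λ : Set S} {D : Set (DiffeoInto U V)} {c : S → S} {P : Finset S} {Q : S → Set S}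
  {Φ : S → G} {K : ℝ} {σ σ' ρ ρ' τ ε : ℝ}

theorem UniformSystem.mono (hs : UniformSystem Λ D c P Q Φ K) {K' : ℝ} (hK : K ≤ K') :
    UniformSystem Λ D c P Q Φ K' := by
  have h0 : 0 < K := one_pos.trans_le hs.one_le
  have hi : K'⁻¹ ≤ K⁻¹ := inv_anti₀ h0 hK
  exact ⟨hs.charts.mono hK, fun f hf x hx hfx => (hs.localRep f hf x hx hfx).mono h0 hK,
    fun f hf x hx hfx ζ hζ => hs.mem f hf x hx hfx ζ (hζ.trans hi), hs.contMDiff,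
    fun x hx => (hs.smooth x hx).mono h0 hK, fun W hW => (hs.tderiv_le W hW).trans hK,
    fun W hW => hi.trans (hs.le_tderiv W hW)⟩

/-- The height, read in a chart. -/
noncomputable def localHeight (Φ : S → G) (c : S → S) (e : TangentBundle (𝓡 2) S) (ζ : Plane) :
    ℝ :=
  innerSL ℝ (tderiv Φ e) (Φ (par (c e.proj) e.proj ζ) - Φ e.proj)

/-- The derivative of the height, read in a chart. -/
noncomputable def localDHeight (Φ : S → G) (c : S → S) (e : TangentBundle (𝓡 2) S) (ζ : Plane) :
    Plane →L[ℝ] ℝ :=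
  (innerSL ℝ (tderiv Φ e)).comp (fderiv ℝ (Φ ∘ (extChartAt (𝓡 2) (c e.proj)).symm)
    (extChartAt (𝓡 2) (c e.proj) e.proj + ζ))

theorem localDHeight_apply (hΦ : ContMDiff (𝓡 2) 𝓘(ℝ, G) ∞ Φ) {e W : TangentBundle (𝓡 2) S}
    (hW : W.proj ∈ (extChartAt (𝓡 2) (c e.proj)).source) :
    localDHeight Φ c e (crd (c e.proj) e.proj W.proj) (tcrd (c e.proj) W) = dheight Φ e W := by
  obtain ⟨A, hA, hA'⟩ := hasFDerivAt_inCharts hW (hΦ.mdifferentiableAt (by simp))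
  rw [localDHeight, crd, add_sub_cancel, hA.fderiv]
  exact congrArg (fun g => inner ℝ (tderiv Φ e) g) (hA' W.2)

/-- The local representatives along an orbit with a pinched vector satisfy the assumptions of the
Lyapunov–Perron argument. -/
theorem UniformSystem.pinchedOrbit [IsContinuousRiemannianBundle (EuclideanSpace ℝ (Fin 2))
    (fun x : S => TangentSpace (𝓡 2) x)] (hs : UniformSystem Λ D c P Q Φ K) {f : DiffeoInto U V}
    (hf : f ∈ D) {e : TangentBundle (𝓡 2) S} (hx : ∀ k, f^[k] e.proj ∈ Λ)
    (he : IsPinchedVector f σ σ' ρ ρ' e) (hσ' : 0 < σ') (hρ : 0 < ρ) (hρ' : 0 < ρ')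
    (hJ : 0 < minNorm f Λ) {K' : ℝ} (hK' : K ^ 8 * (1 + (minNorm f Λ)⁻¹) ≤ K') :
    PinchedOrbit K' σ ρ ρ' (orbitRep f c e.proj) (orbitDeriv f c e.proj) (localHeight Φ c e)
      (localDHeight Φ c e) (fun n => orbitVec f c e.proj n e) (orbitDet f c e.proj) := by
  have hK := hs.one_le
  have hK0 : 0 < K := by linarith
  have hJ' : 0 < (minNorm f Λ)⁻¹ := inv_pos.2 hJ
  have hpow : ∀ j ≤ 8, K ^ j ≤ K' := fun j hj => by
    refine ((pow_le_pow_right₀ hK hj).trans ?_).trans hK'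
    exact le_mul_of_one_le_right (by positivity) (by linarith)
  have hKK' : K ≤ K' := by simpa using hpow 1 (by norm_num)
  have hm : ∀ n, f^[n] e.proj ∈ Q (c (f^[n] e.proj)) := fun n => (hs.control (hx n)).mem
  have hup : ∀ n, ‖orbitVec f c e.proj n e‖ ≤ K * speed f n e := fun n =>
    hs.norm_orbitVec_le hx (hm n)
  have hlow : ∀ n, speed f n e ≤ K * ‖orbitVec f c e.proj n e‖ := fun n =>
    hs.speed_le_norm_orbitVec hx (hm n)
  have hsp : ∀ n, 0 < speed f n e := fun n => (pow_pos hσ' n).trans_le (he.le_speed n)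
  have hdet := fun n => hs.orbitDet_bounds hf hx n
  have hxΛ : e.proj ∈ Λ := hx 0
  have heu : e ∈ unitTangent Λ := ⟨hxΛ, he.norm_eq⟩
  have hΛn : ∀ n, f (f^[n] e.proj) ∈ Λ := fun n => by
    have := hx (n + 1)
    rwa [Function.iterate_succ_apply'] at this
  refine ⟨fun n => (hs.localRep f hf _ (hx n) (hΛn n)).mono hK0 hKK', ?_,
    fun n => (hs.orbitVec_succ_self hf hx n e.2).symm, fun n u w => ?_, fun n h0 => ?_,
    fun n h0 => ?_, fun n => ?_, fun n => ?_, fun n => ?_, fun n => ?_, ?_⟩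
  · refine (((hs.smooth _ hxΛ).clm_comp hK0 hK (innerSL ℝ (tderiv Φ e)) ?_).mono
      (by positivity) ?_)
    · rw [innerSL_apply_norm]; exact hs.tderiv_le e heu
    · rw [← pow_two]; exact hpow 2 (by norm_num)
  · rw [area_map, orbitDet, orbitDet, Finset.prod_range_succ]; ring
  · have := hlow n
    simp only [h0, norm_zero, mul_zero] at this
    exact absurd (hsp n) this.not_gt
  · have := (hdet n).2
    rw [h0, abs_zero, mul_zero] at this
    exact absurd (he.absDet_pos n) this.not_gt
  · calc _ ≤ K * speed f n e := hup n
      _ ≤ K' * σ ^ n := by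
        have := he.speed_le n
        have := hsp n
        have : 0 ≤ K' := by linarith
        gcongr
  · have h1 : minNorm f Λ * speed f n e ≤ speed f (n + 1) e := by
      rw [speed, speed, Function.iterate_succ_apply']
      refine f.minNorm_mul_le ?_
      rw [tangentMap_iterate_proj]; exact hx n
    have h2 : speed f n e ≤ (minNorm f Λ)⁻¹ * speed f (n + 1) e := by
      rw [inv_mul_eq_div, le_div_iff₀ hJ]; linarith
    calc _ ≤ K * speed f n e := hup n
      _ ≤ K * ((minNorm f Λ)⁻¹ * (K * ‖orbitVec f c e.proj (n + 1) e‖)) := by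
        gcongr; exact h2.trans (by gcongr; exact hlow _)
      _ = K ^ 2 * (minNorm f Λ)⁻¹ * ‖orbitVec f c e.proj (n + 1) e‖ := by ring
      _ ≤ K' * _ := by
        refine mul_le_mul_of_nonneg_right (le_trans ?_ hK') (norm_nonneg _)
        gcongr
        · norm_num
        · linarith
  · calc _ ≤ (K * speed f n e) ^ 2 := by gcongr; exact hup n
      _ = K ^ 2 * speed f n e ^ 2 := by ring
      _ ≤ K ^ 2 * (ρ ^ n * (K ^ 4 * |orbitDet f c e.proj n|)) := by
        gcongr
        exact (he.sq_le n).trans (by gcongr; exact (hdet n).2)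
      _ = K ^ 6 * ρ ^ n * |orbitDet f c e.proj n| := by ring
      _ ≤ _ := by gcongr; exact hpow 6 (by norm_num)
  · calc _ ≤ ρ' ^ n * (K ^ 4 * absDet f n e.proj) := by gcongr; exact (hdet n).1
      _ = K ^ 4 * (ρ' ^ n * absDet f n e.proj) := by ring
      _ ≤ K ^ 4 * (K * ‖orbitVec f c e.proj n e‖) ^ 2 := by
        gcongr
        refine (he.le_sq n).trans ?_
        have := hsp n
        gcongr
        exact hlow n
      _ = K ^ 6 * ‖orbitVec f c e.proj n e‖ ^ 2 := by ring
      _ ≤ _ := by gcongr; exact hpow 6 (by norm_num)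
  · have h1 := localDHeight_apply hs.contMDiff (e := e) (W := e)
      ((hs.control hxΛ).subset_source (hs.control hxΛ).mem)
    simp only [crd, sub_self] at h1
    change K'⁻¹ ≤ localDHeight Φ c e 0 (tcrd (c e.proj) e)
    rw [h1, dheight, real_inner_self_eq_norm_sq]
    exact (inv_anti₀ hK0 hKK').trans (hs.le_tderiv e heu)

/-- The orbit of `y` stays in `U` and approaches the orbit of the base point of `e` at the rate of
`e`, up to a subexponential factor. -/
def IsShadow (f : S → S) (U : Set S) (τ ε : ℝ) (e : TangentBundle (𝓡 2) S) (y : S) : Prop :=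
  ∀ n : ℕ, f^[n] y ∈ U ∧
    edist (f^[n] e.proj) (f^[n] y) ≤ ENNReal.ofReal (ε * τ ^ n * speed f n e)

/-- The standing assumptions on the orbit of a pinched vector. -/
structure GoodVector (Λ : Set S) (D : Set (DiffeoInto U V)) (c : S → S) (P : Finset S)
    (Q : S → Set S) (Φ : S → G) (K σ ρ ρ' τ ε : ℝ) (f : DiffeoInto U V)
    (e : TangentBundle (𝓡 2) S) : Prop where
  system : UniformSystem Λ D c P Q Φ K
  map_mem : f ∈ D
  orbit_mem : ∀ k, f^[k] e.proj ∈ Λ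
  speed_pos : ∀ n, 0 < speed f n e
  speed_le : ∀ n, speed f n e ≤ σ ^ n
  orbit : PinchedOrbit K σ ρ ρ' (orbitRep f c e.proj) (orbitDeriv f c e.proj) (localHeight Φ c e)
    (localDHeight Φ c e) (fun n => orbitVec f c e.proj n e) (orbitDet f c e.proj)
  rate_pos : 0 < σ
  rate_le : σ ≤ 1
  pinch_pos : 0 < ρ'
  pinch_le : ρ' ≤ ρ
  pinch_le_one : ρ ≤ 1
  one_le : 1 ≤ τ
  mul_le_one : τ * σ ≤ 1
  mul_lt_one : τ * ρ < 1
  decay_lt : decayRate σ ρ ρ' τ < 1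
  decay_lt' : decayRate σ ρ ρ' 1 < 1
  size_pos : 0 < ε
  size_le : K ^ 2 * ε ≤ perronRadius K (decayRate σ ρ ρ' τ)
  size_le' : K ^ 2 * ε ≤ perronRadius K (decayRate σ ρ ρ' 1)

namespace GoodVector

variable {f : DiffeoInto U V} {e : TangentBundle (𝓡 2) S}
variable (h : GoodVector Λ D c P Q Φ K σ ρ ρ' τ ε f e)
include h

theorem one_le_const : 1 ≤ K := h.system.one_le

theorem control (n : ℕ) : ChartControl U (c (f^[n] e.proj)) (f^[n] e.proj)
    (Q (c (f^[n] e.proj))) K := h.system.control (h.orbit_mem n)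

theorem sq_mul_size_le : K ^ 2 * ε ≤ K⁻¹ := by
  have h1 := perronRadius_mul_le h.one_le_const h.decay_lt
  have h2 := perronRadius_pos h.one_le_const h.decay_lt
  have hK := h.one_le_const
  refine h.size_le.trans (le_trans ?_ h1)
  exact le_mul_of_one_le_right h2.le hK

theorem mul_pow_mul_speed_le (n : ℕ) : τ ^ n * speed f n e ≤ 1 := by
  have h1 := h.one_le
  have h2 := h.rate_pos
  calc τ ^ n * speed f n e ≤ τ ^ n * σ ^ n := by gcongr; exact h.speed_le n
    _ = (τ * σ) ^ n := (mul_pow _ _ _).symm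
    _ ≤ 1 := pow_le_one₀ (by positivity) h.mul_le_one

theorem norm_orbitVec_le (n : ℕ) : ‖orbitVec f c e.proj n e‖ ≤ K * speed f n e :=
  h.system.norm_orbitVec_le h.orbit_mem (h.control n).mem

theorem speed_le_norm_orbitVec (n : ℕ) : speed f n e ≤ K * ‖orbitVec f c e.proj n e‖ :=
  h.system.speed_le_norm_orbitVec h.orbit_mem (h.control n).mem

theorem edist_le_inv {y : S} (hy : IsShadow f U τ ε e y) (n : ℕ) :
    edist (f^[n] e.proj) (f^[n] y) ≤ ENNReal.ofReal K⁻¹ := by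
  refine (hy n).2.trans (ENNReal.ofReal_le_ofReal ?_)
  have hK := h.one_le_const
  have h1 := h.mul_pow_mul_speed_le n
  have h2 := h.size_pos
  calc ε * τ ^ n * speed f n e = ε * (τ ^ n * speed f n e) := by ring
    _ ≤ ε * 1 := by gcongr
    _ ≤ K ^ 2 * ε * 1 := by
      gcongr
      exact le_mul_of_one_le_left h2.le (one_le_pow₀ hK)
    _ ≤ K⁻¹ := by rw [mul_one]; exact h.sq_mul_size_le

theorem shadow_mem {y : S} (hy : IsShadow f U τ ε e y) (n : ℕ) :
    f^[n] y ∈ Q (c (f^[n] e.proj)) := (h.control n).mem_of_edist_le _ (h.edist_le_inv hy n)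

theorem shadow_succ {y : S} (hy : IsShadow f U τ ε e y) (n : ℕ) :
    crd (c (f^[n + 1] e.proj)) (f^[n + 1] e.proj) (f^[n + 1] y) =
      orbitRep f c e.proj n (crd (c (f^[n] e.proj)) (f^[n] e.proj) (f^[n] y)) := by
  rw [orbitRep, localRep, par_crd (h.control n) (h.shadow_mem hy n), Function.iterate_succ_apply',
    Function.iterate_succ_apply']

theorem norm_shadow_le' {y : S} (hy : IsShadow f U τ ε e y) (n : ℕ) :
    ‖crd (c (f^[n] e.proj)) (f^[n] e.proj) (f^[n] y)‖ ≤ K * (ε * τ ^ n * speed f n e) := by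
  have h1 := h.one_le
  have h2 := h.size_pos
  have h3 := h.speed_pos n
  have := (h.control n).norm_crd_sub_le (f^[n] y) (f^[n] e.proj) (h.edist_le_inv hy n)
    (by simp) (ε * τ ^ n * speed f n e) (by positivity) (by rw [edist_comm]; exact (hy n).2)
  simpa [crd] using this

theorem norm_shadow_le {y : S} (hy : IsShadow f U τ ε e y) (n : ℕ) :
    ‖crd (c (f^[n] e.proj)) (f^[n] e.proj) (f^[n] y)‖ ≤
      perronRadius K (decayRate σ ρ ρ' τ) * τ ^ n * ‖orbitVec f c e.proj n e‖ := by
  have h1 := h.one_le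
  have h2 := h.size_pos
  have hK := h.one_le_const
  calc _ ≤ K * (ε * τ ^ n * speed f n e) := h.norm_shadow_le' hy n
    _ ≤ K * (ε * τ ^ n * (K * ‖orbitVec f c e.proj n e‖)) := by
      gcongr; exact h.speed_le_norm_orbitVec n
    _ = (K ^ 2 * ε) * τ ^ n * ‖orbitVec f c e.proj n e‖ := by ring
    _ ≤ _ := by gcongr; exact h.size_le

theorem norm_shadow_le_inv {y : S} (hy : IsShadow f U τ ε e y) (n : ℕ) :
    ‖crd (c (f^[n] e.proj)) (f^[n] e.proj) (f^[n] y)‖ ≤ K⁻¹ := by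
  have h2 := h.size_pos
  have hK := h.one_le_const
  calc _ ≤ K * (ε * τ ^ n * speed f n e) := h.norm_shadow_le' hy n
    _ = K * ε * (τ ^ n * speed f n e) := by ring
    _ ≤ K * ε * 1 := by gcongr; exact h.mul_pow_mul_speed_le n
    _ ≤ K * (K * ε) := by
      rw [mul_one]; gcongr; exact le_mul_of_one_le_left h2.le hK
    _ = K ^ 2 * ε := by ring
    _ ≤ _ := h.sq_mul_size_le

theorem localHeight_crd {y : S} (hy : y ∈ Q (c e.proj)) :
    localHeight Φ c e (crd (c e.proj) e.proj y) = height Φ e y := by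
  have := par_crd (h.control 0) hy
  simp only [Function.iterate_zero, id_eq] at this
  rw [localHeight, this]
  rfl

/-- Points with the same height whose orbits approach the orbit of the base point at the rate of
`e` coincide; quantitatively, the height controls the distance along the orbits. -/
theorem edist_le {y y' : S} (hy : IsShadow f U τ ε e y) (hy' : IsShadow f U τ ε e y') (n : ℕ) :
    edist (f^[n] y) (f^[n] y') ≤
      ENNReal.ofReal (4 * K ^ 3 * speed f n e * |height Φ e y - height Φ e y'|) := by
  have hK := h.one_le_const
  have h1 := h.orbit.norm_sub_le hK h.rate_pos h.pinch_pos h.pinch_le h.pinch_le_one h.one_le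
    h.mul_le_one h.mul_lt_one h.decay_lt (h.shadow_succ hy) (h.shadow_succ hy')
    (h.norm_shadow_le hy) (h.norm_shadow_le hy') n
  have h2 := (h.control n).edist_le _ _ (h.norm_shadow_le_inv hy n) (h.norm_shadow_le_inv hy' n)
  rw [par_crd (h.control n) (h.shadow_mem hy n), par_crd (h.control n) (h.shadow_mem hy' n)] at h2
  refine h2.trans (ENNReal.ofReal_le_ofReal ?_)
  have e1 := h.localHeight_crd (h.shadow_mem hy 0)
  have e2 := h.localHeight_crd (h.shadow_mem hy' 0)
  simp only [Function.iterate_zero, id_eq] at h1 e1 e2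
  rw [e1, e2] at h1
  calc _ ≤ K * (4 * K * (K * speed f n e) * |height Φ e y - height Φ e y'|) := by
        gcongr
        refine h1.trans ?_
        gcongr
        exact h.norm_orbitVec_le n
    _ = _ := by ring

/-- Case n = 0 of `edist_le`. This uniqueness identifies the limits of shadowing points. -/
theorem eq_of_height_eq {y y' : S} (hy : IsShadow f U τ ε e y) (hy' : IsShadow f U τ ε e y')
    (hyy' : height Φ e y = height Φ e y') : y = y' := by
  have := h.edist_le hy hy' 0
  rw [hyy', sub_self, abs_zero, mul_zero, ENNReal.ofReal_zero] at this
  simpa using this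

/-- The tangent version of `edist_le`. -/
theorem speed_le_of_slow_growth {W : TangentBundle (𝓡 2) S} (hW : IsShadow f U τ ε e W.proj)
    {X : ℝ} (hX : ∀ n, speed f n W ≤ X * τ ^ n * speed f n e) (n : ℕ) :
    speed f n W ≤ 4 * K ^ 3 * speed f n e * |dheight Φ e W| := by
  have hK := h.one_le_const
  have hτ := h.one_le
  have hX0 : 0 ≤ X := by
    have h1 := hX 0
    have h2 := speed_nonneg f 0 W
    have h3 := h.speed_pos 0
    rw [pow_zero, mul_one] at h1
    nlinarith
  have h1 := h.orbit.norm_tangent_le hK h.rate_pos h.pinch_pos h.pinch_le h.pinch_le_one h.one_le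
    h.mul_le_one h.mul_lt_one h.decay_lt (h.norm_shadow_le hW)
    (fun n => h.system.orbitVec_succ h.map_mem h.orbit_mem (h.shadow_mem hW n)
      (h.shadow_mem hW (n + 1))) (X₀ := K * X * K) (fun n => by
        calc _ ≤ K * speed f n W := h.system.norm_orbitVec_le h.orbit_mem (h.shadow_mem hW n)
          _ ≤ K * (X * τ ^ n * (K * ‖orbitVec f c e.proj n e‖)) := by
            gcongr
            refine (hX n).trans ?_
            gcongr
            exact h.speed_le_norm_orbitVec n
          _ = _ := by ring) n
  have h2 := localDHeight_apply (c := c) h.system.contMDiff (e := e) (W := W)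
    ((h.control 0).subset_source (h.shadow_mem hW 0))
  have h3 := h.system.speed_le_norm_orbitVec h.orbit_mem (h.shadow_mem hW n)
  change _ ≤ _ * |localDHeight Φ c e (crd (c e.proj) e.proj W.proj) (tcrd (c e.proj) W)| at h1
  rw [h2] at h1
  calc _ ≤ K * (4 * K * (K * speed f n e) * |dheight Φ e W|) := by
        refine h3.trans ?_
        gcongr
        refine h1.trans ?_
        gcongr
        exact h.norm_orbitVec_le n
    _ = _ := by ring

/-- There are asymptotic points of all small heights. -/
theorem exists_shadow {s : ℝ} (hs : 4 * K ^ 3 * |s| ≤ ε) :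
    ∃ y, IsShadow f U τ ε e y ∧ height Φ e y = s := by
  have hK := h.one_le_const
  have hτ := h.one_le
  have h4 : 4 * K * |s| ≤ K ^ 2 * ε := by
    calc 4 * K * |s| ≤ 4 * K ^ 3 * |s| := by gcongr; exact le_self_pow₀ hK (by norm_num)
      _ ≤ 1 * ε := by rw [one_mul]; exact hs
      _ ≤ _ := by have := h.size_pos; gcongr; exact one_le_pow₀ hK
  -- Existence is applied without the weight τⁿ, so the points obtained approach at exactly the rate
  -- of e; uniqueness holds in the larger weighted class.
  obtain ⟨ζ, hζ, hζ0, hζn⟩ := h.orbit.exists_asymptotic_orbit hK h.rate_pos h.rate_le h.pinch_pos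
    h.pinch_le h.pinch_le_one h.decay_lt' (s := s) (h4.trans h.size_le')
  have hζ' : ∀ n, ‖ζ n‖ ≤ 4 * K ^ 2 * |s| * speed f n e := fun n => by
    calc _ ≤ 4 * K * (K * speed f n e) * |s| := by
          refine (hζn n).trans ?_
          gcongr
          exact h.norm_orbitVec_le n
      _ = _ := by ring
  have hinv : ∀ n, ‖ζ n‖ ≤ K⁻¹ := fun n => by
    calc _ ≤ 4 * K ^ 2 * |s| * speed f n e := hζ' n
      _ ≤ 4 * K ^ 3 * |s| * 1 := by
        have h5 : speed f n e ≤ 1 := (h.speed_le n).trans (pow_le_one₀ h.rate_pos.le h.rate_le)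
        have h6 := h.speed_pos n
        gcongr
        · norm_num
      _ ≤ ε := by rw [mul_one]; exact hs
      _ ≤ K ^ 2 * ε := le_mul_of_one_le_left h.size_pos.le (one_le_pow₀ hK)
      _ ≤ _ := h.sq_mul_size_le
  set y := par (c e.proj) e.proj (ζ 0) with hy
  -- The orbit found in coordinates is a genuine orbit on S: each image lies in the domain of the
  -- next chart, so reading it there and returning loses nothing.
  have hit : ∀ n, f^[n] y = par (c (f^[n] e.proj)) (f^[n] e.proj) (ζ n) := by
    intro n
    induction n with
    | zero => rfl
    | succ n ih =>
      have hfx : f (f^[n] e.proj) ∈ Λ := by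
        have := h.orbit_mem (n + 1)
        rwa [Function.iterate_succ_apply'] at this
      have := h.system.mem f h.map_mem _ (h.orbit_mem n) hfx (ζ n) (hinv n)
      rw [hζ n, Function.iterate_succ_apply', Function.iterate_succ_apply', ih, orbitRep, localRep,
        par_crd (h.system.control hfx) this]
  refine ⟨y, fun n => ?_, ?_⟩
  · rw [hit n]
    refine ⟨(h.control n).subset ((h.control n).par_mem _ (hinv n)), ?_⟩
    have h5 := (h.control n).edist_le 0 (ζ n) (by simpa using by linarith) (hinv n)
    have h6 : par (c (f^[n] e.proj)) (f^[n] e.proj) 0 = f^[n] e.proj := by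
      have := par_crd (h.control n) (h.control n).mem
      simpa [crd] using this
    rw [h6, zero_sub, norm_neg] at h5
    refine h5.trans (ENNReal.ofReal_le_ofReal ?_)
    calc K * ‖ζ n‖ ≤ K * (4 * K ^ 2 * |s| * speed f n e) := by gcongr; exact hζ' n
      _ = (4 * K ^ 3 * |s|) * 1 * speed f n e := by ring
      _ ≤ ε * τ ^ n * speed f n e := by
        have := h.speed_pos n
        have := h.size_pos
        gcongr
        exact one_le_pow₀ hτ
  · rw [← hζ0]; rfl

theorem isShadow_self : IsShadow f U τ ε e e.proj := fun n =>
  ⟨h.system.orbit_mem h.orbit_mem n, by simp⟩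

omit h in
theorem height_self : height Φ e e.proj = 0 := by simp [height]

/-- The height is Lipschitz on shadowing points. Combined with `edist_le` this gives the contraction
of the arc relative to the initial distance, and the fact that nearby shadowing points have small
height. -/
theorem abs_height_sub_le {y y' : S} (hy : IsShadow f U τ ε e y) (hy' : IsShadow f U τ ε e y')
    {t : ℝ} (ht : 0 ≤ t) (hyy' : edist y y' ≤ ENNReal.ofReal t) :
    |height Φ e y - height Φ e y'| ≤ 2 * K ^ 2 * t := by
  have hK := h.one_le_const
  have hK0 : 0 < K := by linarith
  have h1 := (h.control 0).norm_crd_sub_le y y' (h.edist_le_inv hy 0) (h.edist_le_inv hy' 0) t ht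
    hyy'
  have h2 := h.orbit.lipDeriv_h.norm_remainder_le hK0 le_rfl (h.norm_shadow_le_inv hy 0)
    (h.norm_shadow_le_inv hy' 0)
  have e1 := h.localHeight_crd (h.shadow_mem hy 0)
  have e2 := h.localHeight_crd (h.shadow_mem hy' 0)
  simp only [Function.iterate_zero, id_eq] at h1 h2 e1 e2
  rw [e1, e2, mul_inv_cancel₀ hK0.ne', one_mul, sub_sub_sub_comm, ← map_sub] at h2
  set ξ := crd (c e.proj) e.proj y - crd (c e.proj) e.proj y'
  have h3 : ‖localDHeight Φ c e 0 ξ‖ ≤ K * ‖ξ‖ :=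
    ContinuousLinearMap.le_of_opNorm_le _ h.orbit.lipDeriv_h.norm_le _
  have h5 := norm_sub_norm_le (height Φ e y - height Φ e y') (localDHeight Φ c e 0 ξ)
  have h6 : (K + 1) * ‖ξ‖ ≤ (K + K) * (K * t) := by gcongr
  rw [← Real.norm_eq_abs]
  nlinarith

end GoodVector

end Shadows

end SurfaceStable

/-! ### Differentiability of the arcs of shadowing points -/

namespace SurfaceStable

set_option linter.unusedSectionVars false

section Arcs

open scoped ENNReal NNReal

variable {S : Type*} [EMetricSpace S] [ChartedSpace (EuclideanSpace ℝ (Fin 2)) S]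
  [IsManifold (𝓡 2) ∞ S]

/-- The difference quotients of a map along a family of points, given those of a chart. -/
theorem tendsto_smul_sub_of_chart {G : Type*} [NormedAddCommGroup G] [NormedSpace ℝ G]
    {ι : Type*} {l : Filter ι} {p y : S} {z : ι → S} {a : ι → ℝ} {w : TangentSpace (𝓡 2) y}
    {g : S → G} (hy : y ∈ (extChartAt (𝓡 2) p).source)
    (hg : MDifferentiableAt (𝓡 2) 𝓘(ℝ, G) g y)
    (hz : ∀ᶠ i in l, z i ∈ (extChartAt (𝓡 2) p).source)
    (h0 : Tendsto (fun i => extChartAt (𝓡 2) p (z i) - extChartAt (𝓡 2) p y) l (𝓝 0))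
    (ha : Tendsto (fun i => a i • (extChartAt (𝓡 2) p (z i) - extChartAt (𝓡 2) p y)) l
      (𝓝 (chartDeriv p y w))) :
    Tendsto (fun i => a i • (g (z i) - g y)) l (𝓝 (mfderiv (𝓡 2) 𝓘(ℝ, G) g y w)) := by
  obtain ⟨A, hA, hA'⟩ := hasFDerivAt_inCharts hy hg
  have h1 := (hA.hasFDerivWithinAt (s := univ)).lim h0 (by simp) ha
  have h2 : A (chartDeriv p y w) = mfderiv (𝓡 2) 𝓘(ℝ, G) g y w := hA' w
  rw [h2] at h1
  refine h1.congr' ?_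
  filter_upwards [hz] with i hi
  simp only [add_sub_cancel, Function.comp_apply, (extChartAt (𝓡 2) p).left_inv hi,
    (extChartAt (𝓡 2) p).left_inv hy]

/-- A curve with a derivative in a chart is differentiable. -/
theorem velocity_eq {φ : ℝ → S} {p : S} {t : ℝ} (ht : t ∈ Icc (-1 : ℝ) 1)
    (hφ : ∀ u ∈ Icc (-1 : ℝ) 1, φ u ∈ (extChartAt (𝓡 2) p).source) {w : TangentSpace (𝓡 2) (φ t)}
    (hd : HasDerivWithinAt (extChartAt (𝓡 2) p ∘ φ) (chartDeriv p (φ t) w) (Icc (-1) 1) t) :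
    velocity φ t = ⟨φ t, w⟩ := by
  have h1 : MDifferentiableAt 𝓘(ℝ, Plane) (𝓡 2) (extChartAt (𝓡 2) p).symm
      ((extChartAt (𝓡 2) p ∘ φ) t) :=
    ((contMDiffOn_extChartAt_symm (n := 1) p).contMDiffAt ((isOpen_extChartAt_target p).mem_nhds
      ((extChartAt (𝓡 2) p).map_source (hφ t ht)))).mdifferentiableAt one_ne_zero
  have h2 : MDifferentiableWithinAt 𝓘(ℝ, ℝ) 𝓘(ℝ, Plane) (extChartAt (𝓡 2) p ∘ φ) (Icc (-1) 1) t :=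
    mdifferentiableWithinAt_iff_differentiableWithinAt.2 hd.differentiableWithinAt
  have h3 : MDifferentiableWithinAt 𝓘(ℝ, ℝ) (𝓡 2) φ (Icc (-1) 1) t := by
    refine (h1.comp_mdifferentiableWithinAt t h2).congr (fun u hu => ?_) ?_
    · exact ((extChartAt (𝓡 2) p).left_inv (hφ u hu)).symm
    · exact ((extChartAt (𝓡 2) p).left_inv (hφ t ht)).symm
  have h4 := hasDerivWithinAt_chart_comp h3 (hφ t ht)
  have h5 := (uniqueDiffOn_Icc (show (-1 : ℝ) < 1 by norm_num) t ht).eq_deriv _ h4 hd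
  have h6 := (chartDeriv_bijective (hφ t ht)).1 h5
  rw [← h6]
  rfl

/-- In the chart, the derivative of the curve is the coordinate of its velocity, so continuity in
the tangent bundle gives the C¹ property. -/
theorem contMDiffOn_of_continuousOn_velocity {φ : ℝ → S} {p : S}
    (hφ : ∀ u ∈ Icc (-1 : ℝ) 1, φ u ∈ (extChartAt (𝓡 2) p).source)
    (hd : ∀ t ∈ Icc (-1 : ℝ) 1, ∃ w : TangentSpace (𝓡 2) (φ t),
      HasDerivWithinAt (extChartAt (𝓡 2) p ∘ φ) (chartDeriv p (φ t) w) (Icc (-1) 1) t)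
    (hc : ContinuousOn (velocity φ) (Icc (-1) 1)) :
    ContMDiffOn 𝓘(ℝ, ℝ) (𝓡 2) 1 φ (Icc (-1) 1) := by
  have hu : UniqueDiffOn ℝ (Icc (-1 : ℝ) 1) := uniqueDiffOn_Icc (by norm_num)
  have h1 : ContDiffOn ℝ 1 (extChartAt (𝓡 2) p ∘ φ) (Icc (-1) 1) := by
    rw [contDiffOn_one_iff_derivWithin hu]
    refine ⟨fun t ht => ?_, ?_⟩
    · obtain ⟨w, hw⟩ := hd t ht
      exact hw.differentiableWithinAt
    · have h2 : ContinuousOn (fun t => tcrd p (velocity φ t)) (Icc (-1) 1) := fun t ht =>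
        tendsto_tcrd (hφ t ht) (hc t ht)
      refine h2.congr fun t ht => ?_
      obtain ⟨w, hw⟩ := hd t ht
      change _ = tcrd p (velocity φ t)
      rw [hw.derivWithin (hu t ht), velocity_eq ht hφ hw]
      rfl
  refine ((contMDiffOn_extChartAt_symm (n := 1) p).comp h1.contMDiffOn
    fun t ht => (extChartAt (𝓡 2) p).map_source (hφ t ht)).congr fun t ht => ?_
  exact ((extChartAt (𝓡 2) p).left_inv (hφ t ht)).symm

variable [RiemannianBundle (fun x : S => TangentSpace (𝓡 2) x)]
variable {G : Type*} [NormedAddCommGroup G] [InnerProductSpace ℝ G]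

variable {U V Λ : Set S} {D : Set (DiffeoInto U V)} {c : S → S} {P : Finset S} {Q : S → Set S}
  {Φ : S → G} {K : ℝ} {σ σ' ρ ρ' τ ε r : ℝ}

/-- A curve of points asymptotic to the base point of `e`, parametrized by the height. -/
def IsShadowArc (f : S → S) (U : Set S) (τ ε : ℝ) (Φ : S → G) (e : TangentBundle (𝓡 2) S) (r : ℝ)
    (φ : ℝ → S) : Prop :=
  ∀ t ∈ Icc (-1 : ℝ) 1, IsShadow f U τ ε e (φ t) ∧ height Φ e (φ t) = r * t

/-- A vector whose iterates decay like those of `e`, with prescribed height. -/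
structure IsShadowTangent (f : S → S) (Φ : S → G) (e : TangentBundle (𝓡 2) S) (B r : ℝ)
    (W : TangentBundle (𝓡 2) S) : Prop where
  speed_le : ∀ n : ℕ, speed f n W ≤ B * speed f n e
  dheight_eq : dheight Φ e W = r

namespace GoodVector

variable {f : DiffeoInto U V} {e : TangentBundle (𝓡 2) S}
variable (h : GoodVector Λ D c P Q Φ K σ ρ ρ' τ ε f e)
include h

/-- The difference of two such vectors still grows slowly and has derivative of height 0, so
`speed_le_of_slow_growth` at n = 0 kills it. -/
theorem tangent_unique {y : S} (hy : IsShadow f U τ ε e y) {w w' : TangentSpace (𝓡 2) y}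
    {B B' : ℝ} (hw : IsShadowTangent f Φ e B r ⟨y, w⟩) (hw' : IsShadowTangent f Φ e B' r ⟨y, w'⟩) :
    w = w' := by
  have hyU : ∀ k, f^[k] y ∈ U := fun k => (hy k).1
  have hτ := h.one_le
  have hK := h.one_le_const
  have hB : 0 ≤ B + B' := by
    have h1 := (speed_nonneg f 0 _).trans (hw.speed_le 0)
    have h2 := (speed_nonneg f 0 _).trans (hw'.speed_le 0)
    have h3 := h.speed_pos 0
    nlinarith
  have h1 := h.speed_le_of_slow_growth (W := ⟨y, w - w'⟩) hy (X := B + B') (fun n => by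
    have h2 := hw.speed_le n
    have h3 := hw'.speed_le n
    rw [f.speed_eq hyU] at h2 h3 ⊢
    rw [map_sub]
    refine (norm_sub_le _ _).trans ((add_le_add h2 h3).trans ?_)
    rw [← add_mul]
    have := h.speed_pos n
    gcongr
    exact le_mul_of_one_le_right hB (one_le_pow₀ hτ)) 0
  have h2 : dheight Φ e ⟨y, w - w'⟩ = 0 := by
    have h3 := hw.dheight_eq.trans hw'.dheight_eq.symm
    simp only [dheight, tderiv] at h3 ⊢
    rw [map_sub]
    refine (inner_sub_right _ _ _).trans ?_
    exact sub_eq_zero.2 h3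
  rw [h2, abs_zero, mul_zero] at h1
  have h3 : ‖w - w'‖ ≤ 0 := h1
  exact sub_eq_zero.1 (norm_le_zero_iff.1 h3)

variable {φ : ℝ → S} (hr : 0 < r) (hφ : IsShadowArc f U τ ε Φ e r φ)
include hr hφ

omit hr in
theorem arc_mem_source : ∀ u ∈ Icc (-1 : ℝ) 1, φ u ∈ (extChartAt (𝓡 2) (c e.proj)).source :=
  fun u hu => (h.control 0).subset_source (h.shadow_mem (hφ u hu).1 0)

/-- Holding at every time n, this makes the difference quotients precompact (n = 0) and makes all
their limits decay at the rate of e. -/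
theorem norm_slope_le {t t' : ℝ} (ht : t ∈ Icc (-1 : ℝ) 1) (ht' : t' ∈ Icc (-1 : ℝ) 1) (n : ℕ) :
    ‖extChartAt (𝓡 2) (c (f^[n] e.proj)) (f^[n] (φ t')) -
      extChartAt (𝓡 2) (c (f^[n] e.proj)) (f^[n] (φ t))‖ ≤
      4 * K ^ 4 * r * speed f n e * |t' - t| := by
  have hK := h.one_le_const
  have h1 := h.edist_le (hφ t' ht').1 (hφ t ht).1 n
  rw [(hφ t' ht').2, (hφ t ht).2, ← mul_sub, abs_mul, abs_of_pos hr] at h1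
  have hs := h.speed_pos n
  have h2 := (h.control n).norm_crd_sub_le _ _ (h.edist_le_inv (hφ t' ht').1 n)
    (h.edist_le_inv (hφ t ht).1 n) _ (by positivity) h1
  rw [crd, crd, sub_sub_sub_cancel_right] at h2
  exact h2.trans (le_of_eq (by ring))

/-- Limits of difference quotients of an arc of asymptotic points. -/
theorem exists_tangent_of_ultrafilter {t : ℝ} (ht : t ∈ Icc (-1 : ℝ) 1) {l : Ultrafilter ℝ}
    (hl : ↑l ≤ 𝓝[Icc (-1) 1 \ {t}] t) :
    ∃ w : TangentSpace (𝓡 2) (φ t), IsShadowTangent f Φ e (4 * K ^ 5 * r) r ⟨φ t, w⟩ ∧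
      Tendsto (slope (extChartAt (𝓡 2) (c e.proj) ∘ φ) t) l
        (𝓝 (chartDeriv (c e.proj) (φ t) w)) := by
  have hK := h.one_le_const
  have hmem : ∀ᶠ u in (l : Filter ℝ), u ∈ Icc (-1 : ℝ) 1 \ {t} := hl self_mem_nhdsWithin
  have hlt : Tendsto (fun u : ℝ => u) l (𝓝 t) := hl.trans nhdsWithin_le_nhds
  have hsl : ∀ n, ∀ᶠ u in (l : Filter ℝ), ‖(u - t)⁻¹ •
      (extChartAt (𝓡 2) (c (f^[n] e.proj)) (f^[n] (φ u)) -
        extChartAt (𝓡 2) (c (f^[n] e.proj)) (f^[n] (φ t)))‖ ≤ 4 * K ^ 4 * r * speed f n e := by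
    intro n
    filter_upwards [hmem] with u hu
    have hut : 0 < |u - t| := abs_pos.2 (sub_ne_zero.2 hu.2)
    rw [norm_smul, norm_inv, Real.norm_eq_abs, inv_mul_le_iff₀ hut, mul_comm |u - t|]
    exact h.norm_slope_le hr hφ ht hu.1 n
  have hsl0 := hsl 0
  simp only [Function.iterate_zero, id_eq] at hsl0
  have hball : ∀ᶠ u in (l : Filter ℝ), (u - t)⁻¹ • (extChartAt (𝓡 2) (c e.proj) (φ u) -
      extChartAt (𝓡 2) (c e.proj) (φ t)) ∈
      Metric.closedBall (0 : Plane) (4 * K ^ 4 * r * speed f 0 e) := by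
    filter_upwards [hsl0] with u hu using mem_closedBall_zero_iff.2 hu
  obtain ⟨v, -, hv⟩ := (isCompact_closedBall (0 : Plane) _).ultrafilter_le_nhds
    (l.map fun u => (u - t)⁻¹ • (extChartAt (𝓡 2) (c e.proj) (φ u) -
      extChartAt (𝓡 2) (c e.proj) (φ t))) (le_principal_iff.2 hball)
  have hsrc := h.arc_mem_source hφ
  obtain ⟨w, hw⟩ := (chartDeriv_bijective (hsrc t ht)).2 v
  have hv' : Tendsto (fun u => (u - t)⁻¹ • (extChartAt (𝓡 2) (c e.proj) (φ u) -
      extChartAt (𝓡 2) (c e.proj) (φ t))) l (𝓝 (chartDeriv (c e.proj) (φ t) w)) := by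
    rw [hw]; exact hv
  have hzero : Tendsto (fun u => extChartAt (𝓡 2) (c e.proj) (φ u) -
      extChartAt (𝓡 2) (c e.proj) (φ t)) l (𝓝 0) := by
    refine squeeze_zero_norm' (a := fun u => 4 * K ^ 4 * r * speed f 0 e * |u - t|) ?_ ?_
    · filter_upwards [hmem] with u hu using h.norm_slope_le hr hφ ht hu.1 0
    · have : Tendsto (fun u : ℝ => 4 * K ^ 4 * r * speed f 0 e * |u - t|) l
          (𝓝 (4 * K ^ 4 * r * speed f 0 e * |t - t|)) :=
        ((hlt.sub_const t).abs).const_mul _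
      simpa using this
  refine ⟨w, ⟨fun n => ?_, ?_⟩, hv'⟩
  -- The limit of difference quotients is pushed forward by fⁿ read in the n-th chart, where
  -- `norm_slope_le` bounds it.
  · have hyU : ∀ k, f^[k] (φ t) ∈ U := fun k => ((hφ t ht).1 k).1
    have hmq := h.shadow_mem (hφ t ht).1 n
    have h1 : MDifferentiableAt (𝓡 2) 𝓘(ℝ, Plane) (extChartAt (𝓡 2) (c (f^[n] e.proj)))
        (f^[n] (φ t)) :=
      mdifferentiableAt_extChartAt (by simpa using (h.control n).subset_source hmq)
    have h2 := f.mdifferentiableAt_iterate (y := φ t) (n := n) fun k _ => hyU k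
    have h3 := tendsto_smul_sub_of_chart (hsrc t ht) (h1.comp (φ t) h2) (by
      filter_upwards [hmem] with u hu using hsrc u hu.1) hzero hv'
    have h4 := le_of_tendsto h3.norm (hsl n)
    have h5 : mfderiv (𝓡 2) 𝓘(ℝ, Plane) (extChartAt (𝓡 2) (c (f^[n] e.proj)) ∘ f^[n]) (φ t) w =
        orbitVec f c e.proj n ⟨φ t, w⟩ := by
      rw [mfderiv_comp (φ t) h1 h2, orbitVec,
        f.tangentMap_iterate (W := ⟨φ t, w⟩) fun k _ => hyU k]
      rfl
    rw [h5] at h4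
    have h6 := h.system.speed_le_norm_orbitVec h.orbit_mem (W := ⟨φ t, w⟩) hmq
    calc _ ≤ K * (4 * K ^ 4 * r * speed f n e) := h6.trans (by gcongr)
      _ = _ := by ring
  · have h1 := tendsto_smul_sub_of_chart (hsrc t ht) (h.system.contMDiff.mdifferentiableAt
      (by simp) (x := φ t)) (by filter_upwards [hmem] with u hu using hsrc u hu.1) hzero hv'
    have h2 := ((innerSL ℝ (tderiv Φ e)).continuous.tendsto _).comp h1
    refine tendsto_nhds_unique h2 (tendsto_const_nhds.congr' ?_)
    filter_upwards [hmem] with u hu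
    have e1 := (hφ u hu.1).2
    have e2 := (hφ t ht).2
    have hut : u - t ≠ 0 := sub_ne_zero.2 hu.2
    simp only [height, inner_sub_right] at e1 e2
    simp only [Function.comp_apply, innerSL_apply_apply, inner_smul_right, inner_sub_right]
    have e3 : inner ℝ (tderiv Φ e) (Φ (φ u)) - inner ℝ (tderiv Φ e) (Φ (φ t)) = r * (u - t) := by
      linarith
    rw [e3]
    field_simp

theorem exists_hasDerivWithinAt {t : ℝ} (ht : t ∈ Icc (-1 : ℝ) 1) :
    ∃ w : TangentSpace (𝓡 2) (φ t), IsShadowTangent f Φ e (4 * K ^ 5 * r) r ⟨φ t, w⟩ ∧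
      HasDerivWithinAt (extChartAt (𝓡 2) (c e.proj) ∘ φ) (chartDeriv (c e.proj) (φ t) w)
        (Icc (-1) 1) t := by
  have hne : (𝓝[Icc (-1) 1 \ {t}] t).NeBot := by
    have := (uniqueDiffOn_Icc (show (-1 : ℝ) < 1 by norm_num) t ht).accPt
    rwa [accPt_principal_iff_nhdsWithin] at this
  obtain ⟨w, hw, -⟩ := h.exists_tangent_of_ultrafilter hr hφ ht
    (Ultrafilter.of_le (𝓝[Icc (-1) 1 \ {t}] t))
  refine ⟨w, hw, ?_⟩
  -- Every ultrafilter yields a limit vector with the same decay and the same derivative of height,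
  -- hence the same vector, so the slopes converge.
  rw [hasDerivWithinAt_iff_tendsto_slope, tendsto_iff_ultrafilter]
  intro l hl
  obtain ⟨w', hw', hlim⟩ := h.exists_tangent_of_ultrafilter hr hφ ht hl
  rwa [h.tangent_unique (hφ t ht).1 hw hw']

theorem velocity_mem {t : ℝ} (ht : t ∈ Icc (-1 : ℝ) 1) :
    ∃ w : TangentSpace (𝓡 2) (φ t), velocity φ t = ⟨φ t, w⟩ ∧
      IsShadowTangent f Φ e (4 * K ^ 5 * r) r ⟨φ t, w⟩ := by
  obtain ⟨w, hw, hd⟩ := h.exists_hasDerivWithinAt hr hφ ht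
  exact ⟨w, velocity_eq ht (h.arc_mem_source hφ) hd, hw⟩

end GoodVector

end Arcs

end SurfaceStable

/-! ### Continuous dependence of the arcs -/

namespace SurfaceStable

set_option linter.unusedSectionVars false

section ArcContinuity

open scoped ENNReal NNReal

variable {S : Type*} [EMetricSpace S] [ChartedSpace (EuclideanSpace ℝ (Fin 2)) S]
  [IsManifold (𝓡 2) ∞ S]
variable [RiemannianBundle (fun x : S => TangentSpace (𝓡 2) x)]
  [IsContinuousRiemannianBundle (EuclideanSpace ℝ (Fin 2)) (fun x : S => TangentSpace (𝓡 2) x)]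
variable {G : Type*} [NormedAddCommGroup G] [InnerProductSpace ℝ G]

variable {U V Λ : Set S} {D : Set (DiffeoInto U V)} {c : S → S} {P : Finset S} {Q : S → Set S}
  {Φ : S → G} {K : ℝ} {σ σ' ρ ρ' τ : ℝ}

/-- A single compact subset of U contains the orbits of all shadowing points, so their limits still
have orbits in U. -/
theorem UniformSystem.exists_isCompact (hs : UniformSystem Λ D c P Q Φ K) :
    ∃ Z : Set S, IsCompact Z ∧ Z ⊆ U ∧ ∀ x ∈ Λ, Q (c x) ⊆ Z := by
  refine ⟨⋃ p ∈ (P : Set S) ∩ c '' Λ, Q p,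
    (P.finite_toSet.inter_of_left _).isCompact_biUnion ?_, iUnion₂_subset ?_, fun x hx =>
    subset_biUnion_of_mem (u := Q) ⟨hs.charts.mem x hx, mem_image_of_mem c hx⟩⟩
  · rintro _ ⟨-, x, hx, rfl⟩
    exact (hs.control hx).isCompact
  · rintro _ ⟨-, x, hx, rfl⟩
    exact (hs.control hx).subset

theorem tendsto_height (hΦ : ContMDiff (𝓡 2) 𝓘(ℝ, G) ∞ Φ) {ι : Type*} {l : Filter ι}
    {e : ι → TangentBundle (𝓡 2) S} {e₀ : TangentBundle (𝓡 2) S} (he : Tendsto e l (𝓝 e₀))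
    {y : ι → S} {y₀ : S} (hy : Tendsto y l (𝓝 y₀)) :
    Tendsto (fun i => height Φ (e i) (y i)) l (𝓝 (height Φ e₀ y₀)) :=
  (((continuous_tderiv hΦ).tendsto e₀).comp he).inner
    (((hΦ.continuous.tendsto y₀).comp hy).sub ((hΦ.continuous.tendsto _).comp (tendsto_proj he)))

theorem tendsto_dheight (hΦ : ContMDiff (𝓡 2) 𝓘(ℝ, G) ∞ Φ) {ι : Type*} {l : Filter ι}
    {e W : ι → TangentBundle (𝓡 2) S} {e₀ W₀ : TangentBundle (𝓡 2) S} (he : Tendsto e l (𝓝 e₀))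
    (hW : Tendsto W l (𝓝 W₀)) :
    Tendsto (fun i => dheight Φ (e i) (W i)) l (𝓝 (dheight Φ e₀ W₀)) :=
  (((continuous_tderiv hΦ).tendsto e₀).comp he).inner (((continuous_tderiv hΦ).tendsto W₀).comp hW)

/-- Limits of tangent vectors to arcs of asymptotic points. -/
theorem exists_tendsto_shadowTangent {ι : Type*} {l : Ultrafilter ι} {f : ι → DiffeoInto U V}
    {f₀ : DiffeoInto U V} (hf : Tendsto f l (𝓝 f₀)) {e W : ι → TangentBundle (𝓡 2) S}
    {e₀ : TangentBundle (𝓡 2) S} (he : Tendsto e l (𝓝 e₀)) {k ε B r s : ι → ℝ} {ε₀ B₀ r₀ s₀ : ℝ}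
    (hs : UniformSystem Λ D c P Q Φ K) (hx₀ : ∀ n, f₀^[n] e₀.proj ∈ U)
    (hg : ∀ᶠ i in (l : Filter ι), GoodVector Λ D c P Q Φ (k i) σ ρ ρ' τ (ε i) (f i) (e i))
    (hε : Tendsto ε l (𝓝 ε₀)) (hB : Tendsto B l (𝓝 B₀)) (hr : Tendsto r l (𝓝 r₀))
    (hs₀ : Tendsto s l (𝓝 s₀))
    (hW : ∀ᶠ i in (l : Filter ι), IsShadow (f i) U τ (ε i) (e i) (W i).proj)
    (hh : ∀ᶠ i in (l : Filter ι), height Φ (e i) (W i).proj = s i)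
    (hT : ∀ᶠ i in (l : Filter ι), IsShadowTangent (f i) Φ (e i) (B i) (r i) (W i)) :
    ∃ W₀, Tendsto W l (𝓝 W₀) ∧ IsShadow f₀ U τ ε₀ e₀ W₀.proj ∧ height Φ e₀ W₀.proj = s₀ ∧
      IsShadowTangent f₀ Φ e₀ B₀ r₀ W₀ := by
  obtain ⟨Z, hZ, hZU, hQZ⟩ := hs.exists_isCompact
  have hmemZ : ∀ n, ∀ᶠ i in (l : Filter ι), (f i)^[n] (W i).proj ∈ Z := fun n => by
    filter_upwards [hg, hW] with i hi hWi
    exact hQZ _ (hi.orbit_mem n) (hi.shadow_mem hWi n)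
  obtain ⟨y, hyZ, hy⟩ := hZ.ultrafilter_le_nhds (l.map fun i => (W i).proj)
    (le_principal_iff.2 (hmemZ 0))
  have hy' : Tendsto (fun i => (W i).proj) l (𝓝 y) := hy
  have hbd : ∀ᶠ i in (l : Filter ι), ‖(W i).2‖ ≤ B₀ * ‖e₀.2‖ + 1 := by
    have h1 := (hB.mul (tendsto_norm_snd he)).eventually_lt_const (lt_add_one _)
    filter_upwards [h1, hT] with i hi hTi
    exact (hTi.speed_le 0).trans hi.le
  obtain ⟨w, hw⟩ := exists_tendsto_of_norm_le hy' hbd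
  -- The n-th iterates converge only once the earlier limits are known to lie in U, hence strong
  -- induction; closedness of Z then gives the next one.
  have hyU : ∀ n, f₀^[n] y ∈ Z := by
    intro n
    induction n using Nat.strong_induction_on with
    | _ n ih =>
      have h1 := tendsto_proj (tendsto_tangentMap_iterate hf hw (n := n) fun k hk => hZU (ih k hk))
      simp only [tangentMap_iterate_proj] at h1
      exact hZ.isClosed.mem_of_tendsto h1 (hmemZ n)
  have hWn : ∀ n, Tendsto (fun i => (tangentMap (𝓡 2) (𝓡 2) (f i))^[n] (W i)) l
      (𝓝 ((tangentMap (𝓡 2) (𝓡 2) f₀)^[n] ⟨y, w⟩)) := fun n =>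
    tendsto_tangentMap_iterate hf hw fun k _ => hZU (hyU k)
  have hen : ∀ n, Tendsto (fun i => (tangentMap (𝓡 2) (𝓡 2) (f i))^[n] (e i)) l
      (𝓝 ((tangentMap (𝓡 2) (𝓡 2) f₀)^[n] e₀)) := fun n =>
    tendsto_tangentMap_iterate hf he fun k _ => hx₀ k
  refine ⟨⟨y, w⟩, hw, fun n => ⟨hZU (hyU n), ?_⟩, ?_, fun n => ?_, ?_⟩
  · have h1 := tendsto_proj (hWn n)
    have h2 := tendsto_proj (hen n)
    simp only [tangentMap_iterate_proj] at h1 h2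
    refine le_of_tendsto_of_tendsto (h2.edist h1) ((ENNReal.continuous_ofReal.tendsto _).comp
      ((hε.mul_const (τ ^ n)).mul (tendsto_norm_snd (hen n)))) ?_
    filter_upwards [hW] with i hi using (hi n).2
  · refine tendsto_nhds_unique (tendsto_height hs.contMDiff he hy') (hs₀.congr' ?_)
    filter_upwards [hh] with i hi using hi.symm
  · refine le_of_tendsto_of_tendsto (tendsto_norm_snd (hWn n))
      (hB.mul (tendsto_norm_snd (hen n))) ?_
    filter_upwards [hT] with i hi using hi.speed_le n
  · refine tendsto_nhds_unique (tendsto_dheight hs.contMDiff he hw) (hr.congr' ?_)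
    filter_upwards [hT] with i hi using hi.dheight_eq.symm

/-- The velocities of the arcs of asymptotic points depend continuously on all the parameters. -/
theorem GoodVector.tendsto_velocity {ι : Type*} {l : Ultrafilter ι} {f : ι → DiffeoInto U V}
    {f₀ : DiffeoInto U V} (hf : Tendsto f l (𝓝 f₀)) {e : ι → TangentBundle (𝓡 2) S}
    {e₀ : TangentBundle (𝓡 2) S} (he : Tendsto e l (𝓝 e₀)) {k ε r t : ι → ℝ} {k₀ ε₀ r₀ t₀ : ℝ}
    (hg₀ : GoodVector Λ D c P Q Φ k₀ σ ρ ρ' τ ε₀ f₀ e₀)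
    (hg : ∀ᶠ i in (l : Filter ι), GoodVector Λ D c P Q Φ (k i) σ ρ ρ' τ (ε i) (f i) (e i))
    (hk : Tendsto k l (𝓝 k₀)) (hε : Tendsto ε l (𝓝 ε₀)) (hr : Tendsto r l (𝓝 r₀))
    (ht : Tendsto t l (𝓝 t₀)) (hr₀ : 0 < r₀) {φ : ι → ℝ → S} {φ₀ : ℝ → S}
    (hφ₀ : IsShadowArc f₀ U τ ε₀ Φ e₀ r₀ φ₀)
    (hφ : ∀ᶠ i in (l : Filter ι), IsShadowArc (f i) U τ (ε i) Φ (e i) (r i) (φ i))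
    (hti : ∀ᶠ i in (l : Filter ι), t i ∈ Icc (-1 : ℝ) 1) :
    Tendsto (fun i => velocity (φ i) (t i)) l (𝓝 (velocity φ₀ t₀)) := by
  have ht₀ : t₀ ∈ Icc (-1 : ℝ) 1 := isClosed_Icc.mem_of_tendsto ht hti
  have hri : ∀ᶠ i in (l : Filter ι), 0 < r i := hr.eventually_const_lt hr₀
  have hprop : ∀ᶠ i in (l : Filter ι), (velocity (φ i) (t i)).proj = φ i (t i) ∧
      IsShadowTangent (f i) Φ (e i) (4 * k i ^ 5 * r i) (r i) (velocity (φ i) (t i)) := by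
    filter_upwards [hg, hφ, hti, hri] with i hi hφi hti hri
    obtain ⟨w, hw, hw'⟩ := hi.velocity_mem hri hφi hti
    exact ⟨by rw [hw], by rw [hw]; exact hw'⟩
  obtain ⟨⟨y, w⟩, hlim, hy, hyh, hw⟩ := exists_tendsto_shadowTangent hf he hg₀.system
    (hg₀.system.orbit_mem hg₀.orbit_mem) hg hε (((hk.pow 5).const_mul 4).mul hr) hr (hr.mul ht)
    (by filter_upwards [hprop, hφ, hti] with i hi hφi hti; rw [hi.1]; exact (hφi _ hti).1)
    (by filter_upwards [hprop, hφ, hti] with i hi hφi hti; rw [hi.1]; exact (hφi _ hti).2)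
    (hprop.mono fun i hi => hi.2)
  obtain rfl : y = φ₀ t₀ :=
    hg₀.eq_of_height_eq hy (hφ₀ t₀ ht₀).1 (hyh.trans (hφ₀ t₀ ht₀).2.symm)
  obtain ⟨w₀, hv, hw₀⟩ := hg₀.velocity_mem hr₀ hφ₀ ht₀
  rw [hv, hg₀.tangent_unique hy hw₀ hw]
  exact hlim

/-- The arcs of asymptotic points are embedded. -/
theorem GoodVector.isC1Arc {f : DiffeoInto U V} {e : TangentBundle (𝓡 2) S} {ε r : ℝ}
    (h : GoodVector Λ D c P Q Φ K σ ρ ρ' τ ε f e) (hr : 0 < r) {φ : ℝ → S}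
    (hφ : IsShadowArc f U τ ε Φ e r φ) : IsC1Arc φ := by
  refine ⟨contMDiffOn_of_continuousOn_velocity (h.arc_mem_source hφ) (fun t ht => ?_)
    fun t ht => ?_, fun t ht t' ht' htt' => ?_, fun t ht h0 => ?_⟩
  · obtain ⟨w, -, hw⟩ := h.exists_hasDerivWithinAt hr hφ ht
    exact ⟨w, hw⟩
  · rw [ContinuousWithinAt, tendsto_iff_ultrafilter]
    intro l hl
    exact h.tendsto_velocity (f := fun _ => f) (e := fun _ => e) (t := fun u => u)
      (φ := fun _ => φ) tendsto_const_nhds tendsto_const_nhds (Eventually.of_forall fun _ => h)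
      tendsto_const_nhds tendsto_const_nhds tendsto_const_nhds (hl.trans nhdsWithin_le_nhds) hr hφ
      (Eventually.of_forall fun _ => hφ) (hl self_mem_nhdsWithin)
  · have := (hφ t ht).2
    rw [htt', (hφ t' ht').2] at this
    exact (mul_left_cancel₀ hr.ne' this).symm
  · obtain ⟨w, hw, hw'⟩ := h.velocity_mem hr hφ ht
    rw [hw] at h0
    have h1 := hw'.dheight_eq
    have h2 : w = 0 := h0
    rw [h2, dheight, tderiv, tderiv] at h1
    refine hr.ne ?_
    rw [← h1]
    refine (inner_zero_right (𝕜 := ℝ) (tderiv Φ e)).symm.trans (congrArg _ ?_)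
    exact (map_zero (mfderiv (𝓡 2) 𝓘(ℝ, G) Φ (φ t))).symm

end ArcContinuity

end SurfaceStable

/-! ### Stable sets, sizes and rates -/

namespace SurfaceStable

set_option linter.unusedSectionVars false

section StableSets

open scoped ENNReal NNReal

variable {S : Type*} [EMetricSpace S] [ChartedSpace (EuclideanSpace ℝ (Fin 2)) S]
  [IsManifold (𝓡 2) ∞ S]
variable [RiemannianBundle (fun x : S => TangentSpace (𝓡 2) x)]
variable {G : Type*} [NormedAddCommGroup G] [InnerProductSpace ℝ G]

variable {U V Λ : Set S} {D : Set (DiffeoInto U V)} {c : S → S} {P : Finset S} {Q : S → Set S}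
  {Φ : S → G} {K : ℝ} {σ σ' ρ ρ' τ ε r : ℝ}

open Classical in
/-- The arc of the asymptotic points, parametrized by the height. -/
noncomputable def shadowArc (f : S → S) (U : Set S) (τ ε : ℝ) (Φ : S → G)
    (e : TangentBundle (𝓡 2) S) (r t : ℝ) : S :=
  if h : ∃ y, IsShadow f U τ ε e y ∧ height Φ e y = r * t then h.choose else e.proj

/-- The asymptotic points of height at most `r`. -/
def stableSet (f : S → S) (U : Set S) (τ ε : ℝ) (Φ : S → G) (e : TangentBundle (𝓡 2) S) (r : ℝ) :
    Set S := {y | IsShadow f U τ ε e y ∧ |height Φ e y| ≤ r}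

/-- Changing the sign of e changes only the sign of the height, so the set depends only on the line
spanned by e. -/
theorem stableSet_neg (f : DiffeoInto U V) {x : S} (hx : ∀ k, f^[k] x ∈ U)
    (e : TangentSpace (𝓡 2) x) :
    stableSet f U τ ε Φ ⟨x, -e⟩ r = stableSet f U τ ε Φ ⟨x, e⟩ r := by
  have h1 : ∀ n, speed f n ⟨x, -e⟩ = speed f n ⟨x, e⟩ := fun n => by
    rw [f.speed_eq hx, f.speed_eq hx, map_neg, norm_neg]
  have h2 : tderiv Φ ⟨x, -e⟩ = -tderiv Φ ⟨x, e⟩ := map_neg (mfderiv (𝓡 2) 𝓘(ℝ, G) Φ x) e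
  ext y
  simp only [stableSet, IsShadow, height, h1, h2, inner_neg_left, abs_neg]

namespace GoodVector

variable {f : DiffeoInto U V} {e : TangentBundle (𝓡 2) S}

theorem isShadowArc (h : GoodVector Λ D c P Q Φ K σ ρ ρ' τ ε f e) (hr : 0 < r)
    (hrε : 4 * K ^ 3 * r ≤ ε) :
    IsShadowArc f U τ ε Φ e r (shadowArc f U τ ε Φ e r) := by
  intro t ht
  have hK := h.one_le_const
  have hex : ∃ y, IsShadow f U τ ε e y ∧ height Φ e y = r * t := by
    refine h.exists_shadow (le_trans ?_ hrε)
    rw [abs_mul, abs_of_pos hr]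
    have : |t| ≤ 1 := abs_le.2 ht
    have h1 : r * |t| ≤ r * 1 := by gcongr
    rw [mul_one] at h1
    gcongr
  rw [shadowArc, dif_pos hex]
  exact hex.choose_spec

theorem image_arc (h : GoodVector Λ D c P Q Φ K σ ρ ρ' τ ε f e) (hr : 0 < r) {φ : ℝ → S}
    (hφ : IsShadowArc f U τ ε Φ e r φ) : φ '' Icc (-1) 1 = stableSet f U τ ε Φ e r := by
  ext y
  constructor
  · rintro ⟨t, ht, rfl⟩
    refine ⟨(hφ t ht).1, ?_⟩
    rw [(hφ t ht).2, abs_mul, abs_of_pos hr]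
    exact mul_le_of_le_one_right hr.le (abs_le.2 ht)
  · rintro ⟨hy, hyr⟩
    have ht : height Φ e y / r ∈ Icc (-1 : ℝ) 1 := by
      rw [mem_Icc, ← abs_le, abs_div, abs_of_pos hr]
      exact div_le_one_of_le₀ hyr hr.le
    refine ⟨_, ht, h.eq_of_height_eq (hφ _ ht).1 hy ?_⟩
    rw [(hφ _ ht).2]
    field_simp

theorem arc_zero (h : GoodVector Λ D c P Q Φ K σ ρ ρ' τ ε f e) {φ : ℝ → S}
    (hφ : IsShadowArc f U τ ε Φ e r φ) : φ 0 = e.proj := by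
  have h0 : (0 : ℝ) ∈ Icc (-1 : ℝ) 1 := by simp
  refine h.eq_of_height_eq (hφ 0 h0).1 h.isShadow_self ?_
  rw [(hφ 0 h0).2, mul_zero, height_self]

/-- The multiple of e with derivative of height r decays like e, so by uniqueness it is the velocity
at x. -/
theorem velocity_zero (h : GoodVector Λ D c P Q Φ K σ ρ ρ' τ ε f e) (hr : 0 < r) {φ : ℝ → S}
    (hφ : IsShadowArc f U τ ε Φ e r φ) (hn : ‖e.2‖ = 1) :
    ∃ a : ℝ, velocity φ 0 = ⟨e.proj, a • e.2⟩ := by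
  have hK := h.one_le_const
  have hx := h.system.orbit_mem h.orbit_mem
  have hm : 0 < dheight Φ e e := by
    rw [dheight, real_inner_self_eq_norm_sq]
    refine (inv_pos.2 ?_).trans_le (h.system.le_tderiv e ⟨h.orbit_mem 0, hn⟩)
    linarith
  obtain ⟨w, hw, hw'⟩ := h.velocity_mem hr hφ (t := 0) (by simp)
  rw [hw]
  have h0 := h.arc_zero hφ
  revert w
  rw [h0]
  intro w _ hw'
  set a := r / dheight Φ e e with ha
  have hsp : ∀ n, speed f n ⟨e.proj, a • e.2⟩ = |a| * speed f n e := fun n => by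
    have := f.speed_eq (n := n) hx e.2
    rw [f.speed_eq hx, map_smul, norm_smul, ← this]
    rfl
  refine ⟨a, congrArg _ (h.tangent_unique h.isShadow_self hw' (B' := |a|)
    ⟨fun n => (hsp n).le, ?_⟩)⟩
  have h1 : tderiv Φ ⟨e.proj, a • e.2⟩ = a • tderiv Φ e :=
    map_smul (mfderiv (𝓡 2) 𝓘(ℝ, G) Φ e.proj) a e.2
  rw [dheight, h1, inner_smul_right, ha]
  exact div_mul_cancel₀ r hm.ne'

/-- The asymptotic points of small height form a stable manifold. -/
theorem isStableManifold [IsContinuousRiemannianBundle (EuclideanSpace ℝ (Fin 2))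
    (fun x : S => TangentSpace (𝓡 2) x)] {x : S} {v : TangentSpace (𝓡 2) x}
    (h : GoodVector Λ D c P Q Φ K σ ρ ρ' τ ε f ⟨x, v⟩) (hr : 0 < r) (hrε : 4 * K ^ 3 * r ≤ ε)
    (hσ1 : σ < 1) (hτ1 : 1 < τ) (hn : ‖v‖ = 1) {E : Submodule ℝ (TangentSpace (𝓡 2) x)}
    (hv : v ∈ E) (hE : ∀ n, normAlong f n x E = speed f n ⟨x, v⟩) :
    IsStableManifold f U x E (stableSet f U τ ε Φ ⟨x, v⟩ r) := by
  have hK := h.one_le_const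
  have hφ := h.isShadowArc hr hrε
  -- The constant 8 K⁵ is the product of 4 K³ from `edist_le` and 2 K² from `abs_height_sub_le`. In
  -- κ, the bound ε makes y a shadowing point and r / (2 K²) brings its height below r.
  refine ⟨⟨_, h.isC1Arc hr hφ, h.image_arc hr hφ, ?_⟩, fun n y hy => (hy.1 n).1,
    ⟨8 * K ^ 5, σ, h.rate_pos, hσ1, fun n y hy z hz => ?_⟩, fun τ' hτ' => ⟨4 * K ^ 3 * r,
    fun n y hy => ?_⟩, ⟨min ε (r / (2 * K ^ 2)), τ, lt_min h.size_pos (by positivity), hτ1,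
    fun y hy => ?_⟩⟩
  · obtain ⟨a, ha⟩ := h.velocity_zero hr hφ hn
    exact ⟨a • v, E.smul_mem a hv, ha⟩
  · have htop : edist y z ≠ ⊤ :=
      ne_top_of_le_ne_top ENNReal.ofReal_ne_top (h.edist_le hy.1 hz.1 0)
    have h1 := h.abs_height_sub_le hy.1 hz.1 (t := (edist y z).toReal) ENNReal.toReal_nonneg
      (ENNReal.ofReal_toReal htop).ge
    rw [← ENNReal.ofReal_toReal htop, ← ENNReal.ofReal_mul (by have := h.rate_pos; positivity)]
    refine (h.edist_le hy.1 hz.1 n).trans (ENNReal.ofReal_le_ofReal ?_)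
    have h2 := h.speed_pos n
    have h3 := h.rate_pos
    calc _ ≤ 4 * K ^ 3 * σ ^ n * (2 * K ^ 2 * (edist y z).toReal) := by
          gcongr
          exact h.speed_le n
      _ = _ := by ring
  · have h1 := h.edist_le h.isShadow_self hy.1 n
    have h2 : |height Φ ⟨x, v⟩ x - height Φ ⟨x, v⟩ y| ≤ r := by
      have h3 : height Φ ⟨x, v⟩ x = 0 := height_self
      rw [h3, zero_sub, abs_neg]; exact hy.2
    refine h1.trans (ENNReal.ofReal_le_ofReal ?_)
    rw [hE]
    have h3 := h.speed_pos n
    calc _ ≤ 4 * K ^ 3 * speed f n ⟨x, v⟩ * r := by gcongr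
      _ = 4 * K ^ 3 * r * 1 * speed f n ⟨x, v⟩ := by ring
      _ ≤ _ := by gcongr; exact one_le_pow₀ hτ'.le
  · have hsh : IsShadow f U τ ε ⟨x, v⟩ y := fun n => by
      refine ⟨(hy n).1, (hy n).2.trans (ENNReal.ofReal_le_ofReal ?_)⟩
      rw [hE]
      have h3 := h.speed_pos n
      gcongr
      exact min_le_left _ _
    refine ⟨hsh, ?_⟩
    have h1 := (hy 0).2
    rw [hE, pow_zero, mul_one] at h1
    have h2 : speed f 0 ⟨x, v⟩ = 1 := hn
    rw [h2, mul_one] at h1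
    have h3 := h.abs_height_sub_le h.isShadow_self hsh (t := r / (2 * K ^ 2)) (by positivity)
      (h1.trans (ENNReal.ofReal_le_ofReal (min_le_right _ _)))
    have h4 : height Φ ⟨x, v⟩ x = 0 := height_self
    change |height Φ ⟨x, v⟩ x - _| ≤ _ at h3
    rw [h4, zero_sub, abs_neg] at h3
    refine h3.trans (le_of_eq ?_)
    field_simp

end GoodVector

/-- The constant of the Lyapunov–Perron argument, in terms of the minimal expansion of a map. -/
noncomputable def sysConst (K : ℝ) (f : S → S) (Λ : Set S) : ℝ := K ^ 8 * (1 + (minNorm f Λ)⁻¹)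

/-- The size of the neighborhoods of orbits in which the Lyapunov–Perron argument applies. -/
noncomputable def shadowSize (σ ρ ρ' τ k : ℝ) : ℝ :=
  min (perronRadius k (decayRate σ ρ ρ' τ)) (perronRadius k (decayRate σ ρ ρ' 1)) / k ^ 2

/-- The size of the stable manifolds. -/
noncomputable def arcSize (σ ρ ρ' τ k : ℝ) : ℝ := shadowSize σ ρ ρ' τ k / (4 * k ^ 3)

theorem continuousAt_perronRadius {k θ : ℝ} (hk : 1 ≤ k) (hθ : θ < 1) :
    ContinuousAt (fun k => perronRadius k θ) k := by
  have h := one_le_shearConst hθ (B := k ^ 3) (by positivity)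
  have h' : 4 * k ^ 5 * shearConst (k ^ 3) θ ≠ 0 := by positivity
  unfold perronRadius
  refine ContinuousAt.inv₀ ?_ h'
  unfold shearConst
  fun_prop

theorem continuousAt_shadowSize {k : ℝ} (hk : 1 ≤ k) (hθ : decayRate σ ρ ρ' τ < 1)
    (hθ' : decayRate σ ρ ρ' 1 < 1) : ContinuousAt (shadowSize σ ρ ρ' τ) k :=
  ((continuousAt_perronRadius hk hθ).min (continuousAt_perronRadius hk hθ')).div
    (continuousAt_id.pow 2) (by positivity)

theorem continuousAt_arcSize {k : ℝ} (hk : 1 ≤ k) (hθ : decayRate σ ρ ρ' τ < 1)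
    (hθ' : decayRate σ ρ ρ' 1 < 1) : ContinuousAt (arcSize σ ρ ρ' τ) k :=
  (continuousAt_shadowSize hk hθ hθ').div ((continuousAt_id.pow 3).const_mul 4)
    (by positivity)

theorem shadowSize_pos {k : ℝ} (hk : 1 ≤ k) (hθ : decayRate σ ρ ρ' τ < 1)
    (hθ' : decayRate σ ρ ρ' 1 < 1) : 0 < shadowSize σ ρ ρ' τ k :=
  div_pos (lt_min (perronRadius_pos hk hθ) (perronRadius_pos hk hθ')) (by positivity)

/-- The numerical assumptions on the rates. -/
structure GoodRates (σ σ' ρ ρ' τ : ℝ) : Prop where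
  pos : 0 < σ
  lt_one : σ < 1
  pos' : 0 < σ'
  pinch_pos : 0 < ρ'
  pinch_le : ρ' ≤ ρ
  pinch_lt_one : ρ < 1
  one_lt : 1 < τ
  mul_le_one : τ * σ ≤ 1
  mul_lt_one : τ * ρ < 1
  decay_lt : decayRate σ ρ ρ' τ < 1
  decay_lt' : decayRate σ ρ ρ' 1 < 1

/-- The hypothesis with σ' ≤ σ gives σρ < ρ', that is, decay rate less than 1 at τ = 1. The
conditions on τ are open there, so they persist for some τ > 1. -/
theorem exists_goodRates (hσ : σ ∈ Ioo (0 : ℝ) 1) (hσ' : 0 < σ') (hρ : ρ ∈ Ioo (0 : ℝ) 1)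
    (hρ' : 0 < ρ') (hpinch : σ < σ' * ρ' / (σ * ρ)) (hσσ' : σ' ≤ σ) (hρρ' : ρ' ≤ ρ) :
    ∃ τ, GoodRates σ σ' ρ ρ' τ := by
  have h1 : decayRate σ ρ ρ' 1 < 1 := by
    have h2 : 0 < σ * ρ := mul_pos hσ.1 hρ.1
    rw [lt_div_iff₀ h2] at hpinch
    have h3 : σ * (σ * ρ) < σ * ρ' := hpinch.trans_le (by gcongr)
    have h4 := lt_of_mul_lt_mul_left h3 hσ.1.le
    rw [decayRate, one_pow, one_mul, ← mul_assoc, ← div_eq_mul_inv, div_lt_one hρ']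
    exact h4
  have e1 : ∀ᶠ τ in 𝓝 (1 : ℝ), decayRate σ ρ ρ' τ < 1 := by
    have : ContinuousAt (decayRate σ ρ ρ') 1 := by unfold decayRate; fun_prop
    exact this.eventually_lt_const h1
  have e2 : ∀ᶠ τ in 𝓝 (1 : ℝ), τ * σ < 1 := by
    have : ContinuousAt (fun τ : ℝ => τ * σ) 1 := by fun_prop
    exact this.eventually_lt_const (by simpa using hσ.2)
  have e3 : ∀ᶠ τ in 𝓝 (1 : ℝ), τ * ρ < 1 := by
    have : ContinuousAt (fun τ : ℝ => τ * ρ) 1 := by fun_prop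
    exact this.eventually_lt_const (by simpa using hρ.2)
  have e4 := ((e1.and (e2.and e3)).filter_mono (nhdsWithin_le_nhds (s := Ioi (1 : ℝ)))).and
    self_mem_nhdsWithin
  obtain ⟨τ, ⟨h5, h6, h7⟩, h8⟩ := e4.exists
  exact ⟨τ, hσ.1, hσ.2, hσ', hρ', hρρ', hρ.2, h8, h6.le, h7, h5, h1⟩

theorem DiffeoInto.minNorm_pos_of_mem [IsContinuousRiemannianBundle (EuclideanSpace ℝ (Fin 2))
    (fun x : S => TangentSpace (𝓡 2) x)] (f : DiffeoInto U V) (hΛ : IsCompact Λ) (hΛU : Λ ⊆ U)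
    {e : TangentBundle (𝓡 2) S} (hx : ∀ k, f^[k] e.proj ∈ Λ)
    (he : IsPinchedVector f σ σ' ρ ρ' e) : 0 < minNorm f Λ :=
  f.minNorm_pos hΛ hΛU ⟨e, hx 0, he.norm_eq⟩

/-- The division by k² in `shadowSize` pays for passing from distances and speeds on S to norms in
charts. -/
theorem UniformSystem.goodVector [IsContinuousRiemannianBundle (EuclideanSpace ℝ (Fin 2))
    (fun x : S => TangentSpace (𝓡 2) x)] (hs : UniformSystem Λ D c P Q Φ K)
    (hg : GoodRates σ σ' ρ ρ' τ) {f : DiffeoInto U V} (hf : f ∈ D) {e : TangentBundle (𝓡 2) S}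
    (hx : ∀ k, f^[k] e.proj ∈ Λ) (he : IsPinchedVector f σ σ' ρ ρ' e) (hJ : 0 < minNorm f Λ) :
    GoodVector Λ D c P Q Φ (sysConst K f Λ) σ ρ ρ' τ (shadowSize σ ρ ρ' τ (sysConst K f Λ)) f e := by
  have hK := hs.one_le
  have hKk : K ≤ sysConst K f Λ := by
    have h1 : 0 < (minNorm f Λ)⁻¹ := inv_pos.2 hJ
    calc K ≤ K ^ 8 := le_self_pow₀ hK (by norm_num)
      _ ≤ _ := le_mul_of_one_le_right (by positivity) (by linarith)
  have hk : 1 ≤ sysConst K f Λ := hK.trans hKk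
  have hk2 : sysConst K f Λ ^ 2 * shadowSize σ ρ ρ' τ (sysConst K f Λ) =
      min (perronRadius (sysConst K f Λ) (decayRate σ ρ ρ' τ))
        (perronRadius (sysConst K f Λ) (decayRate σ ρ ρ' 1)) := by
    rw [shadowSize]
    field_simp
  refine ⟨hs.mono hKk, hf, hx, fun n => (pow_pos hg.pos' n).trans_le (he.le_speed n), he.speed_le,
    hs.pinchedOrbit hf hx he hg.pos' (hg.pinch_pos.trans_le hg.pinch_le) hg.pinch_pos hJ le_rfl,
    hg.pos, hg.lt_one.le, hg.pinch_pos, hg.pinch_le, hg.pinch_lt_one.le, hg.one_lt.le,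
    hg.mul_le_one, hg.mul_lt_one, hg.decay_lt, hg.decay_lt',
    shadowSize_pos hk hg.decay_lt hg.decay_lt', ?_, ?_⟩
  · rw [hk2]; exact min_le_left _ _
  · rw [hk2]; exact min_le_right _ _

end StableSets

end SurfaceStable

/-! ### The stable manifolds and their continuity -/

namespace SurfaceStable

set_option linter.unusedSectionVars false

section Main

variable {S : Type*} [EMetricSpace S] [ChartedSpace (EuclideanSpace ℝ (Fin 2)) S]
  [IsManifold (𝓡 2) ∞ S]
variable [RiemannianBundle (fun x : S => TangentSpace (𝓡 2) x)]
  [IsContinuousRiemannianBundle (EuclideanSpace ℝ (Fin 2)) (fun x : S => TangentSpace (𝓡 2) x)]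
variable {G : Type*} [NormedAddCommGroup G] [InnerProductSpace ℝ G]

variable {U V Λ : Set S} {D : Set (DiffeoInto U V)} {c : S → S} {P : Finset S} {Q : S → Set S}
  {Φ : S → G} {K : ℝ} {σ σ' ρ ρ' τ : ℝ}

theorem UniformSystem.one_le_sysConst (hs : UniformSystem Λ D c P Q Φ K) {f : DiffeoInto U V}
    (hJ : 0 < minNorm f Λ) : 1 ≤ sysConst K f Λ := by
  have hK := hs.one_le
  have h1 : 0 < (minNorm f Λ)⁻¹ := inv_pos.2 hJ
  exact one_le_mul_of_one_le_of_one_le (one_le_pow₀ hK) (by linarith)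

/-- The stable manifold of `x`. -/
def stableManifold (σ σ' ρ ρ' τ K : ℝ) (Λ : Set S) (Φ : S → G) (f : DiffeoInto U V) (x : S) :
    Set S :=
  {y | ∃ e : TangentSpace (𝓡 2) x, IsPinchedVector f σ σ' ρ ρ' ⟨x, e⟩ ∧
    y ∈ stableSet f U τ (shadowSize σ ρ ρ' τ (sysConst K f Λ)) Φ ⟨x, e⟩
      (arcSize σ ρ ρ' τ (sysConst K f Λ))}

theorem IsPinchedVector.eq_or_eq_neg {f : DiffeoInto U V} {x : S} (hx : ∀ k, f^[k] x ∈ U)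
    (hρ : 0 ≤ ρ) (hρ1 : ρ < 1) {e w : TangentSpace (𝓡 2) x}
    (he : IsPinchedVector f σ σ' ρ ρ' ⟨x, e⟩) (hw : IsPinchedVector f σ σ' ρ ρ' ⟨x, w⟩) :
    w = e ∨ w = -e := by
  have h1 := he.eq_inner_smul hx hρ hρ1 hw.sq_le
  have h2 : ‖w‖ = 1 := hw.norm_eq
  have h3 : ‖e‖ = 1 := he.norm_eq
  rw [h1, norm_smul, h3, mul_one, Real.norm_eq_abs] at h2
  rcases (abs_eq zero_le_one).1 h2 with h | h
  · left; rw [h1, h, one_smul]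
  · right; rw [h1, h, neg_one_smul]

theorem IsPinchedVector.neg {f : DiffeoInto U V} {x : S} (hx : ∀ k, f^[k] x ∈ U)
    {e : TangentSpace (𝓡 2) x} (he : IsPinchedVector f σ σ' ρ ρ' ⟨x, e⟩) :
    IsPinchedVector f σ σ' ρ ρ' ⟨x, -e⟩ := by
  have h1 : ∀ n, speed f n ⟨x, -e⟩ = speed f n ⟨x, e⟩ := fun n => by
    rw [f.speed_eq hx, f.speed_eq hx, map_neg, norm_neg]
  refine ⟨(norm_neg e).trans he.norm_eq, fun n => ?_, fun n => ?_, he.absDet_pos, fun n => ?_,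
    fun n => ?_⟩ <;> rw [h1]
  exacts [he.le_speed n, he.speed_le n, he.le_sq n, he.sq_le n]

/-- Pinched unit vectors at x are unique up to sign, and opposite vectors define the same set, so
the manifold is independent of the choice. -/
theorem stableManifold_eq {f : DiffeoInto U V} {x : S} (hx : ∀ k, f^[k] x ∈ U)
    (hρ : 0 ≤ ρ) (hρ1 : ρ < 1) {e : TangentSpace (𝓡 2) x}
    (he : IsPinchedVector f σ σ' ρ ρ' ⟨x, e⟩) :
    stableManifold σ σ' ρ ρ' τ K Λ Φ f x =
      stableSet f U τ (shadowSize σ ρ ρ' τ (sysConst K f Λ)) Φ ⟨x, e⟩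
        (arcSize σ ρ ρ' τ (sysConst K f Λ)) := by
  ext y
  constructor
  · rintro ⟨w, hw, hy⟩
    rcases he.eq_or_eq_neg hx hρ hρ1 hw with rfl | rfl
    · exact hy
    · rwa [stableSet_neg f hx] at hy
  · exact fun hy => ⟨e, he, hy⟩

/-- Pinched vectors accumulate on pinched vectors. -/
theorem IsPinchedVector.exists_tendsto {ι : Type*} {l : Ultrafilter ι}
    {f : ι → DiffeoInto U V} {f₀ : DiffeoInto U V} (hf : Tendsto f l (𝓝 f₀)) {x : ι → S} {x₀ : S}
    (hxl : Tendsto x l (𝓝 x₀)) {v : ∀ i, TangentSpace (𝓡 2) (x i)} {e : TangentSpace (𝓡 2) x₀}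
    (hx : ∀ᶠ i in (l : Filter ι), ∀ k, (f i)^[k] (x i) ∈ U) (hx₀ : ∀ k, f₀^[k] x₀ ∈ U)
    (hρ : 0 ≤ ρ) (hρ1 : ρ < 1)
    (hp : ∀ᶠ i in (l : Filter ι), IsPinchedVector (f i) σ σ' ρ ρ' ⟨x i, v i⟩)
    (he : IsPinchedVector f₀ σ σ' ρ ρ' ⟨x₀, e⟩) :
    ∃ v₀ : TangentSpace (𝓡 2) x₀, Tendsto (fun i => (⟨x i, v i⟩ : TangentBundle (𝓡 2) S)) l
      (𝓝 ⟨x₀, v₀⟩) ∧ (v₀ = e ∨ v₀ = -e) := by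
  obtain ⟨v₀, hv₀⟩ := exists_tendsto_of_norm_le (W := fun i => ⟨x i, v i⟩) (C := 1) hxl
    (hp.mono fun i hi => hi.norm_eq.le)
  obtain ⟨h1, h2⟩ := IsPinchedVector.limit_eq_inner_smul hf hv₀ hx hx₀ hρ hρ1 hp he
  have h3 : ‖e‖ = 1 := he.norm_eq
  refine ⟨v₀, hv₀, ?_⟩
  rw [h2, norm_smul, h3, mul_one, Real.norm_eq_abs] at h1
  rcases (abs_eq zero_le_one).1 h1 with h | h
  · left; rw [h2, h, one_smul]
  · right; rw [h2, h, neg_one_smul]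

theorem dheight_neg {W : TangentBundle (𝓡 2) S} {x : S} (e : TangentSpace (𝓡 2) x) :
    dheight Φ W ⟨x, -e⟩ = -dheight Φ W ⟨x, e⟩ := by
  have h : tderiv Φ ⟨x, -e⟩ = -tderiv Φ ⟨x, e⟩ := map_neg (mfderiv (𝓡 2) 𝓘(ℝ, G) Φ x) e
  rw [dheight, h, inner_neg_right, dheight]

theorem continuousAt_sysConst (hΛ : IsCompact Λ) (hΛU : Λ ⊆ U) {f : DiffeoInto U V}
    (hJ : 0 < minNorm f Λ) : ContinuousAt (fun f : DiffeoInto U V => sysConst K f Λ) f :=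
  (((continuous_minNorm hΛ hΛU).continuousAt.inv₀ hJ.ne').const_add 1).const_mul _

/-- The stable manifolds vary continuously. -/
theorem UniformSystem.variesC1Continuously (hs : UniformSystem Λ D c P Q Φ K)
    (hg : GoodRates σ σ' ρ ρ' τ) (hΛ : IsCompact Λ) (hΛU : Λ ⊆ U) :
    VariesC1Continuously (pinchedPoints D Λ σ σ' ρ ρ')
      (stableManifold (U := U) (V := V) σ σ' ρ ρ' τ K Λ Φ) := by
  have hρ : 0 ≤ ρ := (hg.pinch_pos.trans_le hg.pinch_le).le
  have hρ1 := hg.pinch_lt_one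
  set A := pinchedPoints D Λ σ σ' ρ ρ' with hA
  have hAU : ∀ b ∈ A, ∀ k, b.1^[k] b.2 ∈ U := fun b hb k => hΛU (hb.2.1 k)
  have hAe : ∀ b ∈ A, ∃ e : TangentSpace (𝓡 2) b.2, IsPinchedVector b.1 σ σ' ρ ρ' ⟨b.2, e⟩ := by
    intro b hb
    obtain ⟨E, hE⟩ := hb.2.2
    obtain ⟨e, -, he, -⟩ := hE.exists_vector (hAU b hb) hg.pinch_pos
    exact ⟨e, he⟩
  intro a ha
  obtain ⟨e₀, he₀⟩ := hAe a ha
  set E₀ : TangentBundle (𝓡 2) S := ⟨a.2, e₀⟩ with hE₀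
  have hpos₀ : 0 < dheight Φ E₀ ⟨a.2, e₀⟩ := by
    rw [dheight, real_inner_self_eq_norm_sq]
    have := hs.one_le
    exact (inv_pos.2 (by linarith)).trans_le (hs.le_tderiv E₀ ⟨ha.2.1 0, he₀.norm_eq⟩)
  -- On N the sign of the pairing with the reference vector e₀ distinguishes e from -e. It is a
  -- neighborhood because pinched vectors with zero pairing would accumulate at e₀ or -e₀, whose
  -- pairing is nonzero.
  set N : Set (DiffeoInto U V × S) := {b | b ∈ A → ∀ e : TangentSpace (𝓡 2) b.2,
    IsPinchedVector b.1 σ σ' ρ ρ' ⟨b.2, e⟩ → dheight Φ E₀ ⟨b.2, e⟩ ≠ 0} with hN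
  have hN' : N ∈ 𝓝 a := by
    rw [mem_iff_ultrafilter]
    intro l hl
    by_contra hlN
    have hl' : ∀ᶠ b in (l : Filter _), b ∉ N := Ultrafilter.compl_mem_iff_notMem.2 hlN
    have hex : ∀ b : DiffeoInto U V × S, ∃ v : TangentSpace (𝓡 2) b.2, b ∉ N →
        b ∈ A ∧ IsPinchedVector b.1 σ σ' ρ ρ' ⟨b.2, v⟩ ∧ dheight Φ E₀ ⟨b.2, v⟩ = 0 := by
      intro b
      by_cases hb : b ∈ N
      · exact ⟨0, fun h => absurd hb h⟩
      · simp only [hN, mem_ofPred_eq, not_forall, not_not] at hb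
        obtain ⟨hbA, v, hv, hv'⟩ := hb
        exact ⟨v, fun _ => ⟨hbA, hv, hv'⟩⟩
    choose v hv using hex
    have hla : Tendsto (fun b : DiffeoInto U V × S => b) l (𝓝 a) := hl
    obtain ⟨v₀, hlim, hv₀⟩ := IsPinchedVector.exists_tendsto (v := v) hla.fst_nhds hla.snd_nhds
      (by filter_upwards [hl'] with b hb using hAU b (hv b hb).1) (hAU a ha) hρ hρ1
      (by filter_upwards [hl'] with b hb using (hv b hb).2.1) he₀
    have h0 : dheight Φ E₀ ⟨a.2, v₀⟩ = 0 := by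
      refine tendsto_nhds_unique (tendsto_dheight hs.contMDiff tendsto_const_nhds hlim)
        (tendsto_const_nhds.congr' ?_)
      filter_upwards [hl'] with b hb using (hv b hb).2.2.symm
    rcases hv₀ with rfl | rfl
    · exact hpos₀.ne' h0
    · rw [dheight_neg, neg_eq_zero] at h0
      exact hpos₀.ne' h0
  have hex : ∀ b : DiffeoInto U V × S, ∃ v : TangentSpace (𝓡 2) b.2, b ∈ A →
      IsPinchedVector b.1 σ σ' ρ ρ' ⟨b.2, v⟩ ∧ 0 ≤ dheight Φ E₀ ⟨b.2, v⟩ := by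
    intro b
    by_cases hb : b ∈ A
    · obtain ⟨v, hv⟩ := hAe b hb
      rcases le_total 0 (dheight Φ E₀ ⟨b.2, v⟩) with h | h
      · exact ⟨v, fun _ => ⟨hv, h⟩⟩
      · refine ⟨-v, fun _ => ⟨hv.neg (hAU b hb), ?_⟩⟩
        rw [dheight_neg]
        linarith
    · exact ⟨0, fun h => absurd h hb⟩
  choose v hv using hex
  have hJ : ∀ b ∈ A, 0 < minNorm b.1 Λ := fun b hb =>
    b.1.minNorm_pos_of_mem hΛ hΛU (e := ⟨b.2, v b⟩) hb.2.1 (hv b hb).1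
  have hgood : ∀ b ∈ A, GoodVector Λ D c P Q Φ (sysConst K b.1 Λ) σ ρ ρ' τ
      (shadowSize σ ρ ρ' τ (sysConst K b.1 Λ)) b.1 ⟨b.2, v b⟩ := fun b hb =>
    hs.goodVector hg hb.1 (e := ⟨b.2, v b⟩) hb.2.1 (hv b hb).1 (hJ b hb)
  have hr : ∀ b ∈ A, 0 < arcSize σ ρ ρ' τ (sysConst K b.1 Λ) := fun b hb => by
    have := hs.one_le_sysConst (hJ b hb)
    exact div_pos (shadowSize_pos this hg.decay_lt hg.decay_lt') (by positivity)
  have harc : ∀ b ∈ A, IsShadowArc b.1 U τ (shadowSize σ ρ ρ' τ (sysConst K b.1 Λ)) Φ ⟨b.2, v b⟩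
      (arcSize σ ρ ρ' τ (sysConst K b.1 Λ)) (shadowArc b.1 U τ
        (shadowSize σ ρ ρ' τ (sysConst K b.1 Λ)) Φ ⟨b.2, v b⟩
        (arcSize σ ρ ρ' τ (sysConst K b.1 Λ))) := fun b hb => by
    refine (hgood b hb).isShadowArc (hr b hb) (le_of_eq ?_)
    have := hs.one_le_sysConst (hJ b hb)
    rw [arcSize]
    field_simp
  refine ⟨N, hN', fun b => shadowArc b.1 U τ (shadowSize σ ρ ρ' τ (sysConst K b.1 Λ)) Φ
    ⟨b.2, v b⟩ (arcSize σ ρ ρ' τ (sysConst K b.1 Λ)), fun b hb => ⟨?_, ?_, ?_⟩, ?_⟩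
  · exact (hgood b hb.2).isC1Arc (hr b hb.2) (harc b hb.2)
  · exact (hgood b hb.2).arc_zero (harc b hb.2)
  · rw [(hgood b hb.2).image_arc (hr b hb.2) (harc b hb.2),
      stableManifold_eq (hAU b hb.2) hρ hρ1 (hv b hb.2).1]
  · rintro ⟨b, t⟩ ⟨⟨hbN, hbA⟩, ht⟩
    rw [ContinuousWithinAt, tendsto_iff_ultrafilter]
    intro l hl
    have hmem : ∀ᶠ q in (l : Filter _), q ∈ (N ∩ A) ×ˢ Icc (-1 : ℝ) 1 := hl self_mem_nhdsWithin
    have hlq : Tendsto (fun q : (DiffeoInto U V × S) × ℝ => q) l (𝓝 (b, t)) :=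
      hl.trans nhdsWithin_le_nhds
    have hlb := hlq.fst_nhds
    have hlf := hlb.fst_nhds
    obtain ⟨v₀, hlim, hv₀⟩ := IsPinchedVector.exists_tendsto (f := fun q : (DiffeoInto U V × S) × ℝ =>
      q.1.1) (x := fun q => q.1.2) (v := fun q => v q.1) hlf hlb.snd_nhds
      (by filter_upwards [hmem] with q hq using hAU q.1 hq.1.2) (hAU b hbA) hρ hρ1
      (by filter_upwards [hmem] with q hq using (hv q.1 hq.1.2).1) (hv b hbA).1
    have hvb : v₀ = v b := by
      -- The normalization 0 ≤ `dheight` is closed. A limit -v b would force the pairing of v b to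
      -- vanish, which is excluded on N.
      refine hv₀.resolve_right fun h => ?_
      have h1 : 0 ≤ dheight Φ E₀ ⟨b.2, v₀⟩ := by
        refine ge_of_tendsto (tendsto_dheight hs.contMDiff tendsto_const_nhds hlim) ?_
        filter_upwards [hmem] with q hq using (hv q.1 hq.1.2).2
      rw [h, dheight_neg] at h1
      exact hbN hbA _ (hv b hbA).1 (le_antisymm (by linarith) (hv b hbA).2)
    rw [hvb] at hlim
    have hk : Tendsto (fun q : (DiffeoInto U V × S) × ℝ => sysConst K q.1.1 Λ) l
        (𝓝 (sysConst K b.1 Λ)) := (continuousAt_sysConst hΛ hΛU (hJ b hbA)).tendsto.comp hlf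
    have h1 := hs.one_le_sysConst (hJ b hbA)
    exact GoodVector.tendsto_velocity (f := fun q : (DiffeoInto U V × S) × ℝ => q.1.1)
      (e := fun q => ⟨q.1.2, v q.1⟩) (t := fun q => q.2) hlf hlim (hgood b hbA)
      (by filter_upwards [hmem] with q hq using hgood q.1 hq.1.2) hk
      ((continuousAt_shadowSize h1 hg.decay_lt hg.decay_lt').tendsto.comp hk)
      ((continuousAt_arcSize h1 hg.decay_lt hg.decay_lt').tendsto.comp hk) hlq.snd_nhds
      (hr b hbA) (harc b hbA) (by filter_upwards [hmem] with q hq using harc q.1 hq.1.2)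
      (by filter_upwards [hmem] with q hq using hq.2)

/-- The stable manifold theorem for pinched directions, given uniform bounds. -/
theorem UniformSystem.isStableManifold (hs : UniformSystem Λ D c P Q Φ K)
    (hg : GoodRates σ σ' ρ ρ' τ) (hΛ : IsCompact Λ) (hΛU : Λ ⊆ U) {f : DiffeoInto U V} (hf : f ∈ D)
    {x : S} (hx : ∀ n, f^[n] x ∈ Λ) {E : Submodule ℝ (TangentSpace (𝓡 2) x)}
    (hE : IsPinchedDirection f σ σ' ρ ρ' x E) :
    IsStableManifold f U x E (stableManifold σ σ' ρ ρ' τ K Λ Φ f x) := by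
  have hxU : ∀ k, f^[k] x ∈ U := fun k => hΛU (hx k)
  obtain ⟨e, heE, he, hn⟩ := hE.exists_vector hxU hg.pinch_pos
  have hJ : 0 < minNorm f Λ := f.minNorm_pos_of_mem hΛ hΛU (e := ⟨x, e⟩) hx he
  have hk := hs.one_le_sysConst hJ
  rw [stableManifold_eq hxU (hg.pinch_pos.trans_le hg.pinch_le).le hg.pinch_lt_one he]
  refine (hs.goodVector hg hf (e := ⟨x, e⟩) hx he hJ).isStableManifold ?_ (le_of_eq ?_) hg.lt_one
    hg.one_lt he.norm_eq heE hn
  · exact div_pos (shadowSize_pos hk hg.decay_lt hg.decay_lt') (by positivity)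
  · rw [arcSize]
    field_simp

end Main

end SurfaceStable

theorem mainTheorem7 {S : Type*} [EMetricSpace S] [ChartedSpace (EuclideanSpace ℝ (Fin 2)) S]
    [IsManifold (𝓡 2) ∞ S] [RiemannianBundle (fun x : S => TangentSpace (𝓡 2) x)]
    [IsContMDiffRiemannianBundle (𝓡 2) ∞ (EuclideanSpace ℝ (Fin 2))
      (fun x : S => TangentSpace (𝓡 2) x)]
    [IsRiemannianManifold (𝓡 2) S]
    (Λ U V : Set S) (hΛ : IsCompact Λ) (hU : IsOpen U) (hV : IsOpen V) (hΛU : Λ ⊆ U) (hΛV : Λ ⊆ V)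
    (D : Set (SurfaceStable.DiffeoInto U V)) (hD : SurfaceStable.IsC2Bounded D)
    (σ σ' ρ ρ' : ℝ) (hσ : σ ∈ Ioo (0 : ℝ) 1) (hσ' : σ' ∈ Ioo (0 : ℝ) 1)
    (hρ : ρ ∈ Ioo (0 : ℝ) 1) (hρ' : ρ' ∈ Ioo (0 : ℝ) 1) (hpinch : σ < σ' * ρ' / (σ * ρ)) :
    ∃ W : SurfaceStable.DiffeoInto U V → S → Set S,
      (∀ f ∈ D, ∀ x : S, (∀ n : ℕ, f^[n] x ∈ Λ) → ∀ E : Submodule ℝ (TangentSpace (𝓡 2) x),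
        SurfaceStable.IsPinchedDirection f σ σ' ρ ρ' x E →
          SurfaceStable.IsStableManifold f U x E (W f x)) ∧
      SurfaceStable.VariesC1Continuously
        (SurfaceStable.pinchedPoints D Λ σ σ' ρ ρ') W := by
  have hcont : IsContinuousRiemannianBundle (EuclideanSpace ℝ (Fin 2))
      (fun x : S => TangentSpace (𝓡 2) x) := by
    have h := IsContMDiffRiemannianBundle.exists_contMDiff (IB := 𝓡 2) (n := ∞)
      (F := EuclideanSpace ℝ (Fin 2)) (E := fun x : S => TangentSpace (𝓡 2) x)
    obtain ⟨g, hg, hg'⟩ := h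
    exact ⟨g, hg.continuous, hg'⟩
  -- If either inequality fails, the bounds at n = 1 are incompatible, so there are no pinched
  -- directions and any W will do.
  by_cases hle : σ' ≤ σ ∧ ρ' ≤ ρ
  · obtain ⟨τ, hτ⟩ :=
      SurfaceStable.exists_goodRates hσ hσ'.1 hρ hρ'.1 hpinch hle.1 hle.2
    obtain ⟨c, P, P', Q, Φ, K, hs⟩ := SurfaceStable.exists_uniformSystem hΛ hU hΛU hD
    exact ⟨SurfaceStable.stableManifold σ σ' ρ ρ' τ K Λ Φ,
      fun f hf x hx E hE => hs.isStableManifold hτ hΛ hΛU hf hx hE,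
      hs.variesC1Continuously hτ hΛ hΛU⟩
  · have hempty : ∀ (f : SurfaceStable.DiffeoInto U V) (x : S)
        (E : Submodule ℝ (TangentSpace (𝓡 2) x)),
        ¬ SurfaceStable.IsPinchedDirection f σ σ' ρ ρ' x E := by
      intro f x E hE
      have h1 := hE.contraction 1
      have h2 := hE.pinching 1
      simp only [pow_one] at h1 h2
      exact hle ⟨h1.1.trans h1.2, h2.1.trans h2.2⟩
    refine ⟨fun _ _ => ∅, fun f _ x _ E hE => absurd hE (hempty f x E), fun a ha => ?_⟩
    obtain ⟨E, hE⟩ := ha.2.2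
    exact absurd hE (hempty _ _ _)
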